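/- Let $d\ge 1$, let $\Omega\subset\mathbb{R}^d$ be a bounded domain with $C^\infty$ boundary and outward unit normal $\nu$, let $X\in C^\infty(\mathbb{R}^d;\mathbb{R}^d)$ be a vector field (not necessarily constant), and for $h>0$ put $$P=(hD)^2+i\langle X,hD\rangle=-h^2\Delta+h\langle X,\partial\rangle,\qquad D_j=\tfrac1i\partial_j,\qquad P_z=P-z .$$ A (smooth Dirichlet) quasimode for $z\in\mathbb{C}$ is a family $u=u(h)\in C^\infty(\overline\Omega)$, defined for all sufficiently small $h>0$, with $u|_{\partial\Omega}=0$, $\|u\|_{L^2(\Omega)}=1$ and $P_zu=O_{L^2(\Omega)}(h^\infty)$ as $h\to0^+$. Its essential support $\operatorname{ES}_h(u)$ is the intersection of all closed sets $U\subset\overline\Omega$ such that $(1-\chi)u=O_{L^2(\Omega)}(h^\infty)$ for every $\chi\in C^\infty(\overline\Omega)$ with $\chi\equiv1$ on $U$. Let $x_0\in\partial\Omega$ be a point of the illuminated boundary, i.e. $\langle X(x_0),\nu(x_0)\rangle>0$. 1. If $d\ge2$, then for each $$z\in\{\zeta\in\mathbb{C}:|X(x_0)|^{-2}(\operatorname{Im}\zeta)^2<\operatorname{Re}\zeta\}\setminus\{\langle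 X(x_0),\nu(x_0)\rangle^2/4\}$$ there exists a quasimode $u$ for $z$ with $\operatorname{ES}_h(u)=\{x_0\}$. Moreover, if $\partial\Omega$ and $X$ are real analytic near $x_0$, then $u$ can be chosen such that, in addition, $P_zu=O_{L^2(\Omega)}(e^{-\delta/h})$ as $h\to0^+$ for some $\delta>0$. 2. If $d=1$, then for each $$z\in\{\zeta\in\mathbb{C}:|X(x_0)|^{-2}(\operatorname{Im}\zeta)^2<\operatorname{Re}\zeta\}\setminus\{\zeta\in\mathbb{C}:\operatorname{Im}\zeta=0,\ \operatorname{Re}\zeta\ge\langle X(x_0),\nu(x_0)\rangle^2/4\}$$ there exists $u$ with the same properties (including the exponential error in the real analytic case). -/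

import Mathlib

open Filter MeasureTheory Topology
open scoped ContDiff RealInnerProductSpace

/-- `ℝᵈ` with its Euclidean norm. -/
abbrev Euc (d : ℕ) : Type := EuclideanSpace ℝ (Fin d)

/-- `ρ` is a `Cⁿ` defining function of `Ω` on the set `V`: there `Ω` is `{ρ < 0}` and `dρ ≠ 0`
(so that, for `Ω` and `V` open, `∂Ω` is the hypersurface `{ρ = 0}` in `V`). -/
structure IsDefiningFunctionOn {d : ℕ} (n : WithTop ℕ∞) (Ω V : Set (Euc d)) (ρ : Euc d → ℝ) :
    Prop where
  contDiffOn : ContDiffOn ℝ n ρ V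
  fderiv_ne_zero : ∀ y ∈ V, fderiv ℝ ρ y ≠ 0
  mem_iff : ∀ y ∈ V, (y ∈ Ω ↔ ρ y < 0)

/-- The boundary of `Ω` is of class `Cⁿ` near `x` (`n = ∞`: smooth, `n = ω`: real analytic). -/
def HasBoundaryOfClassNear {d : ℕ} (n : WithTop ℕ∞) (Ω : Set (Euc d)) (x : Euc d) : Prop :=
  ∃ (V : Set (Euc d)) (ρ : Euc d → ℝ), IsOpen V ∧ x ∈ V ∧ IsDefiningFunctionOn n Ω V ρ

/-- A bounded domain (connected open set) with `C^∞` boundary. -/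
structure IsSmoothBoundedDomain {d : ℕ} (Ω : Set (Euc d)) : Prop where
  isOpen : IsOpen Ω
  isConnected : IsConnected Ω
  isBounded : Bornology.IsBounded Ω
  smooth_boundary : ∀ x ∈ frontier Ω, HasBoundaryOfClassNear ∞ Ω x

/-- `ν` is the outward unit normal to `∂Ω` at `x`: the normalized gradient at `x` of a smooth
function defining `Ω` (as `{ρ < 0}`) near the boundary point `x`. -/
def IsOutwardUnitNormal {d : ℕ} (Ω : Set (Euc d)) (x ν : Euc d) : Prop :=
  x ∈ frontier Ω ∧ ∃ (V : Set (Euc d)) (ρ : Euc d → ℝ),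
    IsOpen V ∧ x ∈ V ∧ IsDefiningFunctionOn ∞ Ω V ρ ∧
      ν = ‖gradient ρ x‖⁻¹ • gradient ρ x

/-- `f ∈ C^∞(Ω̄)`: on the closure of `Ω`, `f` agrees with a smooth function on `ℝᵈ`. -/
def SmoothOnClosure {d : ℕ} (Ω : Set (Euc d)) (f : Euc d → ℂ) : Prop :=
  ∃ g : Euc d → ℂ, ContDiff ℝ ∞ g ∧ Set.EqOn f g (closure Ω)

/-- The semiclassical derivative `h D_j = (h / i) ∂_j`. -/
noncomputable def hD {d : ℕ} (h : ℝ) (j : Fin d) (f : Euc d → ℂ) : Euc d → ℂ :=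
  fun x => ((h : ℂ) / Complex.I) * fderiv ℝ f x (EuclideanSpace.single j 1)

/-- The operator `P = (hD)² + i ⟨X, hD⟩`. -/
noncomputable def opP {d : ℕ} (X : Euc d → Euc d) (h : ℝ) (f : Euc d → ℂ) : Euc d → ℂ :=
  fun x => ∑ j, hD h j (hD h j f) x + Complex.I * ∑ j, ((X x j : ℝ) : ℂ) * hD h j f x

/-- The operator `P_z = P - z`. -/
noncomputable def opPz {d : ℕ} (X : Euc d → Euc d) (z : ℂ) (h : ℝ) (f : Euc d → ℂ) :
    Euc d → ℂ :=
  fun x => opP X h f x - z * f x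

/-- `f = O_{L²(Ω)}(F(h))` as `h → 0⁺`. -/
def IsBigOL2 {d : ℕ} (Ω : Set (Euc d)) (f : ℝ → Euc d → ℂ) (F : ℝ → ℝ) : Prop :=
  ∃ C : ℝ, ∀ᶠ h in 𝓝[>] (0 : ℝ),
    eLpNorm (f h) 2 (volume.restrict Ω) ≤ ENNReal.ofReal (C * F h)

/-- `f = O_{L²(Ω)}(h^∞)` as `h → 0⁺`. -/
def IsBigOL2HInfty {d : ℕ} (Ω : Set (Euc d)) (f : ℝ → Euc d → ℂ) : Prop :=
  ∀ N : ℕ, IsBigOL2 Ω f (fun h => h ^ N)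

/-- A family `u(h) ∈ C^∞(Ω̄)`, defined for small `h > 0`, which is a Dirichlet quasimode for `z`:
`P_z u = O_{L²}(h^∞)` in `Ω`, `u = 0` on `∂Ω` and `‖u‖_{L²} = 1`. -/
structure IsSmoothQuasimode {d : ℕ} (Ω : Set (Euc d)) (X : Euc d → Euc d) (z : ℂ)
    (u : ℝ → Euc d → ℂ) : Prop where
  smooth : ∀ᶠ h in 𝓝[>] (0 : ℝ), SmoothOnClosure Ω (u h)
  dirichlet : ∀ᶠ h in 𝓝[>] (0 : ℝ), ∀ x ∈ frontier Ω, u h x = 0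
  normalized : ∀ᶠ h in 𝓝[>] (0 : ℝ), eLpNorm (u h) 2 (volume.restrict Ω) = 1
  almost_solves : IsBigOL2HInfty Ω (fun h => opPz X z h (u h))

/-- The essential support `ES_h(u)`: the intersection of all closed `U ⊆ Ω̄` such that
`(1 - χ) u = O_{L²}(h^∞)` whenever `χ ∈ C^∞(Ω̄)` equals `1` on `U`. (Without closedness, every
`Ω̄ ∖ {p}`, being dense in `Ω̄`, would qualify, and the intersection would always be empty.) -/
def essentialSupport {d : ℕ} (Ω : Set (Euc d)) (u : ℝ → Euc d → ℂ) : Set (Euc d) :=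
  ⋂₀ {U | IsClosed U ∧ U ⊆ closure Ω ∧ ∀ χ : Euc d → ℂ, SmoothOnClosure Ω χ →
    (∀ x ∈ U, χ x = 1) → IsBigOL2HInfty Ω (fun h x => (1 - χ x) * u h x)}

/-! The quasimode is a boundary layer carried by a Gaussian wave packet. Let `ρ` define `Ω` near
`x₀` and put `y = x - x₀`. The ansatz is `u = χ · exp ((κ · y - |y|² / 2) / h) · p (-ρ x, y)` with a
cutoff `χ`, `κ = iξ` for a real tangential `ξ`, and `p (t, y)` polynomial in `y` with coefficients
smooth in `t`. The variables `t` and `y` are treated as independent, so the boundary need not be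
straightened: a solution of the lifted equation is restricted to `t = -ρ x`.

By the chain rule `h ∂ⱼ` becomes `κⱼ + (h ∂ⱼ - yⱼ) - (∂ⱼρ) h ∂ₜ`. Freezing the coefficients at `x₀`
and dropping `h ∂ⱼ - yⱼ` and the term `h Δρ` turns `-P_z` into `|∇ρ|² (h ∂ₜ - l₁) (h ∂ₜ - l₂)`,
where the `|∇ρ| lᵢ` are the roots of `m² + q m + c`, `q = ⟨X, ν⟩` and `c = z - |ξ|² - i ⟨X, ξ⟩`. For
`ξ = (Im z / |X|²) (X - q ν)` the hypothesis on `z` is precisely `(Im c)² < q² Re c`, which together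
with `q > 0` puts both roots in the open left half plane (`exists_roots_re_neg`, `exists_frozenEq`).
Both modes then decay into the domain and a combination of them vanishes at `t = 0`; moreover the
Cauchy problem in `t` is solved with bounds uniform in `h` (`sn_duhamel_le`).

The dropped terms are treated by a Neumann series. In a weighted `ℓ¹` norm of coefficients on a
polydisc of radius `s`, the operator `h ∂ⱼ - yⱼ` costs `h / (s - s') + s` when the radius shrinks to
`s'`. Shrinking `N ≈ δ / h` times by an amount of order `h` keeps every step a contraction by `1/2`,
so the error is `2 ^ (-N)`, exponentially small in `1 / h` (`exists_neumann_bounds`). The smooth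
coefficients `∂ⱼρ`, `X` and `Δρ` are first replaced by Taylor polynomials: against the Gaussian the
error is `O(h^m)` for any prescribed `m`, and exponentially small in the analytic case, with degree
about `1 / h` (`hasApprox_of_contDiffAt`, `hasApprox_of_analyticAt`).

The data `p = 0`, `h ∂ₜ p = 1` at `t = 0` give the Dirichlet condition and `p ≈ t / h`. Thus `|u|`
is bounded below on a ball of radius comparable to `h`, and normalization costs only a power of `h`.
The Gaussian bound gives `ES_h(u) = {x₀}`, and a diagonal choice over the orders of approximation
yields `O(h^∞)`. -/

/-! ### Smooth functions of one real variable -/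

/-- The algebra of smooth functions `ℝ → ℂ`. -/
def smoothSubalgebra : Subalgebra ℂ (ℝ → ℂ) where
  carrier := {f | ContDiff ℝ ∞ f}
  mul_mem' {f g} (hf : ContDiff ℝ ∞ f) (hg : ContDiff ℝ ∞ g) := hf.mul hg
  add_mem' {f g} (hf : ContDiff ℝ ∞ f) (hg : ContDiff ℝ ∞ g) := hf.add hg
  algebraMap_mem' _ := (contDiff_const : ContDiff ℝ ∞ _)

/-- The ring of smooth functions `ℝ → ℂ`. -/
def SmoothFun : Type := smoothSubalgebra

namespace SmoothFun

noncomputable instance : CommRing SmoothFun := inferInstanceAs (CommRing smoothSubalgebra)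

noncomputable instance : Algebra ℂ SmoothFun := inferInstanceAs (Algebra ℂ smoothSubalgebra)

/-- The underlying function. -/
@[coe] def toFun (f : SmoothFun) : ℝ → ℂ := Subtype.val f

instance : Coe SmoothFun (ℝ → ℂ) := ⟨toFun⟩

/-- The smooth function with given underlying function. -/
def mk (f : ℝ → ℂ) (hf : ContDiff ℝ ∞ f) : SmoothFun := Subtype.mk f hf

@[simp] lemma coe_mk (f : ℝ → ℂ) (hf : ContDiff ℝ ∞ f) : (mk f hf : ℝ → ℂ) = f := rfl

@[ext] lemma ext {f g : SmoothFun} (h : ∀ t, (f : ℝ → ℂ) t = (g : ℝ → ℂ) t) : f = g :=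
  Subtype.ext (funext h)

@[simp] lemma coe_zero : ((0 : SmoothFun) : ℝ → ℂ) = 0 := rfl

@[simp] lemma coe_one : ((1 : SmoothFun) : ℝ → ℂ) = 1 := rfl

@[simp] lemma coe_add (f g : SmoothFun) : ((f + g : SmoothFun) : ℝ → ℂ) = f + g := rfl

@[simp] lemma coe_mul (f g : SmoothFun) : ((f * g : SmoothFun) : ℝ → ℂ) = f * g := rfl

@[simp] lemma coe_smul (c : ℂ) (f : SmoothFun) : ((c • f : SmoothFun) : ℝ → ℂ) = c • f := rfl

lemma contDiff (f : SmoothFun) : ContDiff ℝ ∞ (f : ℝ → ℂ) := f.2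

lemma continuous (f : SmoothFun) : Continuous (f : ℝ → ℂ) := f.contDiff.continuous

lemma differentiable (f : SmoothFun) : Differentiable ℝ (f : ℝ → ℂ) :=
  f.contDiff.differentiable (by simp)

/-- Restriction to the unit interval. -/
noncomputable def restr (f : SmoothFun) : C(Set.Icc (0 : ℝ) 1, ℂ) :=
  ⟨fun t => (f : ℝ → ℂ) t, f.continuous.comp continuous_subtype_val⟩

/-- The supremum of `|f|` over the unit interval. -/
noncomputable def sn (f : SmoothFun) : ℝ := ‖f.restr‖

lemma sn_nonneg (f : SmoothFun) : 0 ≤ f.sn := norm_nonneg _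

lemma norm_le_sn (f : SmoothFun) {t : ℝ} (ht : t ∈ Set.Icc (0 : ℝ) 1) :
    ‖(f : ℝ → ℂ) t‖ ≤ f.sn :=
  ContinuousMap.norm_coe_le_norm f.restr ⟨t, ht⟩

lemma sn_le {f : SmoothFun} {K : ℝ} (h : ∀ t ∈ Set.Icc (0 : ℝ) 1, ‖(f : ℝ → ℂ) t‖ ≤ K) :
    f.sn ≤ K :=
  (ContinuousMap.norm_le_of_nonempty f.restr).2 fun t => h t t.2

@[simp] lemma sn_zero : (0 : SmoothFun).sn = 0 :=
  le_antisymm (sn_le fun t _ => by simp) (sn_nonneg _)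

lemma sn_add_le (f g : SmoothFun) : (f + g).sn ≤ f.sn + g.sn :=
  sn_le fun _ ht => (norm_add_le _ _).trans (add_le_add (f.norm_le_sn ht) (g.norm_le_sn ht))

lemma sn_mul_le (f g : SmoothFun) : (f * g).sn ≤ f.sn * g.sn :=
  sn_le fun _ ht => (norm_mul_le _ _).trans
    (mul_le_mul (f.norm_le_sn ht) (g.norm_le_sn ht) (norm_nonneg _) f.sn_nonneg)

lemma sn_smul_le (c : ℂ) (f : SmoothFun) : (c • f).sn ≤ ‖c‖ * f.sn :=
  sn_le fun _ ht => (norm_smul_le c _).trans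
    (mul_le_mul_of_nonneg_left (f.norm_le_sn ht) (norm_nonneg _))

lemma sn_one_le : (1 : SmoothFun).sn ≤ 1 := sn_le fun t _ => by simp

/-- Differentiation. -/
noncomputable def diff : SmoothFun →ₗ[ℂ] SmoothFun where
  toFun f := mk (deriv f) (contDiff_infty_iff_deriv.1 f.contDiff).2
  map_add' f g := ext fun t =>
    deriv_add (f.differentiable t) (g.differentiable t)
  map_smul' c f := ext fun t => by
    simpa using deriv_const_smul c (f.differentiable t)

lemma hasDerivAt (f : SmoothFun) (t : ℝ) :
    HasDerivAt (f : ℝ → ℂ) ((diff f : ℝ → ℂ) t) t :=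
  (f.differentiable t).hasDerivAt

lemma diff_eq {f g : SmoothFun} (h : ∀ t, HasDerivAt (f : ℝ → ℂ) ((g : ℝ → ℂ) t) t) :
    diff f = g := ext fun t => (h t).deriv

/-- Evaluation at `t`. -/
def evalAt (t : ℝ) : SmoothFun →+* ℂ where
  toFun f := (f : ℝ → ℂ) t
  map_one' := rfl
  map_mul' _ _ := rfl
  map_zero' := rfl
  map_add' _ _ := rfl

/-- The function `t ↦ exp (l t)`. -/
noncomputable def expFun (l : ℂ) : SmoothFun :=
  mk (fun t => Complex.exp (l * t)) <| by
    have : ContDiff ℝ ∞ fun t : ℝ => (t : ℂ) := Complex.ofRealCLM.contDiff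
    fun_prop

@[simp] lemma expFun_apply (l : ℂ) (t : ℝ) : (expFun l : ℝ → ℂ) t = Complex.exp (l * t) := rfl

lemma diff_expFun (l : ℂ) : diff (expFun l) = l • expFun l := by
  refine diff_eq fun t => ?_
  have h : HasDerivAt (fun t : ℝ => l * (t : ℂ)) (l * 1) t :=
    (Complex.ofRealCLM.hasDerivAt (x := t)).const_mul l
  have h2 := h.cexp
  rw [mul_one, mul_comm] at h2
  exact h2

lemma sn_expFun_le {l : ℂ} (hl : l.re ≤ 0) : (expFun l).sn ≤ 1 := by
  refine sn_le fun t ht => ?_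
  rw [expFun_apply, Complex.norm_exp]
  simpa using mul_nonpos_of_nonpos_of_nonneg hl ht.1

lemma diff_mul (f g : SmoothFun) : diff (f * g) = diff f * g + f * diff g :=
  diff_eq fun t => (f.hasDerivAt t).mul (g.hasDerivAt t)

/-- The primitive vanishing at `0`. -/
noncomputable def prim : SmoothFun →ₗ[ℂ] SmoothFun where
  toFun f := mk (fun t => ∫ s in (0 : ℝ)..t, (f : ℝ → ℂ) s) <| by
    have h : ∀ t, HasDerivAt (fun t : ℝ => ∫ s in (0 : ℝ)..t, (f : ℝ → ℂ) s) ((f : ℝ → ℂ) t) t :=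
      fun t => (f.continuous).integral_hasStrictDerivAt 0 t |>.hasDerivAt
    refine contDiff_infty_iff_deriv.2 ⟨fun t => (h t).differentiableAt, ?_⟩
    rw [show deriv _ = (f : ℝ → ℂ) from funext fun t => (h t).deriv]
    exact f.contDiff
  map_add' f g := ext fun t =>
    intervalIntegral.integral_add (f.continuous.intervalIntegrable _ _)
      (g.continuous.intervalIntegrable _ _)
  map_smul' c f := ext fun t => by
    simp

lemma diff_prim (f : SmoothFun) : diff (prim f) = f :=
  diff_eq fun t => (f.continuous).integral_hasStrictDerivAt 0 t |>.hasDerivAt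

/-- The operator `h d/dt`. -/
noncomputable def hdiff (h : ℝ) : SmoothFun →ₗ[ℂ] SmoothFun := (h : ℂ) • diff

/-- The solution operator of `h f' = l f + g`, `f 0 = 0`. -/
noncomputable def duhamel (h : ℝ) (l : ℂ) : SmoothFun →ₗ[ℂ] SmoothFun :=
  (h : ℂ)⁻¹ • (LinearMap.mulLeft ℂ (expFun (l / h)) ∘ₗ prim ∘ₗ
    LinearMap.mulLeft ℂ (expFun (-(l / h))))

lemma expFun_mul_neg (l : ℂ) : expFun l * expFun (-l) = 1 :=
  ext fun t => by simp [← Complex.exp_add]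

lemma hdiff_duhamel {h : ℝ} (hh : 0 < h) (l : ℂ) (f : SmoothFun) :
    hdiff h (duhamel h l f) = l • duhamel h l f + f := by
  have h0 : (h : ℂ) ≠ 0 := by exact_mod_cast hh.ne'
  simp only [hdiff, duhamel, LinearMap.smul_apply, LinearMap.comp_apply, LinearMap.mulLeft_apply,
    map_smul, diff_mul, diff_prim, diff_expFun]
  rw [smul_smul, inv_mul_cancel₀ h0, one_smul, ← mul_assoc, expFun_mul_neg, one_mul, smul_mul_assoc,
    smul_smul]
  rfl

@[simp] lemma duhamel_zero (h : ℝ) (l : ℂ) (f : SmoothFun) :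
    (duhamel h l f : ℝ → ℂ) 0 = 0 := by
  simp [duhamel, prim]

/-- The kernel `h⁻¹ exp (l (t - s) / h)` has mass at most `1 / |Re l|` on `s ≤ t`, whatever `h`.
This uniformity is why both characteristic roots must lie in the left half plane. -/
lemma sn_duhamel_le {h : ℝ} (hh : 0 < h) {l : ℂ} (hl : l.re < 0) (f : SmoothFun) :
    (duhamel h l f).sn ≤ (-l.re)⁻¹ * f.sn := by
  refine sn_le fun t ht => ?_
  set a : ℝ := -l.re / h with ha
  have ha0 : 0 < a := div_pos (by linarith) hh
  have hre : ∀ s : ℝ, ‖Complex.exp (-(l / h) * s)‖ = Real.exp (a * s) := fun s => by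
    rw [Complex.norm_exp]
    congr 1
    simp [ha, neg_div]
  have hint : ‖∫ s in (0 : ℝ)..t, Complex.exp (-(l / h) * s) * (f : ℝ → ℂ) s‖
      ≤ ∫ s in (0 : ℝ)..t, f.sn * Real.exp (a * s) := by
    refine intervalIntegral.norm_integral_le_of_norm_le ht.1 (ae_of_all _ fun s hs => ?_)
      (Continuous.intervalIntegrable (by fun_prop) _ _)
    rw [norm_mul, hre, mul_comm]
    exact mul_le_mul_of_nonneg_right (f.norm_le_sn ⟨hs.1.le, hs.2.trans ht.2⟩) (Real.exp_pos _).le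
  have hval : ∫ s in (0 : ℝ)..t, f.sn * Real.exp (a * s) = f.sn * (a⁻¹ * (Real.exp (a * t) - 1)) := by
    rw [intervalIntegral.integral_const_mul, intervalIntegral.integral_comp_mul_left _ ha0.ne',
      integral_exp]
    simp
  have hexp : ‖Complex.exp (l / h * t)‖ = Real.exp (-(a * t)) := by
    rw [Complex.norm_exp]
    congr 1
    simp [ha]; ring
  have : ‖(duhamel h l f : ℝ → ℂ) t‖ = h⁻¹ * (Real.exp (-(a * t)) *
      ‖∫ s in (0 : ℝ)..t, Complex.exp (-(l / h) * s) * (f : ℝ → ℂ) s‖) := by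
    rw [← hexp, ← norm_mul]
    simp [duhamel, prim, abs_of_pos hh]
  rw [this]
  calc _ ≤ h⁻¹ * (Real.exp (-(a * t)) * (f.sn * (a⁻¹ * (Real.exp (a * t) - 1)))) := by
        rw [← hval]; gcongr
    _ = h⁻¹ * a⁻¹ * f.sn * (1 - Real.exp (-(a * t))) := by
        have : Real.exp (-(a * t)) * Real.exp (a * t) = 1 := by rw [← Real.exp_add]; simp
        linear_combination (h⁻¹ * f.sn * a⁻¹) * this
    _ ≤ h⁻¹ * a⁻¹ * f.sn * 1 := by
        have := f.sn_nonneg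
        gcongr
        linarith [Real.exp_pos (-(a * t))]
    _ = (-l.re)⁻¹ * f.sn := by
        rw [ha, mul_one]; congr 1; field_simp

end SmoothFun

/-! ### Polynomials with coefficients in the smooth functions -/

/-- Polynomials in `d` space variables whose coefficients are smooth functions of `t`. -/
abbrev SPoly (d : ℕ) : Type := MvPolynomial (Fin d) SmoothFun

namespace SPoly

open MvPolynomial SmoothFun

variable {d : ℕ}

/-- The weighted `ℓ¹` norm of the coefficients on the polydisc of radius `s`. -/
noncomputable def nm (s : ℝ) (p : SPoly d) : ℝ :=
  ∑ a ∈ p.support, (coeff a p : SmoothFun).sn * s ^ a.degree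

lemma nm_eq_sum {s : ℝ} {p : SPoly d} {A : Finset (Fin d →₀ ℕ)} (h : p.support ⊆ A) :
    nm s p = ∑ a ∈ A, (coeff a p : SmoothFun).sn * s ^ a.degree :=
  Finset.sum_subset h fun _ _ ha => by simp [notMem_support_iff.1 ha]

lemma nm_nonneg {s : ℝ} (hs : 0 ≤ s) (p : SPoly d) : 0 ≤ nm s p :=
  Finset.sum_nonneg fun _ _ => mul_nonneg (sn_nonneg _) (pow_nonneg hs _)

@[simp] lemma nm_zero (s : ℝ) : nm s (0 : SPoly d) = 0 := by simp [nm]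

lemma nm_add_le {s : ℝ} (hs : 0 ≤ s) (p q : SPoly d) : nm s (p + q) ≤ nm s p + nm s q := by
  classical
  rw [nm_eq_sum (support_add (p := p) (q := q)),
    nm_eq_sum (Finset.subset_union_left (s₁ := p.support) (s₂ := q.support)),
    nm_eq_sum (Finset.subset_union_right (s₁ := p.support) (s₂ := q.support)),
    ← Finset.sum_add_distrib]
  refine Finset.sum_le_sum fun a _ => ?_
  rw [← add_mul, coeff_add]
  exact mul_le_mul_of_nonneg_right (sn_add_le _ _) (pow_nonneg hs _)

lemma nm_sum_le {ι : Type*} {s : ℝ} (hs : 0 ≤ s) (A : Finset ι) (f : ι → SPoly d) :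
    nm s (∑ i ∈ A, f i) ≤ ∑ i ∈ A, nm s (f i) :=
  Finset.le_sum_of_subadditive _ (nm_zero s).le (nm_add_le hs) _ _

lemma nm_monomial (s : ℝ) (a : Fin d →₀ ℕ) (f : SmoothFun) :
    nm s (monomial a f) = f.sn * s ^ a.degree := by
  classical
  rw [nm_eq_sum (support_monomial_subset)]
  simp

lemma nm_map_le {s c : ℝ} (hs : 0 ≤ s) {p q : SPoly d}
    (h : ∀ a, (coeff a q : SmoothFun).sn ≤ c * (coeff a p : SmoothFun).sn) :
    nm s q ≤ c * nm s p := by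
  classical
  rw [nm_eq_sum (Finset.subset_union_left (s₁ := p.support) (s₂ := q.support)),
    nm_eq_sum (Finset.subset_union_right (s₁ := p.support) (s₂ := q.support)), Finset.mul_sum]
  refine Finset.sum_le_sum fun a _ => ?_
  rw [← mul_assoc]
  exact mul_le_mul_of_nonneg_right (h a) (pow_nonneg hs _)

lemma nm_smul_le {s : ℝ} (hs : 0 ≤ s) (c : ℂ) (p : SPoly d) : nm s (c • p) ≤ ‖c‖ * nm s p :=
  nm_map_le hs fun _ => sn_smul_le _ _

lemma nm_neg {s : ℝ} (hs : 0 ≤ s) (p : SPoly d) : nm s (-p) ≤ nm s p := by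
  have h : ∀ a, (coeff a (-p) : SmoothFun).sn ≤ 1 * (coeff a p : SmoothFun).sn := fun a => by
    have := sn_smul_le (-1) (coeff a p)
    rwa [neg_smul, one_smul, norm_neg, norm_one, ← coeff_neg] at this
  simpa using nm_map_le hs h

lemma nm_sub_le {s : ℝ} (hs : 0 ≤ s) (p q : SPoly d) : nm s (p - q) ≤ nm s p + nm s q := by
  rw [sub_eq_add_neg]
  exact (nm_add_le hs _ _).trans (add_le_add_right (nm_neg hs q) _)

lemma nm_mono {s s' : ℝ} (hs : 0 ≤ s) (h : s ≤ s') (p : SPoly d) : nm s p ≤ nm s' p :=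
  Finset.sum_le_sum fun _ _ =>
    mul_le_mul_of_nonneg_left (pow_le_pow_left₀ hs h _) (sn_nonneg _)

lemma nm_mul_le {s : ℝ} (hs : 0 ≤ s) (p q : SPoly d) : nm s (p * q) ≤ nm s p * nm s q := by
  classical
  rw [mul_def]
  refine (nm_sum_le hs _ _).trans ((Finset.sum_le_sum fun a _ => nm_sum_le hs _ _).trans ?_)
  rw [nm, nm, Finset.sum_mul_sum]
  refine Finset.sum_le_sum fun a _ => Finset.sum_le_sum fun b _ => ?_
  rw [nm_monomial, map_add, pow_add, mul_mul_mul_comm]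
  exact mul_le_mul_of_nonneg_right (sn_mul_le _ _) (by positivity)

lemma nm_X_le {s : ℝ} (hs : 0 ≤ s) (j : Fin d) : nm s (X j : SPoly d) ≤ s := by
  rw [X, nm_monomial]
  simpa using mul_le_mul_of_nonneg_right sn_one_le hs

lemma nm_C (s : ℝ) (f : SmoothFun) : nm s (C f : SPoly d) = f.sn := by
  rw [C_apply, nm_monomial]; simp

/-- Factor `s ^ k - s' ^ k = (s - s') ∑ s ^ i s' ^ (k - 1 - i)` and bound each summand below by `s'
^ (k - 1)`. -/
lemma mul_pow_pred_le {s s' : ℝ} (hs : 0 ≤ s') (h : s' < s) (k : ℕ) :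
    k * s' ^ (k - 1) * (s - s') ≤ s ^ k := by
  have := (Commute.all s s').mul_geom_sum₂ k
  have h2 : (k : ℝ) * s' ^ (k - 1) ≤ ∑ i ∈ Finset.range k, s ^ i * s' ^ (k - 1 - i) := by
    rw [← nsmul_eq_mul, ← Finset.card_range k, ← Finset.sum_const, Finset.card_range]
    refine Finset.sum_le_sum fun i hi => ?_
    have : i ≤ k - 1 := by have := Finset.mem_range.1 hi; omega
    rw [← pow_sub_mul_pow s' this, mul_comm]
    gcongr
  nlinarith [pow_nonneg hs k, sub_pos.2 h]

/-- The Cauchy estimate: a derivative in `y` is paid for by a loss of radius, monomial by monomial.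
-/
lemma nm_pderiv_le {s s' : ℝ} (hs : 0 ≤ s') (h : s' < s) (j : Fin d) (p : SPoly d) :
    nm s' (pderiv j p) ≤ (s - s')⁻¹ * nm s p := by
  classical
  have hp : pderiv j p = ∑ a ∈ p.support, pderiv j (monomial a (coeff a p)) := by
    conv_lhs => rw [← support_sum_monomial_coeff p]
    rw [map_sum]
  rw [hp]
  refine (nm_sum_le hs _ _).trans ?_
  rw [nm, Finset.mul_sum]
  refine Finset.sum_le_sum fun a _ => ?_
  rw [pderiv_monomial, nm_monomial]
  rcases Nat.eq_zero_or_pos (a j) with h0 | h0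
  · have := sn_nonneg (coeff a p)
    have := sub_pos.2 h
    simp only [h0, Nat.cast_zero, mul_zero, sn_zero, zero_mul]
    have := pow_nonneg (hs.trans h.le) a.degree
    positivity
  have hdeg : (a - Finsupp.single j 1).degree = a.degree - 1 := by
    have : a - Finsupp.single j 1 + Finsupp.single j 1 = a :=
      tsub_add_cancel_of_le (Finsupp.single_le_iff.2 h0)
    conv_rhs => rw [← this]
    simp
  have hle : ((a j : ℕ) : ℝ) ≤ (a.degree : ℕ) := by
    exact_mod_cast Finsupp.le_degree j a
  have hsn : (coeff a p * ((a j : ℕ) : SmoothFun)).sn ≤ a.degree * (coeff a p : SmoothFun).sn := by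
    have : coeff a p * ((a j : ℕ) : SmoothFun) = ((a j : ℕ) : ℂ) • coeff a p := by
      rw [Nat.cast_smul_eq_nsmul, nsmul_eq_mul, mul_comm]
    rw [this]
    refine (sn_smul_le _ _).trans (mul_le_mul_of_nonneg_right ?_ (sn_nonneg _))
    simpa using hle
  rw [hdeg]
  have h3 := mul_pow_pred_le hs h a.degree
  have h4 : 0 < s - s' := sub_pos.2 h
  have h5 := sn_nonneg (coeff a p)
  calc _ ≤ a.degree * (coeff a p : SmoothFun).sn * s' ^ (a.degree - 1) := by gcongr
    _ = (coeff a p : SmoothFun).sn * (a.degree * s' ^ (a.degree - 1)) := by ring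
    _ ≤ (coeff a p : SmoothFun).sn * ((s - s')⁻¹ * s ^ a.degree) := by
        refine mul_le_mul_of_nonneg_left ?_ h5
        rw [inv_mul_eq_div, le_div_iff₀ h4]
        exact h3
    _ = _ := by ring

lemma ite_mem_support (T : SmoothFun →ₗ[ℂ] SmoothFun) (p : SPoly d) (a : Fin d →₀ ℕ)
    [Decidable (a ∈ p.support)] : (if a ∈ p.support then T (coeff a p) else 0) = T (coeff a p) := by
  split_ifs with h
  · rfl
  · rw [notMem_support_iff.1 h, map_zero]

/-- Coefficientwise application of a linear map. -/
noncomputable def lift (T : SmoothFun →ₗ[ℂ] SmoothFun) : SPoly d →ₗ[ℂ] SPoly d where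
  toFun p := ∑ a ∈ p.support, monomial a (T (coeff a p))
  map_add' p q := by
    classical
    ext1 a
    rw [coeff_add]
    simp only [coeff_sum, coeff_monomial, Finset.sum_ite_eq', ite_mem_support]
    rw [coeff_add, map_add]
  map_smul' c p := by
    classical
    ext1 a
    rw [RingHom.id_apply, coeff_smul]
    simp only [coeff_sum, coeff_monomial, Finset.sum_ite_eq', ite_mem_support]
    rw [coeff_smul, map_smul]

@[simp] lemma coeff_lift (T : SmoothFun →ₗ[ℂ] SmoothFun) (p : SPoly d) (a : Fin d →₀ ℕ) :
    coeff a (lift T p) = T (coeff a p) := by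
  classical
  simp only [lift, LinearMap.coe_mk, AddHom.coe_mk, coeff_sum, coeff_monomial, Finset.sum_ite_eq',
    ite_mem_support]

lemma lift_comp (T U : SmoothFun →ₗ[ℂ] SmoothFun) (p : SPoly d) :
    lift T (lift U p) = lift (T ∘ₗ U) p := by
  ext1 a; simp

lemma lift_C (T : SmoothFun →ₗ[ℂ] SmoothFun) (f : SmoothFun) :
    lift T (C f : SPoly d) = C (T f) := by
  classical
  ext1 a
  simp only [coeff_lift, coeff_C]
  split_ifs <;> simp

lemma nm_lift_le {s c : ℝ} (hs : 0 ≤ s) {T : SmoothFun →ₗ[ℂ] SmoothFun}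
    (hT : ∀ f, (T f).sn ≤ c * f.sn) (p : SPoly d) : nm s (lift T p) ≤ c * nm s p :=
  nm_map_le hs fun a => by rw [coeff_lift]; exact hT _

lemma lift_X_mul (T : SmoothFun →ₗ[ℂ] SmoothFun) (j : Fin d) (p : SPoly d) :
    lift T (X j * p) = X j * lift T p := by
  classical
  ext1 a
  rw [coeff_lift, coeff_X_mul', coeff_X_mul']
  split_ifs <;> simp

lemma lift_pderiv (T : SmoothFun →ₗ[ℂ] SmoothFun) (j : Fin d) (p : SPoly d) :
    lift T (pderiv j p) = pderiv j (lift T p) := by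
  classical
  induction p using MvPolynomial.induction_on' with
  | monomial a f =>
    have key : ∀ (b : Fin d →₀ ℕ) (g : SmoothFun),
        lift T (monomial b g) = monomial b (T g) := by
      intro b g
      ext1 c
      rw [coeff_lift, coeff_monomial, coeff_monomial]
      split_ifs <;> simp
    rw [key, pderiv_monomial, pderiv_monomial, key]
    congr 1
    rw [mul_comm, ← nsmul_eq_mul, map_nsmul, nsmul_eq_mul, mul_comm]
  | add p q hp hq => simp only [map_add, hp, hq]

/-- Evaluation at `(t, y)`. -/
noncomputable def ev (t : ℝ) (y : Euc d) : SPoly d →+* ℂ :=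
  eval₂Hom (evalAt t) fun j => ((y j : ℝ) : ℂ)

@[simp] lemma ev_C (t : ℝ) (y : Euc d) (f : SmoothFun) : ev t y (C f) = (f : ℝ → ℂ) t :=
  eval₂Hom_C _ _ _

@[simp] lemma ev_X (t : ℝ) (y : Euc d) (j : Fin d) : ev t y (X j) = (y j : ℝ) :=
  eval₂Hom_X' _ _ _

@[simp] lemma ev_smul (t : ℝ) (y : Euc d) (c : ℂ) (p : SPoly d) :
    ev t y (c • p) = c * ev t y p := by
  have : c • p = C (algebraMap ℂ SmoothFun c) * p := by
    rw [← smul_eq_C_mul, algebraMap_smul]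
  rw [this, map_mul, ev_C]
  rfl

lemma ev_eq_sum (t : ℝ) (y : Euc d) (p : SPoly d) :
    ev t y p = ∑ a ∈ p.support, ((coeff a p : SmoothFun) : ℝ → ℂ) t * ∏ j, ((y j : ℝ) : ℂ) ^ a j := by
  rw [ev, coe_eval₂Hom, eval₂_eq']
  rfl

lemma norm_ev_le {s t : ℝ} (ht : t ∈ Set.Icc (0 : ℝ) 1) {y : Euc d}
    (hy : ‖y‖ ≤ s) (p : SPoly d) : ‖ev t y p‖ ≤ nm s p := by
  have hs : 0 ≤ s := (norm_nonneg y).trans hy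
  rw [ev_eq_sum]
  refine (norm_sum_le _ _).trans (Finset.sum_le_sum fun a _ => ?_)
  rw [norm_mul]
  refine mul_le_mul (norm_le_sn _ ht) ?_ (norm_nonneg _) (sn_nonneg _)
  rw [norm_prod, Finsupp.degree_eq_sum, ← Finset.prod_pow_eq_pow_sum]
  refine Finset.prod_le_prod (fun _ _ => norm_nonneg _) fun j _ => ?_
  rw [norm_pow]
  refine pow_le_pow_left₀ (norm_nonneg _) ?_ _
  rw [Complex.norm_real]
  exact (PiLp.norm_apply_le y j).trans hy

lemma ev_eq_zero {t : ℝ} {p : SPoly d} (h : ∀ a, ((coeff a p : SmoothFun) : ℝ → ℂ) t = 0) (y : Euc d) :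
    ev t y p = 0 := by
  rw [ev_eq_sum]
  exact Finset.sum_eq_zero fun a _ => by rw [h, zero_mul]

/-- The derivative of `t`-coefficients. -/
noncomputable def tderiv : SPoly d →ₗ[ℂ] SPoly d := lift diff

lemma tderiv_mul_X (p : SPoly d) (j : Fin d) : tderiv (p * X j) = tderiv p * X j := by
  rw [mul_comm, tderiv, lift_X_mul, mul_comm]

lemma hasFDerivAt_coord (x₀ x : Euc d) (j : Fin d) :
    HasFDerivAt (fun x : Euc d => (((x - x₀) j : ℝ) : ℂ))
      ((EuclideanSpace.proj j : Euc d →L[ℝ] ℝ).smulRight (1 : ℂ)) x := by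
  have h2 : HasFDerivAt (fun x : Euc d => (x - x₀) j)
      (EuclideanSpace.proj j : Euc d →L[ℝ] ℝ) x := by
    have h3 := (EuclideanSpace.proj j : Euc d →L[ℝ] ℝ).hasFDerivAt (x := x - x₀)
    exact h3.comp x ((hasFDerivAt_id x).sub_const x₀)
  refine ((Complex.ofRealCLM.hasFDerivAt (x := (x - x₀) j)).comp x h2).congr_fderiv ?_
  ext v
  simp

/-- The chain rule for `x ↦ p (τ x, x - x₀)`. -/
lemma hasFDerivAt_ev {τ : Euc d → ℝ} {τ' : Euc d →L[ℝ] ℝ} {x : Euc d} (x₀ : Euc d)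
    (hτ : HasFDerivAt τ τ' x) (p : SPoly d) :
    HasFDerivAt (fun x => ev (τ x) (x - x₀) p)
      (τ'.smulRight (ev (τ x) (x - x₀) (tderiv p)) +
        ∑ j, (EuclideanSpace.proj j : Euc d →L[ℝ] ℝ).smulRight
          (ev (τ x) (x - x₀) (pderiv j p))) x := by
  induction p using MvPolynomial.induction_on with
  | C f =>
    simp only [ev_C, tderiv, lift_C, pderiv_C, map_zero]
    have := (f.hasDerivAt (τ x)).hasFDerivAt.comp x hτ
    refine this.congr_fderiv ?_
    ext v
    simp [mul_comm]
  | add p q hp hq =>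
    simp only [map_add]
    refine (hp.add hq).congr_fderiv ?_
    ext v
    simp [Finset.sum_add_distrib]
    ring
  | mul_X p j hp =>
    have h1 := hasFDerivAt_coord x₀ x j
    simp only [map_mul, ev_X, tderiv_mul_X, Derivation.leibniz, pderiv_X, smul_eq_mul, map_add]
    refine (hp.mul h1).congr_fderiv ?_
    ext v
    simp [Pi.single_apply, Finset.sum_add_distrib, apply_ite (ev (τ x) (x - x₀)),
      Finset.mul_sum]
    simp only [mul_comm, mul_left_comm]
    ring

lemma contDiffAt_ev {τ : Euc d → ℝ} {x : Euc d} (x₀ : Euc d) (hτ : ContDiffAt ℝ ∞ τ x)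
    (p : SPoly d) : ContDiffAt ℝ ∞ (fun x => ev (τ x) (x - x₀) p) x := by
  induction p using MvPolynomial.induction_on with
  | C f =>
    simp only [ev_C]
    exact f.contDiff.contDiffAt.comp x hτ
  | add p q hp hq => simpa using hp.add hq
  | mul_X p j hp =>
    simp only [map_mul, ev_X]
    refine hp.mul (Complex.ofRealCLM.contDiff.contDiffAt.comp x ?_)
    exact ((EuclideanSpace.proj j : Euc d →L[ℝ] ℝ).contDiff.comp
      (contDiff_id.sub contDiff_const)).contDiffAt

end SPoly

/-! ### The conjugated operator, its frozen model and the Cauchy problem for the model -/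

namespace SPoly

open MvPolynomial SmoothFun

variable {d : ℕ}

/-- The operator `h ∂ₜ`. -/
noncomputable def Dt (h : ℝ) : SPoly d →ₗ[ℂ] SPoly d := lift (hdiff h)

/-- The operator `h ∂ⱼ - yⱼ`. -/
noncomputable def De (h : ℝ) (j : Fin d) : SPoly d →ₗ[ℂ] SPoly d :=
  (h : ℂ) • ((pderiv j : Derivation SmoothFun (SPoly d) (SPoly d)).toLinearMap.restrictScalars ℂ) -
    LinearMap.mulLeft ℂ (X j)

/-- The operator `h ∂ⱼ` conjugated by `exp ((κ · y - |y|² / 2) / h)`. -/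
noncomputable def Dy (h : ℝ) (κ : Fin d → ℂ) (j : Fin d) : SPoly d →ₗ[ℂ] SPoly d :=
  κ j • LinearMap.id + De h j

lemma De_apply (h : ℝ) (j : Fin d) (p : SPoly d) :
    De h j p = (h : ℂ) • pderiv j p - X j * p := rfl

lemma Dy_apply (h : ℝ) (κ : Fin d → ℂ) (j : Fin d) (p : SPoly d) :
    Dy h κ j p = κ j • p + De h j p := rfl

lemma Dt_De (h : ℝ) (j : Fin d) (p : SPoly d) : Dt h (De h j p) = De h j (Dt h p) := by
  rw [De_apply, De_apply, map_sub, map_smul, Dt, lift_pderiv, lift_X_mul]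

lemma Dt_Dy (h : ℝ) (κ : Fin d → ℂ) (j : Fin d) (p : SPoly d) :
    Dt h (Dy h κ j p) = Dy h κ j (Dt h p) := by
  rw [Dy_apply, Dy_apply, map_add, map_smul, Dt_De]

/-- The factor is small once `s` is small and `h` is small compared with the loss of radius `s -
s'`. Hence the Gaussian may be treated as a perturbation of the plane phase. -/
lemma nm_De_le {h s s' : ℝ} (hh : 0 ≤ h) (hs : 0 ≤ s') (hss : s' < s) (j : Fin d) (p : SPoly d) :
    nm s' (De h j p) ≤ (h / (s - s') + s) * nm s p := by
  rw [De_apply, add_mul]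
  have h1 := nm_mono hs hss.le p
  have h0 := nm_nonneg hs p
  refine (nm_sub_le hs _ _).trans (add_le_add ?_ ?_)
  · refine (nm_smul_le hs _ _).trans ?_
    rw [Complex.norm_real, Real.norm_of_nonneg hh, div_eq_mul_inv, mul_assoc]
    exact mul_le_mul_of_nonneg_left (nm_pderiv_le hs hss j p) hh
  · exact (nm_mul_le hs _ _).trans
      (mul_le_mul ((nm_X_le hs j).trans hss.le) h1 h0 (hs.trans hss.le))

/-- The data of a conjugated operator: the covector `κ`, the coefficients and the spectral
parameter. -/
structure OpData (d : ℕ) where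
  κ : Fin d → ℂ
  β : Fin d → ℂ
  η : Fin d → ℂ
  z : ℂ
  B : Fin d → SPoly d
  Y : Fin d → SPoly d
  E : SPoly d

namespace OpData

variable (D : OpData d)

/-- Minus the conjugated operator. -/
noncomputable def op (h : ℝ) : SPoly d →ₗ[ℂ] SPoly d :=
  (∑ j, (Dy h D.κ j ∘ₗ Dy h D.κ j -
    (2 : ℂ) • (LinearMap.mulLeft ℂ (D.B j) ∘ₗ Dy h D.κ j ∘ₗ Dt h) +
    LinearMap.mulLeft ℂ (D.B j * D.B j) ∘ₗ Dt h ∘ₗ Dt h -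
    LinearMap.mulLeft ℂ (D.Y j) ∘ₗ Dy h D.κ j + LinearMap.mulLeft ℂ (D.Y j * D.B j) ∘ₗ Dt h)) -
    (h : ℂ) • (LinearMap.mulLeft ℂ D.E ∘ₗ Dt h) + D.z • LinearMap.id

lemma op_apply (h : ℝ) (p : SPoly d) : D.op h p =
    (∑ j, (Dy h D.κ j (Dy h D.κ j p) - (2 : ℂ) • (D.B j * Dy h D.κ j (Dt h p)) +
      D.B j * D.B j * Dt h (Dt h p) - D.Y j * Dy h D.κ j p + D.Y j * D.B j * Dt h p)) -
    (h : ℂ) • (D.E * Dt h p) + D.z • p := by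
  simp [op, LinearMap.sum_apply, mul_assoc]

end OpData

/-- The constant coefficient operator `g (Dₜ - l₁) (Dₜ - l₂)`. -/
noncomputable def constOp (h : ℝ) (g l₁ l₂ : ℂ) : SPoly d →ₗ[ℂ] SPoly d :=
  g • (Dt h ∘ₗ Dt h - (l₁ + l₂) • Dt h + (l₁ * l₂) • LinearMap.id)

lemma constOp_apply (h : ℝ) (g l₁ l₂ : ℂ) (p : SPoly d) :
    constOp h g l₁ l₂ p = g • (Dt h (Dt h p) - (l₁ + l₂) • Dt h p + (l₁ * l₂) • p) := rfl

/-- The operator `constOp` with the coefficients of `D` frozen at the origin. -/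
structure OpData.FrozenEq (D : OpData d) (g l₁ l₂ : ℂ) : Prop where
  two : ∑ j, D.β j * D.β j = g
  one : ∑ j, (2 * D.β j * D.κ j - D.η j * D.β j) = g * (l₁ + l₂)
  zero : ∑ j, (D.κ j * D.κ j - D.η j * D.κ j) + D.z = g * (l₁ * l₂)

/-- Bounds on the data: the coefficients are `ε`-close to their value at the origin. -/
structure OpData.Close (D : OpData d) (M ε r : ℝ) : Prop where
  κ : ∀ j, ‖D.κ j‖ ≤ M
  β : ∀ j, ‖D.β j‖ ≤ M
  η : ∀ j, ‖D.η j‖ ≤ M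
  B : ∀ j, nm r (D.B j - algebraMap ℂ _ (D.β j)) ≤ ε
  Y : ∀ j, nm r (D.Y j - algebraMap ℂ _ (D.η j)) ≤ ε
  E : nm r D.E ≤ M

lemma OpData.Close.mono {D : OpData d} {M ε r s : ℝ} (h : D.Close M ε r) (hs : 0 ≤ s)
    (hsr : s ≤ r) : D.Close M ε s :=
  ⟨h.κ, h.β, h.η, fun j => (nm_mono hs hsr _).trans (h.B j),
    fun j => (nm_mono hs hsr _).trans (h.Y j), (nm_mono hs hsr _).trans h.E⟩

/-- The sum of the norms of `p`, `h ∂ₜ p` and `(h ∂ₜ)² p`. -/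
noncomputable def tn (h s : ℝ) (p : SPoly d) : ℝ :=
  nm s p + nm s (Dt h p) + nm s (Dt h (Dt h p))

lemma tn_nonneg {h s : ℝ} (hs : 0 ≤ s) (p : SPoly d) : 0 ≤ tn h s p :=
  add_nonneg (add_nonneg (nm_nonneg hs _) (nm_nonneg hs _)) (nm_nonneg hs _)

lemma tn_mono {h s s' : ℝ} (hs : 0 ≤ s) (hss : s ≤ s') (p : SPoly d) : tn h s p ≤ tn h s' p :=
  add_le_add (add_le_add (nm_mono hs hss _) (nm_mono hs hss _)) (nm_mono hs hss _)

lemma tn_add_le {h s : ℝ} (hs : 0 ≤ s) (p q : SPoly d) :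
    tn h s (p + q) ≤ tn h s p + tn h s q := by
  simp only [tn, map_add]
  linarith [nm_add_le hs p q, nm_add_le hs (Dt h p) (Dt h q),
    nm_add_le hs (Dt h (Dt h p)) (Dt h (Dt h q))]

lemma nm_Dy_le {D : OpData d} {M ε s s' h : ℝ} (hM : 1 ≤ M) (hε : ε ≤ 1)
    (hh : 0 < h) (hs : 0 ≤ s') (hss : s' < s) (hgap : h / (s - s') + s ≤ ε)
    (hκ : ∀ j, ‖D.κ j‖ ≤ M) (j : Fin d) (p : SPoly d) :
    nm s' (Dy h D.κ j p) ≤ 2 * M * nm s p := by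
  rw [Dy_apply]
  have h0 := nm_nonneg hs p
  have h1 := nm_mono hs hss.le p
  have h2 := (nm_De_le hh.le hs hss j p).trans (mul_le_mul_of_nonneg_right hgap (h0.trans h1))
  have h3 : nm s' (D.κ j • p) ≤ M * nm s p := (nm_smul_le hs _ _).trans
    (mul_le_mul (hκ j) h1 h0 (by linarith))
  have h4 : ε * nm s p ≤ M * nm s p := mul_le_mul_of_nonneg_right (by linarith) (h0.trans h1)
  linarith [nm_add_le hs (D.κ j • p) (De h j p)]

lemma nm_mul_le_of_le {s a b : ℝ} (hs : 0 ≤ s) {p q : SPoly d} (hp : nm s p ≤ a)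
    (hq : nm s q ≤ b) : nm s (p * q) ≤ a * b :=
  (nm_mul_le hs _ _).trans (mul_le_mul hp hq (nm_nonneg hs _) ((nm_nonneg hs _).trans hp))

lemma nm_smul_le_of_le {s a b : ℝ} (hs : 0 ≤ s) {c : ℂ} {q : SPoly d} (hp : ‖c‖ ≤ a)
    (hq : nm s q ≤ b) : nm s (c • q) ≤ a * b :=
  (nm_smul_le hs _ _).trans (mul_le_mul hp hq (nm_nonneg hs _) ((norm_nonneg _).trans hp))

lemma nm_add_le_of_le {s a b : ℝ} (hs : 0 ≤ s) {p q : SPoly d} (hp : nm s p ≤ a)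
    (hq : nm s q ≤ b) : nm s (p + q) ≤ a + b :=
  (nm_add_le hs _ _).trans (add_le_add hp hq)

lemma nm_sub_le_of_le {s a b : ℝ} (hs : 0 ≤ s) {p q : SPoly d} (hp : nm s p ≤ a)
    (hq : nm s q ≤ b) : nm s (p - q) ≤ a + b :=
  (nm_sub_le hs _ _).trans (add_le_add hp hq)

/-- The difference of the `j`-th summand of `op` and its frozen version. -/
noncomputable def OpData.diffTerm (D : OpData d) (h : ℝ) (j : Fin d) (p q r : SPoly d) : SPoly d :=
  ((2 : ℂ) • (D.κ j • De h j p) + De h j (De h j p)) -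
  (2 : ℂ) • ((D.B j - algebraMap ℂ _ (D.β j)) * Dy h D.κ j q + D.β j • De h j q) +
  ((D.B j - algebraMap ℂ _ (D.β j)) * ((D.B j - algebraMap ℂ _ (D.β j)) * r) +
    (2 : ℂ) • (D.β j • ((D.B j - algebraMap ℂ _ (D.β j)) * r))) -
  ((D.Y j - algebraMap ℂ _ (D.η j)) * Dy h D.κ j p + D.η j • De h j p) +
  ((D.Y j - algebraMap ℂ _ (D.η j)) * ((D.B j - algebraMap ℂ _ (D.β j)) * q) +
    D.η j • ((D.B j - algebraMap ℂ _ (D.β j)) * q) +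
    D.β j • ((D.Y j - algebraMap ℂ _ (D.η j)) * q))

/-- The three frozen identities cancel the main part. Every surviving term carries a small factor:
`De`, `D.B j - D.β j`, `D.Y j - D.η j`, or an explicit `h`. -/
lemma op_sub_constOp {D : OpData d} {h : ℝ} {g l₁ l₂ : ℂ} (hD : D.FrozenEq g l₁ l₂) (p : SPoly d) :
    D.op h p - constOp h g l₁ l₂ p =
      (∑ j, D.diffTerm h j p (Dt h p) (Dt h (Dt h p))) - (h : ℂ) • (D.E * Dt h p) := by
  rw [constOp_apply, smul_add, smul_sub, smul_smul, smul_smul, ← hD.one, ← hD.zero, ← hD.two,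
    D.op_apply, add_smul, Finset.sum_smul, Finset.sum_smul, Finset.sum_smul]
  have : ∀ A B C D F H : SPoly d, A - H + F - (B - C + (D + F)) = (A - (B - C + D)) - H := by
    intros; ring
  rw [this, ← Finset.sum_sub_distrib, ← Finset.sum_add_distrib, ← Finset.sum_sub_distrib]
  congr 1
  refine Finset.sum_congr rfl fun j _ => ?_
  simp only [OpData.diffTerm, Dy_apply, map_add, map_smul]
  simp only [Algebra.smul_def, map_mul, map_sub, map_ofNat]
  ring

/-- Each product has at least one factor `ε`, and powers of `ε` are absorbed by `ε ≤ 1 ≤ M`. The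
totals for `P`, `Q`, `R` are at most `6`, `9`, `3` times `M * ε`, whence the constant `9`. -/
lemma nm_diffTerm_le {D : OpData d} {M ε s h P Q R : ℝ} {p q r : SPoly d} (hM : 1 ≤ M)
    (hε0 : 0 ≤ ε) (hε : ε ≤ 1) (hc : D.Close M ε s) (hs : 0 ≤ s) {j : Fin d}
    (hQ : nm s q ≤ Q) (hR : nm s r ≤ R) (hP0 : 0 ≤ P)
    (he : nm s (De h j p) ≤ ε * P) (heq : nm s (De h j q) ≤ ε * Q)
    (hee : nm s (De h j (De h j p)) ≤ ε * (ε * P)) (hDp : nm s (Dy h D.κ j p) ≤ 2 * M * P)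
    (hDq : nm s (Dy h D.κ j q) ≤ 2 * M * Q) :
    nm s (D.diffTerm h j p q r) ≤ 9 * M * ε * (P + Q + R) := by
  have h2 : ‖(2 : ℂ)‖ ≤ 2 := by simp
  have hQ0 : 0 ≤ Q := (nm_nonneg hs _).trans hQ
  have hR0 : 0 ≤ R := (nm_nonneg hs _).trans hR
  have t1 := nm_add_le_of_le hs (nm_smul_le_of_le hs h2 (nm_smul_le_of_le hs (hc.κ j) he)) hee
  have t2 := nm_smul_le_of_le hs h2 (nm_add_le_of_le hs (nm_mul_le_of_le hs (hc.B j) hDq)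
        (nm_smul_le_of_le hs (hc.β j) heq))
  have t3 := nm_add_le_of_le hs (nm_mul_le_of_le hs (hc.B j) (nm_mul_le_of_le hs (hc.B j) hR))
        (nm_smul_le_of_le hs h2 (nm_smul_le_of_le hs (hc.β j) (nm_mul_le_of_le hs (hc.B j) hR)))
  have t4 := nm_add_le_of_le hs (nm_mul_le_of_le hs (hc.Y j) hDp)
        (nm_smul_le_of_le hs (hc.η j) he)
  have t5 := nm_add_le_of_le hs (nm_add_le_of_le hs
        (nm_mul_le_of_le hs (hc.Y j) (nm_mul_le_of_le hs (hc.B j) hQ))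
        (nm_smul_le_of_le hs (hc.η j) (nm_mul_le_of_le hs (hc.B j) hQ)))
        (nm_smul_le_of_le hs (hc.β j) (nm_mul_le_of_le hs (hc.Y j) hQ))
  refine (nm_add_le_of_le hs (nm_sub_le_of_le hs (nm_add_le_of_le hs (nm_sub_le_of_le hs
    t1 t2) t3) t4) t5).trans ?_
  have hεM : ε * ε ≤ M * ε := mul_le_mul_of_nonneg_right (hε.trans hM) hε0
  have e1 := mul_le_mul_of_nonneg_right hεM hP0
  have e2 := mul_le_mul_of_nonneg_right hεM hQ0
  have e3 := mul_le_mul_of_nonneg_right hεM hR0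
  have e4 : 0 ≤ M * ε * P := by positivity
  have e5 : 0 ≤ M * ε * R := by positivity
  linarith

lemma nm_op_sub_constOp_le {D : OpData d} {M ε s s' h : ℝ} {g l₁ l₂ : ℂ} (hM : 1 ≤ M)
    (hε0 : 0 ≤ ε) (hε : ε ≤ 1) (hD : D.FrozenEq g l₁ l₂) (hc : D.Close M ε s)
    (hh : 0 < h) (hhε : h ≤ ε) (hs : 0 ≤ s') (hss : s' < s)
    (hgap : h / ((s - s') / 2) + s ≤ ε) (p : SPoly d) :
    nm s' (D.op h p - constOp h g l₁ l₂ p) ≤ (10 * (d + 1) * M) * ε * tn h s p := by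
  -- `De` may act twice, so the loss of radius is shared equally by two applications; this is the
  -- halved gap in `hgap`.
  set m := (s + s') / 2 with hm
  have hs'm : s' < m := by rw [hm]; linarith
  have hms : m < s := by rw [hm]; linarith
  have hm0 : 0 ≤ m := hs.trans hs'm.le
  have hgap1 : h / (m - s') + m ≤ ε := by
    have : m - s' = (s - s') / 2 := by rw [hm]; ring
    rw [this]; linarith
  have hgap2 : h / (s - m) + s ≤ ε := by
    have : s - m = (s - s') / 2 := by rw [hm]; ring
    rw [this]; linarith
  have hc' : D.Close M ε s' := hc.mono hs hss.le
  have he : ∀ j (f : SPoly d), nm m (De h j f) ≤ ε * nm s f := fun j f =>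
    (nm_De_le hh.le hm0 hms j f).trans
      (mul_le_mul_of_nonneg_right hgap2 (nm_nonneg (hs.trans hss.le) _))
  have he' : ∀ j (f : SPoly d), nm s' (De h j f) ≤ ε * nm s f := fun j f =>
    (nm_mono hs hs'm.le _).trans (he j f)
  have hee : ∀ j (f : SPoly d), nm s' (De h j (De h j f)) ≤ ε * (ε * nm s f) := fun j f =>
    ((nm_De_le hh.le hs hs'm j _).trans (mul_le_mul_of_nonneg_right hgap1 (nm_nonneg hm0 _))).trans
      (mul_le_mul_of_nonneg_left (he j f) hε0)
  have hDy : ∀ j (f : SPoly d), nm s' (Dy h D.κ j f) ≤ 2 * M * nm s f := fun j f =>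
    (nm_mono hs hs'm.le _).trans (nm_Dy_le hM hε hh hm0 hms hgap2 hc.κ j f)
  have hQ := nm_mono hs hss.le (Dt h p)
  rw [op_sub_constOp hD]
  refine (nm_sub_le_of_le hs ((nm_sum_le hs _ _).trans (Finset.sum_le_sum fun j _ =>
    nm_diffTerm_le hM hε0 hε hc' hs hQ (nm_mono hs hss.le _) (nm_nonneg (hs.trans hss.le) p)
      (he' j p) (he' j _) (hee j p) (hDy j p) (hDy j _)))
    (nm_smul_le_of_le (a := ε) hs (by simpa [abs_of_pos hh] using hhε)
      (nm_mul_le_of_le hs hc'.E hQ))).trans ?_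
  rw [Finset.sum_const, Finset.card_univ, Fintype.card_fin, nsmul_eq_mul, ← tn]
  have hQ0 : 0 ≤ nm s (Dt h p) := nm_nonneg (hs.trans hss.le) _
  have e0 : nm s (Dt h p) ≤ tn h s p := by
    rw [tn]
    linarith [nm_nonneg (hs.trans hss.le) p, nm_nonneg (hs.trans hss.le) (Dt h (Dt h p))]
  have e1 : 0 ≤ tn h s p := hQ0.trans e0
  have e2 : ε * (M * nm s (Dt h p)) ≤ ε * (M * tn h s p) := by gcongr
  have e3 : 0 ≤ M * ε * tn h s p := by positivity
  have e4 : 0 ≤ (d : ℝ) * (M * ε * tn h s p) := by positivity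
  linarith

/-- The right inverse of `constOp` given by vanishing Cauchy data. -/
noncomputable def solveOp (h : ℝ) (g l₁ l₂ : ℂ) : SPoly d →ₗ[ℂ] SPoly d :=
  lift (g⁻¹ • (duhamel h l₁ ∘ₗ duhamel h l₂))

lemma lift_smul (c : ℂ) (T : SmoothFun →ₗ[ℂ] SmoothFun) (p : SPoly d) :
    lift (c • T) p = c • lift T p := by
  ext1 a; simp

lemma Dt_lift_duhamel {h : ℝ} (hh : 0 < h) (l : ℂ) (p : SPoly d) :
    Dt h (lift (duhamel h l) p) = l • lift (duhamel h l) p + p := by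
  ext1 a; simp [Dt, hdiff_duhamel hh]

lemma solveOp_apply (h : ℝ) (g l₁ l₂ : ℂ) (p : SPoly d) :
    solveOp h g l₁ l₂ p = g⁻¹ • lift (duhamel h l₁) (lift (duhamel h l₂) p) := by
  rw [solveOp, lift_smul, lift_comp]

lemma constOp_solveOp {h : ℝ} (hh : 0 < h) {g : ℂ} (hg : g ≠ 0) (l₁ l₂ : ℂ) (p : SPoly d) :
    constOp h g l₁ l₂ (solveOp h g l₁ l₂ p) = p := by
  rw [constOp_apply, solveOp_apply]
  simp only [map_smul, map_add, Dt_lift_duhamel hh]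
  simp only [Algebra.smul_def, map_add, map_mul]
  have : algebraMap ℂ (SPoly d) g * algebraMap ℂ (SPoly d) g⁻¹ = 1 := by
    rw [← map_mul, mul_inv_cancel₀ hg, map_one]
  linear_combination p * this

lemma coeff_solveOp_zero (h : ℝ) (g l₁ l₂ : ℂ) (p : SPoly d) (a : Fin d →₀ ℕ) :
    ((coeff a (solveOp h g l₁ l₂ p) : SmoothFun) : ℝ → ℂ) 0 = 0 := by
  simp [solveOp]

lemma coeff_Dt_solveOp_zero {h : ℝ} (hh : 0 < h) (g l₁ l₂ : ℂ) (p : SPoly d) (a : Fin d →₀ ℕ) :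
    ((coeff a (Dt h (solveOp h g l₁ l₂ p)) : SmoothFun) : ℝ → ℂ) 0 = 0 := by
  rw [solveOp_apply, map_smul, Dt_lift_duhamel hh]
  simp

/-- The Duhamel equations express `Dt` of the solution algebraically through the solution and its
source. Two `t`-derivatives are therefore controlled with no loss of radius and no negative power of
`h`, as needed because the perturbation contains `Dt` up to second order. -/
lemma exists_tn_solveOp_le (g : ℂ) {l₁ l₂ : ℂ} (h₁ : l₁.re < 0) (h₂ : l₂.re < 0) :
    ∃ K : ℝ, 0 < K ∧ ∀ h > 0, ∀ s ≥ 0, ∀ p : SPoly d,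
      tn h s (solveOp h g l₁ l₂ p) ≤ K * nm s p := by
  set k₁ := (-l₁.re)⁻¹ with hk₁
  set k₂ := (-l₂.re)⁻¹ with hk₂
  have k₁0 : 0 < k₁ := inv_pos.2 (by linarith)
  have k₂0 : 0 < k₂ := inv_pos.2 (by linarith)
  refine ⟨‖g⁻¹‖ * (k₁ * k₂ + (‖l₁‖ * (k₁ * k₂) + k₂) +
    (‖l₁‖ * (‖l₁‖ * (k₁ * k₂) + k₂) + (‖l₂‖ * k₂ + 1))) + 1, by positivity, fun h hh s hs p => ?_⟩
  have b2 : nm s (lift (duhamel h l₂) p) ≤ k₂ * nm s p :=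
    nm_lift_le hs (sn_duhamel_le hh h₂) p
  have b1 : nm s (lift (duhamel h l₁) (lift (duhamel h l₂) p)) ≤ k₁ * (k₂ * nm s p) :=
    (nm_lift_le hs (sn_duhamel_le hh h₁) _).trans (mul_le_mul_of_nonneg_left b2 k₁0.le)
  have b3 := nm_add_le_of_le hs (nm_smul_le_of_le hs (le_refl ‖l₁‖) b1) b2
  have b4 := nm_add_le_of_le hs (nm_smul_le_of_le hs (le_refl ‖l₂‖) b2) (le_refl (nm s p))
  have b5 := nm_add_le_of_le hs (nm_smul_le_of_le hs (le_refl ‖l₁‖) b3) b4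
  rw [tn, solveOp_apply, map_smul, map_smul, Dt_lift_duhamel hh, map_add, map_smul,
    Dt_lift_duhamel hh, Dt_lift_duhamel hh]
  have c1 := nm_smul_le_of_le hs (le_refl ‖g⁻¹‖) b1
  have c2 := nm_smul_le_of_le hs (le_refl ‖g⁻¹‖) b3
  have c3 := nm_smul_le_of_le hs (le_refl ‖g⁻¹‖) b5
  have := nm_nonneg hs p
  refine (add_le_add (add_le_add c1 c2) c3).trans ?_
  nlinarith

/-- The solution of the frozen equation with Cauchy data `0`, `1`. -/
noncomputable def seed (h : ℝ) (l₁ l₂ : ℂ) : SPoly d := C (duhamel h l₁ (expFun (l₂ / h)))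

lemma C_smul (c : ℂ) (f : SmoothFun) : (C (c • f) : SPoly d) = c • C f := by
  classical
  ext1 a
  rw [coeff_C, coeff_smul, coeff_C]
  split_ifs <;> simp

lemma Dt_seed {h : ℝ} (hh : 0 < h) (l₁ l₂ : ℂ) :
    Dt h (seed h l₁ l₂ : SPoly d) = l₁ • seed h l₁ l₂ + C (expFun (l₂ / h)) := by
  rw [seed, Dt, lift_C, hdiff_duhamel hh, map_add, C_smul]

lemma Dt_C_expFun {h : ℝ} (hh : 0 < h) (l : ℂ) :
    Dt h (C (expFun (l / h)) : SPoly d) = l • C (expFun (l / h)) := by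
  rw [Dt, lift_C, hdiff, LinearMap.smul_apply, diff_expFun, smul_smul,
    mul_div_cancel₀ _ (by exact_mod_cast hh.ne' : (h : ℂ) ≠ 0), C_smul]

/-- `Dt - l₁` sends the seed to `exp (l₂ t / h)`, which `Dt - l₂` annihilates. Writing the seed as a
Duhamel integral avoids dividing by `l₁ - l₂`, so a double root needs no separate treatment. -/
lemma constOp_seed {h : ℝ} (hh : 0 < h) (g l₁ l₂ : ℂ) :
    constOp h g l₁ l₂ (seed h l₁ l₂ : SPoly d) = 0 := by
  rw [constOp_apply, Dt_seed hh, map_add, map_smul, Dt_seed hh, Dt_C_expFun hh]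
  simp only [Algebra.smul_def, map_add, map_mul]
  ring

lemma coeff_seed_zero (h : ℝ) (l₁ l₂ : ℂ) (a : Fin d →₀ ℕ) :
    ((coeff a (seed h l₁ l₂ : SPoly d) : SmoothFun) : ℝ → ℂ) 0 = 0 := by
  classical
  rw [seed, coeff_C]
  split_ifs <;> simp

lemma ev_Dt_seed_zero {h : ℝ} (hh : 0 < h) (l₁ l₂ : ℂ) (y : Euc d) :
    ev 0 y (Dt h (seed h l₁ l₂)) = 1 := by
  rw [Dt_seed hh, map_add, ev_smul, seed, ev_C, ev_C, duhamel_zero]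
  simp [expFun]

lemma exists_tn_seed_le {l₁ l₂ : ℂ} (h₁ : l₁.re < 0) (h₂ : l₂.re < 0) :
    ∃ K : ℝ, 0 < K ∧ ∀ h > 0, ∀ s ≥ 0, tn h s (seed h l₁ l₂ : SPoly d) ≤ K := by
  set k₁ := (-l₁.re)⁻¹ with hk₁
  have k₁0 : 0 < k₁ := inv_pos.2 (by linarith)
  refine ⟨k₁ * 1 + (‖l₁‖ * (k₁ * 1) + 1) + (‖l₁‖ * (‖l₁‖ * (k₁ * 1) + 1) + ‖l₂‖ * 1),
    by positivity, fun h hh s hs => ?_⟩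
  have b0 : nm s (C (expFun (l₂ / h)) : SPoly d) ≤ 1 := by
    rw [nm_C]
    refine sn_expFun_le ?_
    rw [Complex.div_ofReal_re]
    exact div_nonpos_of_nonpos_of_nonneg h₂.le hh.le
  have b1 : nm s (seed h l₁ l₂ : SPoly d) ≤ k₁ * 1 := by
    rw [nm_C] at b0
    rw [seed, nm_C]
    exact (sn_duhamel_le hh h₁ _).trans (mul_le_mul_of_nonneg_left b0 k₁0.le)
  have b2 := nm_add_le_of_le hs (nm_smul_le_of_le hs (le_refl ‖l₁‖) b1) b0
  rw [tn, Dt_seed hh, map_add, map_smul, Dt_seed hh, Dt_C_expFun hh]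
  exact add_le_add (add_le_add b1 b2) (nm_add_le_of_le hs (nm_smul_le_of_le hs (le_refl ‖l₁‖) b2)
    (nm_smul_le_of_le hs (le_refl ‖l₂‖) b0))

end SPoly

/-! ### The Neumann series -/

namespace SPoly

open MvPolynomial SmoothFun

variable {d : ℕ}

/-- The Neumann iterates for `op v = 0` with Cauchy data `0`, `1`. -/
noncomputable def iterate (D : OpData d) (h : ℝ) (g l₁ l₂ : ℂ) : ℕ → SPoly d
  | 0 => seed h l₁ l₂
  | n + 1 => -solveOp h g l₁ l₂ (D.op h (iterate D h g l₁ l₂ n) -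
      constOp h g l₁ l₂ (iterate D h g l₁ l₂ n))

/-- The partial sums of the Neumann series. -/
noncomputable def neumann (D : OpData d) (h : ℝ) (g l₁ l₂ : ℂ) (N : ℕ) : SPoly d :=
  ∑ n ∈ Finset.range (N + 1), iterate D h g l₁ l₂ n

/-- The sum telescopes: the frozen operator applied to each iterate cancels the perturbation applied
to its predecessor, leaving only the perturbation of the last iterate. -/
lemma op_neumann {D : OpData d} {h : ℝ} (hh : 0 < h) {g : ℂ} (hg : g ≠ 0) (l₁ l₂ : ℂ) (N : ℕ) :
    D.op h (neumann D h g l₁ l₂ N) = D.op h (iterate D h g l₁ l₂ N) -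
      constOp h g l₁ l₂ (iterate D h g l₁ l₂ N) := by
  induction N with
  | zero => simp [neumann, iterate, constOp_seed hh]
  | succ n ih =>
    rw [neumann, Finset.sum_range_succ, map_add, ← neumann, ih]
    conv_rhs => rw [iterate, map_neg (constOp h g l₁ l₂), constOp_solveOp hh hg, ← iterate]
    ring

lemma coeff_neumann_zero (D : OpData d) (h : ℝ) (g l₁ l₂ : ℂ) (N : ℕ) (a : Fin d →₀ ℕ) :
    evalAt 0 (coeff a (neumann D h g l₁ l₂ N)) = 0 := by
  rw [neumann, coeff_sum, map_sum]
  refine Finset.sum_eq_zero fun n _ => ?_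
  cases n with
  | zero => exact coeff_seed_zero h l₁ l₂ a
  | succ n =>
    rw [iterate, coeff_neg, map_neg, neg_eq_zero]
    exact coeff_solveOp_zero h g l₁ l₂ _ a

lemma ev_neumann_zero (D : OpData d) (h : ℝ) (g l₁ l₂ : ℂ) (N : ℕ) (y : Euc d) :
    ev 0 y (neumann D h g l₁ l₂ N) = 0 :=
  ev_eq_zero (coeff_neumann_zero D h g l₁ l₂ N) y

lemma ev_Dt_neumann_zero (D : OpData d) {h : ℝ} (hh : 0 < h) (g l₁ l₂ : ℂ) (N : ℕ) (y : Euc d) :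
    ev 0 y (Dt h (neumann D h g l₁ l₂ N)) = 1 := by
  rw [neumann, map_sum, map_sum, Finset.sum_range_succ']
  rw [Finset.sum_eq_zero, zero_add, iterate, ev_Dt_seed_zero hh]
  intro n _
  rw [iterate, map_neg, map_neg, neg_eq_zero]
  exact ev_eq_zero (fun a => coeff_Dt_solveOp_zero hh g l₁ l₂ _ a) y

lemma tn_neg_le {h s : ℝ} (hs : 0 ≤ s) (p : SPoly d) : tn h s (-p) ≤ tn h s p := by
  simp only [tn, map_neg]
  linarith [nm_neg hs p, nm_neg hs (Dt h p), nm_neg hs (Dt h (Dt h p))]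

lemma tn_sum_le {ι : Type*} {h s : ℝ} (hs : 0 ≤ s) (A : Finset ι) (f : ι → SPoly d) :
    tn h s (∑ i ∈ A, f i) ≤ ∑ i ∈ A, tn h s (f i) :=
  Finset.le_sum_of_subadditive _ (by simp [tn]) (tn_add_le hs) _ _

/-- Exponentially accurate solutions of the conjugated equation, uniformly in the data. -/
theorem exists_neumann_bounds {M : ℝ} (hM : 1 ≤ M) {g : ℂ} (hg : g ≠ 0) {l₁ l₂ : ℂ}
    (h₁ : l₁.re < 0) (h₂ : l₂.re < 0) :
    ∃ ε : ℝ, 0 < ε ∧ ε ≤ 1 ∧ ∃ K : ℝ, 0 < K ∧ ∀ (D : OpData d) (h r : ℝ) (N : ℕ),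
      D.FrozenEq g l₁ l₂ → 0 < r → D.Close M ε r → 0 < h → h ≤ ε → 2 ≤ N →
      4 * h * N / r + r ≤ ε →
      tn h (r / 2) (neumann D h g l₁ l₂ N) ≤ K ∧
      nm (r / 4) (D.op h (neumann D h g l₁ l₂ N)) ≤ K * (1 / 2) ^ N := by
  obtain ⟨K₁, hK₁, hsolve⟩ := exists_tn_solveOp_le (d := d) g h₁ h₂
  obtain ⟨K₀, hK₀, hseed⟩ := exists_tn_seed_le (d := d) h₁ h₂
  set A : ℝ := 10 * (d + 1) * M with hA
  have hA0 : 0 < A := by positivity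
  -- Solving costs `K₁` and the perturbation costs `A * ε`; this choice makes their product at most
  -- `1 / 2`.
  set ε : ℝ := min 1 (1 / (2 * K₁ * A)) with hε
  have hε0 : 0 < ε := lt_min one_pos (by positivity)
  have hε1 : ε ≤ 1 := min_le_left _ _
  have hεA : K₁ * (A * ε) ≤ 1 / 2 := by
    have : ε ≤ 1 / (2 * K₁ * A) := min_le_right _ _
    calc K₁ * (A * ε) ≤ K₁ * (A * (1 / (2 * K₁ * A))) := by gcongr
      _ = 1 / 2 := by field_simp
  refine ⟨ε, hε0, hε1, 2 * K₀ + A * K₀, by positivity, fun D h r N hD hr hc hh hhε hN hgap => ?_⟩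
  have hN0 : (0 : ℝ) < N := by exact_mod_cast (by omega : 0 < N)
  set v := iterate D h g l₁ l₂ with hv
  -- The radius falls from `r` to `r / 2` in `N` equal steps. Each loss `r / (2 * N)` is halved once
  -- more for the two uses of `De`, which produces the term `4 * h * N / r` of the gap condition.
  set s : ℕ → ℝ := fun n => r - n * (r / (2 * N)) with hs
  have hs_half : ∀ n ≤ N, r / 2 ≤ s n := by
    intro n hn
    have : (n : ℝ) * (r / (2 * N)) ≤ N * (r / (2 * N)) := by gcongr
    have h2 : (N : ℝ) * (r / (2 * N)) = r / 2 := by field_simp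
    simp only [hs]; linarith
  have hs_le : ∀ n, s n ≤ r := fun n => by
    have : (0 : ℝ) ≤ n * (r / (2 * N)) := by positivity
    simp only [hs]; linarith
  have hbound : ∀ n ≤ N, tn h (s n) (v n) ≤ K₀ * (1 / 2) ^ n := by
    intro n
    induction n with
    | zero => intro _; simpa [hs, hv, iterate] using hseed h hh r hr.le
    | succ n ih =>
      intro hn
      have hpos : 0 ≤ s (n + 1) := (by positivity : (0 : ℝ) ≤ r / 2).trans (hs_half _ hn)
      have hdiff : s n - s (n + 1) = r / (2 * N) := by simp only [hs]; push_cast; ring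
      have hlt : s (n + 1) < s n := by
        have : 0 < r / (2 * N) := by positivity
        linarith
      have hgap' : h / ((s n - s (n + 1)) / 2) + s n ≤ ε := by
        have : h / ((s n - s (n + 1)) / 2) = 4 * h * N / r := by
          rw [hdiff]; field_simp; ring
        rw [this]; linarith [hs_le n]
      have key := nm_op_sub_constOp_le hM hε0.le hε1 hD
        (hc.mono (hpos.trans hlt.le) (hs_le n)) hh hhε hpos hlt hgap' (v n)
      calc tn h (s (n + 1)) (v (n + 1))
          ≤ K₁ * nm (s (n + 1)) (D.op h (v n) - constOp h g l₁ l₂ (v n)) :=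
            (tn_neg_le hpos _).trans (hsolve h hh _ hpos _)
        _ ≤ K₁ * (A * ε * tn h (s n) (v n)) := by gcongr
        _ = K₁ * (A * ε) * tn h (s n) (v n) := by ring
        _ ≤ 1 / 2 * (K₀ * (1 / 2) ^ n) := by
            refine mul_le_mul hεA (ih (by omega)) (tn_nonneg (hpos.trans hlt.le) _) (by norm_num)
        _ = K₀ * (1 / 2) ^ (n + 1) := by ring
  have hhalf : ∀ n ≤ N, tn h (r / 2) (v n) ≤ K₀ * (1 / 2) ^ n := fun n hn =>
    (tn_mono (by positivity) (hs_half n hn) _).trans (hbound n hn)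
  constructor
  · have h1 : tn h (r / 2) (neumann D h g l₁ l₂ N) ≤
        ∑ n ∈ Finset.range (N + 1), K₀ * (1 / 2) ^ n :=
      (tn_sum_le (by positivity) _ _).trans
        (Finset.sum_le_sum fun n hn => hhalf n (by have := Finset.mem_range.1 hn; omega))
    rw [← Finset.mul_sum] at h1
    have h2 : ∑ n ∈ Finset.range (N + 1), (1 / 2 : ℝ) ^ n ≤ 2 := by
      rw [geom_sum_eq (by norm_num), div_le_iff_of_neg (by norm_num)]
      have : (0 : ℝ) < (1 / 2) ^ (N + 1) := by positivity
      linarith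
    have h3 : 0 < A * K₀ := by positivity
    nlinarith
  · rw [op_neumann hh hg]
    -- The remaining residual uses one further drop, from `r / 2` to `r / 4`. Its gap term is `4 * h
    -- * 2 / r`, so `2 ≤ N` makes the old gap condition sufficient.
    have hgap' : h / ((r / 2 - r / 4) / 2) + r / 2 ≤ ε := by
      have e1 : h / ((r / 2 - r / 4) / 2) = 4 * h * 2 / r := by field_simp; ring
      have e2 : 4 * h * 2 / r ≤ 4 * h * N / r := by
        gcongr
        exact_mod_cast hN
      rw [e1]; linarith
    have key := nm_op_sub_constOp_le hM hε0.le hε1 hD (hc.mono (by positivity : 0 ≤ r / 2)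
      (by linarith)) hh hhε (by positivity : 0 ≤ r / 4) (by linarith : r / 4 < r / 2) hgap' (v N)
    refine key.trans ?_
    have h4 := hhalf N le_rfl
    have h5 := tn_nonneg (h := h) (by positivity : 0 ≤ r / 2) (v N)
    calc A * ε * tn h (r / 2) (v N) ≤ A * 1 * (K₀ * (1 / 2) ^ N) := by gcongr
      _ ≤ (2 * K₀ + A * K₀) * (1 / 2) ^ N := by
        have : 0 ≤ 2 * K₀ * (1 / 2) ^ N := by positivity
        nlinarith

end SPoly

/-! ### The operator applied to oscillating functions -/

/-- The `j`-th partial derivative. -/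
noncomputable def pd {d : ℕ} {F : Type*} [NormedAddCommGroup F] [NormedSpace ℝ F] (j : Fin d)
    (f : Euc d → F) : Euc d → F :=
  fun x => fderiv ℝ f x (EuclideanSpace.single j 1)

section

variable {d : ℕ}

lemma contDiffAt_pd {F : Type*} [NormedAddCommGroup F] [NormedSpace ℝ F] {n : WithTop ℕ∞}
    (hn : n + 1 ≤ n) {f : Euc d → F} {x : Euc d} (hf : ContDiffAt ℝ n f x) (j : Fin d) :
    ContDiffAt ℝ n (pd j f) x :=
  (hf.fderiv_right hn).clm_apply contDiffAt_const

lemma hD_eq (h : ℝ) (j : Fin d) (f : Euc d → ℂ) : hD h j f = ((h : ℂ) / Complex.I) • pd j f := rfl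

lemma hD_hD_eq (h : ℝ) (j : Fin d) (f : Euc d → ℂ) (x : Euc d) :
    hD h j (hD h j f) x = -(h : ℂ) ^ 2 * pd j (pd j f) x := by
  rw [hD_eq, hD_eq]
  simp only [Pi.smul_apply, smul_eq_mul]
  have : pd j (((h : ℂ) / Complex.I) • pd j f) x = ((h : ℂ) / Complex.I) * pd j (pd j f) x := by
    rw [pd, fderiv_const_smul_field]
    simp [pd]
  rw [this, ← mul_assoc, div_mul_div_comm, Complex.I_mul_I]
  ring

lemma opPz_eq (X : Euc d → Euc d) (z : ℂ) (h : ℝ) (f : Euc d → ℂ) (x : Euc d) :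
    opPz X z h f x = ∑ j, (-(h : ℂ) ^ 2 * pd j (pd j f) x + (X x j : ℝ) * (h * pd j f x)) -
      z * f x := by
  rw [opPz, opP, Finset.sum_add_distrib, Finset.mul_sum]
  congr 2
  · exact Finset.sum_congr rfl fun j _ => hD_hD_eq h j f x
  · refine Finset.sum_congr rfl fun j _ => ?_
    rw [hD_eq, Pi.smul_apply, smul_eq_mul]
    field_simp

lemma pd_mul {f g : Euc d → ℂ} {x : Euc d} (hf : DifferentiableAt ℝ f x)
    (hg : DifferentiableAt ℝ g x) (j : Fin d) :
    pd j (fun x => f x * g x) x = pd j f x * g x + f x * pd j g x := by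
  rw [pd, fderiv_fun_mul hf hg]
  simp [pd]
  ring

lemma pd_add {f g : Euc d → ℂ} {x : Euc d} (hf : DifferentiableAt ℝ f x)
    (hg : DifferentiableAt ℝ g x) (j : Fin d) :
    pd j (fun x => f x + g x) x = pd j f x + pd j g x := by
  rw [pd, fderiv_fun_add hf hg]
  rfl

lemma pd_const_mul_sub {f g : Euc d → ℂ} {x : Euc d} (hf : DifferentiableAt ℝ f x)
    (hg : DifferentiableAt ℝ g x) (c : ℂ) (j : Fin d) :
    pd j (fun x => c * (f x - g x)) x = c * (pd j f x - pd j g x) := by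
  rw [pd, fderiv_const_mul (hf.fun_sub hg), fderiv_fun_sub hf hg]
  rfl

lemma pd_congr {F : Type*} [NormedAddCommGroup F] [NormedSpace ℝ F] {f g : Euc d → F} {x : Euc d}
    (h : f =ᶠ[𝓝 x] g) (j : Fin d) : pd j f x = pd j g x := by
  rw [pd, pd, h.fderiv_eq]

/-- Apart from the first term, every contribution contains a derivative of `χ` and hence vanishes
where `χ` is locally constant. -/
lemma opPz_mul {χ f : Euc d → ℂ} {x : Euc d} (hχ : ContDiffAt ℝ ∞ χ x) (hf : ContDiffAt ℝ ∞ f x)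
    (X : Euc d → Euc d) (z : ℂ) (h : ℝ) :
    opPz X z h (fun x => χ x * f x) x = χ x * opPz X z h f x +
      ∑ j, (-(h : ℂ) * (2 * pd j χ x * (h * pd j f x)) - (h : ℂ) ^ 2 * pd j (pd j χ) x * f x +
        (X x j : ℝ) * h * pd j χ x * f x) := by
  have hd : ∀ {g : Euc d → ℂ} {y : Euc d}, ContDiffAt ℝ ∞ g y → DifferentiableAt ℝ g y :=
    fun hg => hg.differentiableAt (by simp)
  have hev : ∀ {g : Euc d → ℂ}, ContDiffAt ℝ ∞ g x → ∀ᶠ y in 𝓝 x, DifferentiableAt ℝ g y :=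
    fun {g} hg => ((hg.of_le (m := 1) (by exact_mod_cast le_top)).eventually (by simp)).mono
      fun y hy => hy.differentiableAt (by simp)
  have h1 : ∀ j, pd j (fun x => χ x * f x) x = pd j χ x * f x + χ x * pd j f x :=
    fun j => pd_mul (hd hχ) (hd hf) j
  have h2 : ∀ j, pd j (pd j (fun x => χ x * f x)) x =
      pd j (pd j χ) x * f x + 2 * (pd j χ x * pd j f x) + χ x * pd j (pd j f) x := by
    intro j
    have e : pd j (fun x => χ x * f x) =ᶠ[𝓝 x] fun y => pd j χ y * f y + χ y * pd j f y := by
      filter_upwards [hev hχ, hev hf] with y h1 h2 using pd_mul h1 h2 j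
    have dχ := hd (contDiffAt_pd le_rfl hχ j)
    have df := hd (contDiffAt_pd le_rfl hf j)
    rw [pd_congr e]
    rw [pd_add (f := fun y => pd j χ y * f y) (g := fun y => χ y * pd j f y) (dχ.mul (hd hf))
      ((hd hχ).mul df), pd_mul dχ (hd hf), pd_mul (hd hχ) df]
    ring
  rw [opPz_eq, opPz_eq, mul_sub, Finset.mul_sum, sub_add_eq_add_sub, ← Finset.sum_add_distrib]
  congr 1
  · refine Finset.sum_congr rfl fun j _ => ?_
    rw [h1, h2]
    ring
  · ring

end

/-! ### Wave packets and the chain rule -/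

namespace SPoly

open MvPolynomial SmoothFun

variable {d : ℕ}

/-- The phase `(κ · y - |y|² / 2) / h` with `y = x - x₀`. -/
noncomputable def phase (h : ℝ) (κ : Fin d → ℂ) (x₀ x : Euc d) : ℂ :=
  ∑ j, (κ j * ((x - x₀) j : ℝ) - (((x - x₀) j : ℝ) : ℂ) ^ 2 / 2) / h

/-- The function `exp (phase) p (τ x, x - x₀)`. -/
noncomputable def wave (h : ℝ) (κ : Fin d → ℂ) (x₀ : Euc d) (τ : Euc d → ℝ) (p : SPoly d)
    (x : Euc d) : ℂ :=
  Complex.exp (phase h κ x₀ x) * ev (τ x) (x - x₀) p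

lemma contDiff_coord (x₀ : Euc d) (j : Fin d) :
    ContDiff ℝ ∞ fun x : Euc d => (((x - x₀) j : ℝ) : ℂ) :=
  Complex.ofRealCLM.contDiff.comp ((EuclideanSpace.proj j : Euc d →L[ℝ] ℝ).contDiff.comp
    (contDiff_id.sub contDiff_const))

lemma contDiff_phase (h : ℝ) (κ : Fin d → ℂ) (x₀ : Euc d) : ContDiff ℝ ∞ (phase h κ x₀) := by
  unfold phase
  refine ContDiff.sum fun j _ => ?_
  have := contDiff_coord x₀ j
  fun_prop

lemma hasFDerivAt_phase (h : ℝ) (κ : Fin d → ℂ) (x₀ x : Euc d) :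
    HasFDerivAt (phase h κ x₀) (∑ j, (EuclideanSpace.proj j : Euc d →L[ℝ] ℝ).smulRight
      ((κ j - ((x - x₀) j : ℝ)) / h)) x := by
  unfold phase
  refine HasFDerivAt.fun_sum fun j _ => ?_
  have h1 := hasFDerivAt_coord x₀ x j
  have h2 := ((h1.const_mul (κ j)).sub ((h1.pow 2).mul_const (2⁻¹ : ℂ))).mul_const ((h : ℂ)⁻¹)
  simp only [div_eq_mul_inv]
  refine h2.congr_fderiv ?_
  ext v
  simp
  ring

lemma contDiffAt_wave (h : ℝ) (κ : Fin d → ℂ) (x₀ : Euc d) {τ : Euc d → ℝ} {x : Euc d}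
    (hτ : ContDiffAt ℝ ∞ τ x) (p : SPoly d) : ContDiffAt ℝ ∞ (wave h κ x₀ τ p) x :=
  (contDiff_phase h κ x₀).contDiffAt.cexp.mul (contDiffAt_ev x₀ hτ p)

lemma tderiv_eq {h : ℝ} (hh : 0 < h) (p : SPoly d) : (h : ℂ)⁻¹ • Dt h p = tderiv p := by
  have : (h : ℂ) ≠ 0 := by exact_mod_cast hh.ne'
  rw [Dt, hdiff, lift_smul, smul_smul, inv_mul_cancel₀ this, one_smul, tderiv]

lemma pd_wave {h : ℝ} (hh : 0 < h) (κ : Fin d → ℂ) (x₀ : Euc d) {τ : Euc d → ℝ} {x : Euc d}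
    (hτ : DifferentiableAt ℝ τ x) (p : SPoly d) (j : Fin d) :
    h * pd j (wave h κ x₀ τ p) x =
      wave h κ x₀ τ (Dy h κ j p) x + (pd j τ x : ℝ) * wave h κ x₀ τ (Dt h p) x := by
  have h0 : (h : ℂ) ≠ 0 := by exact_mod_cast hh.ne'
  have key := (hasFDerivAt_phase h κ x₀ x).cexp.mul (hasFDerivAt_ev x₀ hτ.hasFDerivAt p)
  rw [pd]
  have : fderiv ℝ (wave h κ x₀ τ p) x = _ := key.fderiv
  rw [this, ← tderiv_eq hh]
  simp only [wave, Dy_apply, De_apply, map_add, map_sub, map_mul, ev_smul, ev_X, pd]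
  simp
  field_simp
  ring

/-- Squaring `Dy - (∂ⱼρ) Dt` also differentiates the coefficient `∂ⱼρ`. Summed over `j` this gives
the `h Δρ` term, which is modelled by `OpData.E`. -/
lemma opPz_wave {h : ℝ} (hh : 0 < h) (κ : Fin d → ℂ) (x₀ : Euc d) {ρ : Euc d → ℝ} {x : Euc d}
    (hρ : ContDiffAt ℝ ∞ ρ x) (p : SPoly d) (X : Euc d → Euc d) (z : ℂ) :
    -opPz X z h (wave h κ x₀ (-ρ) p) x =
      (∑ j, (wave h κ x₀ (-ρ) (Dy h κ j (Dy h κ j p)) x -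
        2 * ((pd j ρ x : ℝ) * wave h κ x₀ (-ρ) (Dy h κ j (Dt h p)) x) +
        (pd j ρ x : ℝ) * (pd j ρ x : ℝ) * wave h κ x₀ (-ρ) (Dt h (Dt h p)) x -
        (X x j : ℝ) * wave h κ x₀ (-ρ) (Dy h κ j p) x +
        (X x j : ℝ) * (pd j ρ x : ℝ) * wave h κ x₀ (-ρ) (Dt h p) x)) -
      h * ((∑ j, pd j (pd j ρ) x : ℝ) * wave h κ x₀ (-ρ) (Dt h p) x) +
      z * wave h κ x₀ (-ρ) p x := by
  have h0 : (h : ℂ) ≠ 0 := by exact_mod_cast hh.ne'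
  have hd : ∀ᶠ y in 𝓝 x, DifferentiableAt ℝ ρ y :=
    ((hρ.of_le (m := 1) (by exact_mod_cast le_top)).eventually (by simp)).mono
      fun y hy => hy.differentiableAt (by simp)
  have hneg : ∀ y j, pd j (-ρ) y = -pd j ρ y := fun y j => by
    rw [pd, fderiv_neg]; rfl
  -- The first-derivative formula is needed on a neighbourhood of `x`, since it is differentiated
  -- once more in `h2`.
  have h1 : ∀ q : SPoly d, ∀ j, ∀ᶠ y in 𝓝 x, h * pd j (wave h κ x₀ (-ρ) q) y =
      wave h κ x₀ (-ρ) (Dy h κ j q) y - (pd j ρ y : ℝ) * wave h κ x₀ (-ρ) (Dt h q) y := by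
    intro q j
    filter_upwards [hd] with y hy
    rw [pd_wave hh κ x₀ hy.neg, hneg]
    push_cast; ring
  have hw : ∀ q : SPoly d, DifferentiableAt ℝ (wave h κ x₀ (-ρ) q) x := fun q =>
    (contDiffAt_wave h κ x₀ hρ.neg q).differentiableAt (by simp)
  have h2 : ∀ j, (h : ℂ) ^ 2 * pd j (pd j (wave h κ x₀ (-ρ) p)) x =
      wave h κ x₀ (-ρ) (Dy h κ j (Dy h κ j p)) x -
        2 * ((pd j ρ x : ℝ) * wave h κ x₀ (-ρ) (Dy h κ j (Dt h p)) x) +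
        (pd j ρ x : ℝ) * (pd j ρ x : ℝ) * wave h κ x₀ (-ρ) (Dt h (Dt h p)) x -
        h * ((pd j (pd j ρ) x : ℝ) * wave h κ x₀ (-ρ) (Dt h p) x) := by
    intro j
    have e : pd j (wave h κ x₀ (-ρ) p) =ᶠ[𝓝 x] fun y => (h : ℂ)⁻¹ *
        (wave h κ x₀ (-ρ) (Dy h κ j p) y -
          ((pd j ρ y : ℝ) : ℂ) * wave h κ x₀ (-ρ) (Dt h p) y) := by
      filter_upwards [h1 p j] with y hy
      rw [← hy, ← mul_assoc, inv_mul_cancel₀ h0, one_mul]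
    have dρ := (contDiffAt_pd le_rfl hρ j).differentiableAt (by simp)
    have dρ' : DifferentiableAt ℝ (fun y => ((pd j ρ y : ℝ) : ℂ)) x :=
      Complex.ofRealCLM.differentiableAt.comp x dρ
    have eρ : pd j (fun y => ((pd j ρ y : ℝ) : ℂ)) x = (pd j (pd j ρ) x : ℝ) := by
      have := (Complex.ofRealCLM.hasFDerivAt (x := pd j ρ x)).comp x dρ.hasFDerivAt
      rw [pd, show fderiv ℝ (fun y => ((pd j ρ y : ℝ) : ℂ)) x = _ from this.fderiv]
      rfl
    rw [pd_congr e, pd_const_mul_sub (g := fun y => ((pd j ρ y : ℝ) : ℂ) * wave h κ x₀ (-ρ) (Dt h p) y)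
      (hw _) (dρ'.mul (hw _)), pd_mul dρ' (hw _), eρ]
    have a1 := (h1 (Dy h κ j p) j).self_of_nhds
    have a2 := (h1 (Dt h p) j).self_of_nhds
    rw [Dt_Dy] at a1
    have : (h : ℂ) ^ 2 * (h : ℂ)⁻¹ = h := by field_simp
    linear_combination a1 - ((pd j ρ x : ℝ) : ℂ) * a2 +
      (pd j (wave h κ x₀ (-ρ) (Dy h κ j p)) x - (((pd j (pd j ρ) x : ℝ) : ℂ) * wave h κ x₀ (-ρ) (Dt h p) x
        + ((pd j ρ x : ℝ) : ℂ) * pd j (wave h κ x₀ (-ρ) (Dt h p)) x)) * this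
  rw [opPz_eq, neg_sub, sub_eq_neg_add, ← Finset.sum_neg_distrib]
  congr 1
  push_cast
  rw [Finset.sum_mul, Finset.mul_sum, ← Finset.sum_sub_distrib]
  refine Finset.sum_congr rfl fun j _ => ?_
  have b1 := h2 j
  have b2 := (h1 p j).self_of_nhds
  linear_combination b1 - (X x j : ℂ) * b2

end SPoly

/-! ### Polynomial approximation of the coefficients -/

namespace SPoly

open MvPolynomial SmoothFun

variable {d : ℕ}

@[simp] lemma ev_algebraMap (t : ℝ) (y : Euc d) (c : ℂ) : ev t y (algebraMap ℂ (SPoly d) c) = c := by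
  rw [Algebra.algebraMap_eq_smul_one, ev_smul, map_one, mul_one]

lemma nm_algebraMap_le (s : ℝ) (c : ℂ) : nm s (algebraMap ℂ (SPoly d) c) ≤ ‖c‖ := by
  have h1 : algebraMap ℂ (SPoly d) c = C (c • 1) := by
    rw [C_smul, map_one, Algebra.algebraMap_eq_smul_one]
  rw [h1, nm_C]
  exact (sn_smul_le _ _).trans (mul_le_of_le_one_right (norm_nonneg _) sn_one_le)

lemma nm_prod_X_le {s : ℝ} (hs : 0 ≤ s) {n : ℕ} (i : Fin n → Fin d) :
    nm s (∏ k, (X (i k) : SPoly d)) ≤ s ^ n := by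
  have : ∀ A : Finset (Fin n), nm s (∏ k ∈ A, (X (i k) : SPoly d)) ≤ s ^ A.card := by
    classical
    intro A
    induction A using Finset.induction_on with
    | empty =>
      have := nm_algebraMap_le (d := d) s 1
      simpa using this
    | insert a A ha ih =>
      rw [Finset.prod_insert ha, Finset.card_insert_of_notMem ha, pow_succ']
      exact nm_mul_le_of_le hs (nm_X_le hs _) ih
  simpa using this Finset.univ

/-- The homogeneous term of degree `n` of a power series, as a polynomial. -/
noncomputable def homPoly (q : FormalMultilinearSeries ℝ (Euc d) ℝ) (n : ℕ) : SPoly d :=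
  ∑ i : Fin n → Fin d, algebraMap ℂ (SPoly d)
    ((q n (fun k => EuclideanSpace.single (i k) (1 : ℝ)) : ℝ) : ℂ) * ∏ k, X (i k)

lemma ev_homPoly (q : FormalMultilinearSeries ℝ (Euc d) ℝ) (n : ℕ) (t : ℝ) (y : Euc d) :
    ev t y (homPoly q n) = ((q n fun _ => y : ℝ) : ℂ) := by
  have hy : y = ∑ j, y j • EuclideanSpace.single j (1 : ℝ) := by
    have := (EuclideanSpace.basisFun (Fin d) ℝ).sum_repr y
    simpa using this.symm
  conv_rhs => rw [hy, ContinuousMultilinearMap.map_sum]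
  simp only [ContinuousMultilinearMap.map_smul_univ]
  rw [homPoly, map_sum]
  push_cast
  refine Finset.sum_congr rfl fun i _ => ?_
  rw [map_mul, ev_algebraMap, map_prod]
  simp [mul_comm]

lemma nm_homPoly_le {s : ℝ} (hs : 0 ≤ s) (q : FormalMultilinearSeries ℝ (Euc d) ℝ) (n : ℕ) :
    nm s (homPoly q n) ≤ ‖q n‖ * (d * s) ^ n := by
  have hterm : ∀ i ∈ (Finset.univ : Finset (Fin n → Fin d)), nm s (algebraMap ℂ (SPoly d)
      ((q n (fun k => EuclideanSpace.single (i k) (1 : ℝ)) : ℝ) : ℂ) * ∏ k, X (i k)) ≤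
      ‖q n‖ * s ^ n := by
    intro i _
    refine nm_mul_le_of_le hs ((nm_algebraMap_le s _).trans ?_) (nm_prod_X_le hs i)
    rw [Complex.norm_real]
    refine ((q n).le_opNorm _).trans ?_
    simp
  refine ((nm_sum_le hs _ _).trans (Finset.sum_le_sum hterm)).trans ?_
  rw [Finset.sum_const, Finset.card_univ, Fintype.card_fun, Fintype.card_fin, Fintype.card_fin,
    nsmul_eq_mul, mul_pow]
  push_cast
  exact le_of_eq (by ring)

/-- The partial sum of a power series, as a polynomial. -/
noncomputable def partialPoly (q : FormalMultilinearSeries ℝ (Euc d) ℝ) (M : ℕ) : SPoly d :=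
  ∑ n ∈ Finset.range M, homPoly q n

lemma ev_partialPoly (q : FormalMultilinearSeries ℝ (Euc d) ℝ) (M : ℕ) (t : ℝ) (y : Euc d) :
    ev t y (partialPoly q M) = ((q.partialSum M y : ℝ) : ℂ) := by
  rw [partialPoly, map_sum, FormalMultilinearSeries.partialSum]
  push_cast
  exact Finset.sum_congr rfl fun n _ => ev_homPoly q n t y

/-- Without its constant term the series is dominated by a geometric one of ratio `d * s / R ≤ 1 /
2`. The bound does not depend on the degree, which is essential when the degree grows like `1 / h`.
-/
lemma nm_partialPoly_sub_le {q : FormalMultilinearSeries ℝ (Euc d) ℝ} {M : ℕ} {A R c : ℝ}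
    (hA : 0 ≤ A) (hR : 0 < R) (hq : ∀ n < M + 1, ‖q n‖ * R ^ n ≤ A) (hc : q 0 0 = c) {s : ℝ}
    (hs : 0 ≤ s) (hsR : s ≤ R / (2 * (d + 1))) :
    nm s (partialPoly q (M + 1) - algebraMap ℂ (SPoly d) (c : ℂ)) ≤ 2 * A * d / R * s := by
  have h0 : homPoly q 0 = algebraMap ℂ (SPoly d) (c : ℂ) := by
    rw [homPoly]
    simp only [Finset.univ_unique, Finset.univ_eq_empty, Finset.prod_empty, mul_one,
      Finset.sum_singleton]
    congr 2
    rw [← hc]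
    congr 1
    exact Subsingleton.elim _ _
  rw [partialPoly, Finset.sum_range_succ', h0, add_sub_cancel_right]
  refine (nm_sum_le hs _ _).trans ?_
  set x : ℝ := d * s / R with hx
  have hx0 : 0 ≤ x := by positivity
  have hx1 : x ≤ 1 / 2 := by
    rw [hx, div_le_iff₀ hR]
    rw [le_div_iff₀ (by positivity)] at hsR
    nlinarith
  have hterm : ∀ n ∈ Finset.range M, nm s (homPoly q (n + 1)) ≤ A * x * (1 / 2) ^ n := by
    intro n hn
    have hn' : n + 1 < M + 1 := by simpa using hn
    have e : (d * s : ℝ) = R * x := by rw [hx]; field_simp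
    calc nm s (homPoly q (n + 1)) ≤ ‖q (n + 1)‖ * (d * s) ^ (n + 1) := nm_homPoly_le hs q _
      _ = ‖q (n + 1)‖ * R ^ (n + 1) * (x * x ^ n) := by rw [e, mul_pow]; ring
      _ ≤ A * (x * (1 / 2) ^ n) :=
        mul_le_mul (hq _ hn') (by gcongr) (by positivity) hA
      _ = _ := by ring
  refine (Finset.sum_le_sum hterm).trans ?_
  rw [← Finset.mul_sum]
  have h2 : ∑ n ∈ Finset.range M, (1 / 2 : ℝ) ^ n ≤ 2 := by
    rw [geom_sum_eq (by norm_num), div_le_iff_of_neg (by norm_num)]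
    have : (0 : ℝ) < (1 / 2) ^ M := by positivity
    linarith
  calc _ ≤ A * x * 2 := by gcongr
    _ = 2 * A * d / R * s := by rw [hx]; ring

/-- `f` has polynomial approximations near `x₀` with error `O(e(h))` when multiplied by the
Gaussian `exp (-|x - x₀|² / (2 h))`. -/
def HasApprox (f : Euc d → ℝ) (x₀ : Euc d) (e : ℝ → ℝ) : Prop :=
  ∃ K : ℝ, 0 < K ∧ ∃ r : ℝ, 0 < r ∧ ∀ᶠ h in 𝓝[>] (0 : ℝ), ∃ P : SPoly d,
    (∀ s, 0 ≤ s → s ≤ r → nm s (P - algebraMap ℂ (SPoly d) (f x₀ : ℂ)) ≤ K * s) ∧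
    ∀ (t : ℝ) (x : Euc d), ‖x - x₀‖ ≤ r →
      ‖(f x : ℂ) - ev t (x - x₀) P‖ * Real.exp (-‖x - x₀‖ ^ 2 / (2 * h)) ≤ K * e h

lemma HasApprox.mono {f : Euc d → ℝ} {x₀ : Euc d} {e e' : ℝ → ℝ} (hf : HasApprox f x₀ e)
    (he : ∀ᶠ h in 𝓝[>] (0 : ℝ), e h ≤ e' h) : HasApprox f x₀ e' := by
  obtain ⟨K, hK, r, hr, H⟩ := hf
  refine ⟨K, hK, r, hr, ?_⟩
  filter_upwards [H, he] with h ⟨P, h1, h2⟩ h3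
  exact ⟨P, h1, fun t x hx => (h2 t x hx).trans (mul_le_mul_of_nonneg_left h3 hK.le)⟩

/-- This is `a ^ m / m! ≤ exp a` at `a = y ^ 2 / (2 * h)`: under the Gaussian, two powers of `y` are
worth one power of `h`. -/
lemma pow_mul_gaussian_le {h : ℝ} (hh : 0 < h) (m : ℕ) (y : ℝ) :
    y ^ (2 * m) * Real.exp (-y ^ 2 / (2 * h)) ≤ m.factorial * 2 ^ m * h ^ m := by
  have h1 := Real.pow_div_factorial_le_exp (x := y ^ 2 / (2 * h)) (by positivity) m
  have h2 : (0 : ℝ) < m.factorial := by exact_mod_cast m.factorial_pos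
  rw [div_pow, div_div, div_le_iff₀ (by positivity)] at h1
  have h3 : Real.exp (-y ^ 2 / (2 * h)) * Real.exp (y ^ 2 / (2 * h)) = 1 := by
    rw [← Real.exp_add]; ring_nf; simp
  calc y ^ (2 * m) * Real.exp (-y ^ 2 / (2 * h))
      = (y ^ 2) ^ m * Real.exp (-y ^ 2 / (2 * h)) := by rw [pow_mul]
    _ ≤ Real.exp (y ^ 2 / (2 * h)) * ((2 * h) ^ m * m.factorial) *
        Real.exp (-y ^ 2 / (2 * h)) := by gcongr
    _ = (Real.exp (-y ^ 2 / (2 * h)) * Real.exp (y ^ 2 / (2 * h))) *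
        (m.factorial * 2 ^ m * h ^ m) := by rw [mul_pow]; ring
    _ = _ := by rw [h3, one_mul]

/-- Taylor expansion to degree `2 * m + 1` leaves a remainder of size `‖x - x₀‖ ^ (2 * (m + 1))`,
which the Gaussian converts into `h ^ (m + 1)`. -/
theorem hasApprox_of_contDiffAt {f : Euc d → ℝ} {x₀ : Euc d} (hf : ContDiffAt ℝ ∞ f x₀) (m : ℕ) :
    HasApprox f x₀ fun h => h ^ (m + 1) := by
  set n : ℕ := 2 * m + 1 with hn
  have hfn : ContDiffAt ℝ ((n : ℕ) + 1 : ℕ) f x₀ := hf.of_le (by exact_mod_cast le_top)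
  have hcont : ContinuousAt (iteratedFDeriv ℝ (n + 1) f) x₀ :=
    (hfn.iteratedFDeriv_right (i := n + 1) (m := 0) (by simp)).continuousAt
  set B : ℝ := ‖iteratedFDeriv ℝ (n + 1) f x₀‖ + 1 with hB
  have hev : ∀ᶠ x in 𝓝 x₀, ContDiffAt ℝ ((n : ℕ) + 1 : ℕ) f x ∧
      ‖iteratedFDeriv ℝ (n + 1) f x‖ ≤ B :=
    (hfn.eventually (by simp)).and
      ((hcont.norm.eventually_lt continuousAt_const (lt_add_one _)).mono fun _ h => h.le)
  obtain ⟨ε, hε, hball⟩ := Metric.eventually_nhds_iff_ball.1 hev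
  set q : FormalMultilinearSeries ℝ (Euc d) ℝ := fun k =>
    ((k.factorial : ℝ)⁻¹) • iteratedFDeriv ℝ k f x₀ with hq
  set A : ℝ := ∑ k ∈ Finset.range (n + 1), ‖q k‖ with hA
  have hA0 : 0 ≤ A := Finset.sum_nonneg fun _ _ => norm_nonneg _
  have hqA : ∀ k < n + 1, ‖q k‖ * 1 ^ k ≤ A := fun k hk => by
    rw [one_pow, mul_one]
    exact Finset.single_le_sum (f := fun k => ‖q k‖) (fun _ _ => norm_nonneg _)
      (Finset.mem_range.2 hk)
  set L : ℝ := B * ((m + 1).factorial * 2 ^ (m + 1)) with hL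
  have hB0 : 0 < B := by positivity
  have hL0 : 0 < L := by
    have : (0 : ℝ) < (m + 1).factorial := by exact_mod_cast (m + 1).factorial_pos
    positivity
  refine ⟨2 * A * d / 1 + L, by positivity, min (1 / (2 * (d + 1))) (ε / 2), by positivity, ?_⟩
  filter_upwards [self_mem_nhdsWithin] with h hh
  have hh0 : 0 < h := hh
  refine ⟨partialPoly q (n + 1), fun s hs hsr => ?_, fun t x hx => ?_⟩
  · refine (nm_partialPoly_sub_le hA0 one_pos hqA ?_ hs (hsr.trans (min_le_left _ _))).trans ?_
    · simp [hq]
    · nlinarith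
  · have hxε : ‖x - x₀‖ < ε := lt_of_le_of_lt (hx.trans (min_le_right _ _)) (by linarith)
    have hseg : ∀ u ∈ Set.Icc (0 : ℝ) 1, x₀ + u • (x - x₀) ∈ Metric.ball x₀ ε := by
      intro u hu
      rw [Metric.mem_ball, dist_eq_norm, add_sub_cancel_left, norm_smul,
        Real.norm_of_nonneg hu.1]
      exact (mul_le_of_le_one_left (norm_nonneg _) hu.2).trans_lt hxε
    have htay := map_add_eq_sum_add_integral_iteratedFDeriv (f := f) (x := x₀) (y := x - x₀)
      (n := n) (fun u hu => by exact_mod_cast (hball _ (hseg u hu)).1)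
    rw [add_sub_cancel] at htay
    have hps : q.partialSum (n + 1) (x - x₀) = ∑ k ∈ Finset.range (n + 1),
        ((k.factorial : ℝ)⁻¹) • (iteratedFDeriv ℝ k f x₀ fun _ => x - x₀) := by
      rw [FormalMultilinearSeries.partialSum]
      rfl
    have hint : ‖∫ u in (0 : ℝ)..1, (1 - u) ^ n • iteratedFDeriv ℝ (n + 1) f (x₀ + u • (x - x₀))
        (fun _ => x - x₀)‖ ≤ B * ‖x - x₀‖ ^ (n + 1) * |1 - 0| := by
      refine intervalIntegral.norm_integral_le_of_norm_le_const fun u hu => ?_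
      rw [Set.uIoc_of_le zero_le_one] at hu
      have hu' : u ∈ Set.Icc (0 : ℝ) 1 := ⟨hu.1.le, hu.2⟩
      rw [norm_smul]
      have h1 : ‖(1 - u) ^ n‖ ≤ 1 := by
        rw [norm_pow, Real.norm_of_nonneg (by linarith [hu.2])]
        exact pow_le_one₀ (by linarith [hu.2]) (by linarith [hu.1])
      refine (mul_le_of_le_one_left (norm_nonneg _) h1).trans ?_
      refine (ContinuousMultilinearMap.le_opNorm _ _).trans ?_
      simp only [Finset.prod_const, Finset.card_univ, Fintype.card_fin]
      exact mul_le_mul_of_nonneg_right (hball _ (hseg u hu')).2 (by positivity)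
    rw [ev_partialPoly, ← Complex.ofReal_sub, Complex.norm_real, hps, htay, add_sub_cancel_left,
      norm_smul]
    have hfac : ‖((n.factorial : ℝ)⁻¹)‖ ≤ 1 := by
      rw [norm_inv, Real.norm_natCast]
      exact inv_le_one_of_one_le₀ (by exact_mod_cast n.factorial_pos)
    have hn2 : n + 1 = 2 * (m + 1) := by omega
    have hb := (mul_le_of_le_one_left (norm_nonneg _) hfac).trans hint
    rw [sub_zero, abs_one, mul_one, hn2] at hb
    calc _ ≤ B * ‖x - x₀‖ ^ (2 * (m + 1)) * Real.exp (-‖x - x₀‖ ^ 2 / (2 * h)) := by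
          refine mul_le_mul_of_nonneg_right ?_ (Real.exp_pos _).le
          rw [← hn2] at hb ⊢
          exact hb
      _ = B * (‖x - x₀‖ ^ (2 * (m + 1)) * Real.exp (-‖x - x₀‖ ^ 2 / (2 * h))) := by ring
      _ ≤ B * ((m + 1).factorial * 2 ^ (m + 1) * h ^ (m + 1)) := by
          exact mul_le_mul_of_nonneg_left (pow_mul_gaussian_le hh0 _ _) hB0.le
      _ = L * h ^ (m + 1) := by rw [hL]; ring
      _ ≤ (2 * A * d / 1 + L) * h ^ (m + 1) := by
          have : 0 ≤ 2 * A * d / 1 := by positivity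
          gcongr
          linarith

/-- Partial sums converge at a geometric rate `a < 1` near `x₀`. Truncating at degree about `1 / h`
gives the error `a ^ (1 / h) = exp (log a / h)`; the Gaussian is merely bounded by `1`. -/
theorem hasApprox_of_analyticAt {f : Euc d → ℝ} {x₀ : Euc d} (hf : AnalyticAt ℝ f x₀) :
    ∃ δ : ℝ, 0 < δ ∧ HasApprox f x₀ fun h => Real.exp (-δ / h) := by
  obtain ⟨q, R, hq⟩ := hf
  obtain ⟨R', hR'0, hR'R⟩ := ENNReal.lt_iff_exists_nnreal_btwn.1 hq.r_pos
  have hR'pos : 0 < (R' : ℝ) := by exact_mod_cast hR'0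
  obtain ⟨a, ha, C, hC, happrox⟩ := hq.uniform_geometric_approx' hR'R
  obtain ⟨A, hA, hqA⟩ := q.norm_mul_pow_le_of_lt_radius (hR'R.trans_le hq.r_le)
  have hlog : 0 < -Real.log a := neg_pos.2 (Real.log_neg ha.1 ha.2)
  refine ⟨-Real.log a, hlog, 2 * A * d / R' + C, by positivity, min (R' / (2 * (d + 1))) (R' / 2),
    by positivity, ?_⟩
  filter_upwards [self_mem_nhdsWithin] with h hh
  have hh0 : 0 < h := hh
  refine ⟨partialPoly q (⌈1 / h⌉₊ + 1), fun s hs hsr => ?_, fun t x hx => ?_⟩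
  · refine (nm_partialPoly_sub_le hA.le hR'pos (fun n _ => hqA n) (hq.coeff_zero 0) hs
      (hsr.trans (min_le_left _ _))).trans ?_
    nlinarith
  · have hxR : x - x₀ ∈ Metric.ball (0 : Euc d) R' := by
      rw [mem_ball_zero_iff]
      exact lt_of_le_of_lt (hx.trans (min_le_right _ _)) (by linarith)
    have h1 := happrox _ hxR (⌈1 / h⌉₊ + 1)
    rw [add_sub_cancel] at h1
    rw [ev_partialPoly, ← Complex.ofReal_sub, Complex.norm_real]
    have hexp : Real.exp (-‖x - x₀‖ ^ 2 / (2 * h)) ≤ 1 := by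
      rw [Real.exp_le_one_iff, neg_div]
      have : 0 ≤ ‖x - x₀‖ ^ 2 / (2 * h) := by positivity
      linarith
    have hle : a * (‖x - x₀‖ / R') ≤ a := by
      refine mul_le_of_le_one_right ha.1.le ?_
      rw [div_le_one hR'pos]
      exact (mem_ball_zero_iff.1 hxR).le
    have hpow : a ^ (⌈1 / h⌉₊ + 1) ≤ Real.exp (-(-Real.log a) / h) := by
      rw [← Real.rpow_natCast, Real.rpow_def_of_pos ha.1, Real.exp_le_exp, neg_neg]
      have : 1 / h ≤ ((⌈1 / h⌉₊ + 1 : ℕ) : ℝ) := by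
        push_cast
        linarith [Nat.le_ceil (1 / h)]
      have h2 := mul_le_mul_of_nonneg_left this hlog.le
      rw [mul_one_div] at h2
      linarith [neg_div h (Real.log a)]
    calc _ ≤ ‖f x - q.partialSum (⌈1 / h⌉₊ + 1) (x - x₀)‖ :=
          mul_le_of_le_one_right (norm_nonneg _) hexp
      _ ≤ C * (a * (‖x - x₀‖ / R')) ^ (⌈1 / h⌉₊ + 1) := h1
      _ ≤ C * a ^ (⌈1 / h⌉₊ + 1) := by
          have := ha.1
          gcongr
      _ ≤ C * Real.exp (-(-Real.log a) / h) := by gcongr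
      _ ≤ _ := by
          refine mul_le_mul_of_nonneg_right ?_ (Real.exp_pos _).le
          have : 0 ≤ 2 * A * d / R' := by positivity
          linarith

end SPoly

/-! ### Pointwise bounds for wave packets -/

namespace SPoly

open MvPolynomial SmoothFun

variable {d : ℕ}

lemma norm_exp_phase {h : ℝ} {κ : Fin d → ℂ} (hκ : ∀ j, (κ j).re = 0) (x₀ x : Euc d) :
    ‖Complex.exp (phase h κ x₀ x)‖ = Real.exp (-‖x - x₀‖ ^ 2 / (2 * h)) := by
  rw [Complex.norm_exp, phase, Complex.re_sum, EuclideanSpace.real_norm_sq_eq]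
  congr 1
  rw [← Finset.sum_neg_distrib, Finset.sum_div]
  refine Finset.sum_congr rfl fun j _ => ?_
  generalize (x - x₀) j = a
  rw [Complex.div_ofReal_re, Complex.sub_re, Complex.mul_re, hκ, ← Complex.ofReal_pow]
  simp only [Complex.div_ofNat_re, Complex.ofReal_re, Complex.ofReal_im]
  ring

lemma norm_wave_le {h : ℝ} {κ : Fin d → ℂ} (hκ : ∀ j, (κ j).re = 0) {x₀ x : Euc d}
    {τ : Euc d → ℝ} {p : SPoly d} {s K : ℝ} (hτ : τ x ∈ Set.Icc (0 : ℝ) 1) (hx : ‖x - x₀‖ ≤ s)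
    (hp : nm s p ≤ K) : ‖wave h κ x₀ τ p x‖ ≤ K * Real.exp (-‖x - x₀‖ ^ 2 / (2 * h)) := by
  rw [wave, norm_mul, norm_exp_phase hκ, mul_comm]
  exact mul_le_mul_of_nonneg_right ((norm_ev_le hτ hx p).trans hp) (Real.exp_pos _).le

lemma wave_op (D : OpData d) (h : ℝ) (x₀ : Euc d) (τ : Euc d → ℝ) (p : SPoly d) (x : Euc d) :
    wave h D.κ x₀ τ (D.op h p) x =
      (∑ j, (wave h D.κ x₀ τ (Dy h D.κ j (Dy h D.κ j p)) x -
        2 * (ev (τ x) (x - x₀) (D.B j) * wave h D.κ x₀ τ (Dy h D.κ j (Dt h p)) x) +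
        ev (τ x) (x - x₀) (D.B j) * ev (τ x) (x - x₀) (D.B j) *
          wave h D.κ x₀ τ (Dt h (Dt h p)) x -
        ev (τ x) (x - x₀) (D.Y j) * wave h D.κ x₀ τ (Dy h D.κ j p) x +
        ev (τ x) (x - x₀) (D.Y j) * ev (τ x) (x - x₀) (D.B j) * wave h D.κ x₀ τ (Dt h p) x)) -
      h * (ev (τ x) (x - x₀) D.E * wave h D.κ x₀ τ (Dt h p) x) + D.z * wave h D.κ x₀ τ p x := by
  rw [wave, D.op_apply]
  simp only [map_add, map_sub, map_sum, map_mul, ev_smul, wave, mul_add, mul_sub, Finset.mul_sum]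
  congr 1
  · congr 1
    · exact Finset.sum_congr rfl fun j _ => by ring
    · ring
  · ring

/-- The formulas `opPz_wave` and `wave_op` have the same shape, with true and with polynomial
coefficients. Their difference is a sum of coefficient errors times wave packets, and the Gaussian
of the packet is spent on making each coefficient error small. -/
lemma norm_opPz_wave_le {D : OpData d} {h : ℝ} (hh : 0 < h) (hh1 : h ≤ 1)
    (hκ : ∀ j, (D.κ j).re = 0) {x₀ x : Euc d} {ρ : Euc d → ℝ} (hρ : ContDiffAt ℝ ∞ ρ x)
    {X : Euc d → Euc d} {p : SPoly d} {s K A e : ℝ} (hK : 1 ≤ K) (hA : 1 ≤ A)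
    (ht : -ρ x ∈ Set.Icc (0 : ℝ) 1) (hx : ‖x - x₀‖ ≤ s)
    (h1 : nm s (Dt h p) ≤ K) (h2 : nm s (Dt h (Dt h p)) ≤ K)
    (h3 : ∀ j, nm s (Dy h D.κ j p) ≤ K) (h4 : ∀ j, nm s (Dy h D.κ j (Dt h p)) ≤ K)
    (hR : ∀ j, |pd j ρ x| ≤ A) (hX : ∀ j, |X x j| ≤ A)
    (hB : ∀ j, ‖ev (-ρ x) (x - x₀) (D.B j)‖ ≤ A)
    (eB : ∀ j, ‖((pd j ρ x : ℝ) : ℂ) - ev (-ρ x) (x - x₀) (D.B j)‖ *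
      Real.exp (-‖x - x₀‖ ^ 2 / (2 * h)) ≤ e)
    (eY : ∀ j, ‖((X x j : ℝ) : ℂ) - ev (-ρ x) (x - x₀) (D.Y j)‖ *
      Real.exp (-‖x - x₀‖ ^ 2 / (2 * h)) ≤ e)
    (eE : ‖((∑ j, pd j (pd j ρ) x : ℝ) : ℂ) - ev (-ρ x) (x - x₀) D.E‖ *
      Real.exp (-‖x - x₀‖ ^ 2 / (2 * h)) ≤ e) :
    ‖opPz X D.z h (wave h D.κ x₀ (-ρ) p) x‖ ≤
      7 * (d + 1) * A * K * e + nm s (D.op h p) := by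
  set G := Real.exp (-‖x - x₀‖ ^ 2 / (2 * h)) with hG
  have hG1 : G ≤ 1 := by
    rw [hG, Real.exp_le_one_iff, neg_div]
    have : 0 ≤ ‖x - x₀‖ ^ 2 / (2 * h) := by positivity
    linarith
  have hG0 : 0 < G := Real.exp_pos _
  have hs : 0 ≤ s := (norm_nonneg _).trans hx
  have hop : ‖wave h D.κ x₀ (-ρ) (D.op h p) x‖ ≤ nm s (D.op h p) :=
    (norm_wave_le hκ (τ := -ρ) ht hx le_rfl).trans
      (mul_le_of_le_one_right (nm_nonneg hs _) hG1)
  have he : 0 ≤ e := (mul_nonneg (norm_nonneg _) hG0.le).trans eE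
  have aux : ∀ {a w : ℂ}, ‖a‖ * G ≤ e → ‖w‖ ≤ K * G → ‖a * w‖ ≤ K * e := by
    intro a w ha hw
    rw [norm_mul]
    calc ‖a‖ * ‖w‖ ≤ ‖a‖ * (K * G) := by gcongr
      _ = K * (‖a‖ * G) := by ring
      _ ≤ K * e := by gcongr
  have w1 := norm_wave_le (h := h) hκ (τ := -ρ) ht hx h1
  have w2 := norm_wave_le (h := h) hκ (τ := -ρ) ht hx h2
  have w3 := fun j => norm_wave_le (h := h) hκ (τ := -ρ) ht hx (h3 j)
  have w4 := fun j => norm_wave_le (h := h) hκ (τ := -ρ) ht hx (h4 j)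
  have hdecomp : -opPz X D.z h (wave h D.κ x₀ (-ρ) p) x =
      wave h D.κ x₀ (-ρ) (D.op h p) x + ((∑ j,
        (-(2 * ((((pd j ρ x : ℝ) : ℂ) - ev (-ρ x) (x - x₀) (D.B j)) *
            wave h D.κ x₀ (-ρ) (Dy h D.κ j (Dt h p)) x)) +
          (((pd j ρ x : ℝ) : ℂ) + ev (-ρ x) (x - x₀) (D.B j)) *
            ((((pd j ρ x : ℝ) : ℂ) - ev (-ρ x) (x - x₀) (D.B j)) *
              wave h D.κ x₀ (-ρ) (Dt h (Dt h p)) x) -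
          (((X x j : ℝ) : ℂ) - ev (-ρ x) (x - x₀) (D.Y j)) *
            wave h D.κ x₀ (-ρ) (Dy h D.κ j p) x +
          (((X x j : ℝ) : ℂ) * ((((pd j ρ x : ℝ) : ℂ) - ev (-ρ x) (x - x₀) (D.B j)) *
              wave h D.κ x₀ (-ρ) (Dt h p) x) +
            ev (-ρ x) (x - x₀) (D.B j) * ((((X x j : ℝ) : ℂ) - ev (-ρ x) (x - x₀) (D.Y j)) *
              wave h D.κ x₀ (-ρ) (Dt h p) x)))) -
        h * ((((∑ j, pd j (pd j ρ) x : ℝ) : ℂ) - ev (-ρ x) (x - x₀) D.E) *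
          wave h D.κ x₀ (-ρ) (Dt h p) x)) := by
    rw [opPz_wave hh D.κ x₀ hρ p X D.z, wave_op]
    have : ∀ S T a b c r : ℂ, S - T = r → S - h * a + c = (T - h * b + c) + (r - h * (a - b)) := by
      intro S T a b c r hr
      rw [← hr]; ring
    rw [sub_mul (((∑ j, pd j (pd j ρ) x : ℝ) : ℂ))]
    refine this _ _ _ _ _ _ ?_
    rw [← Finset.sum_sub_distrib]
    refine Finset.sum_congr rfl fun j _ => ?_
    simp only [Pi.neg_apply]
    ring
  have hterm : ∀ j, ‖(-(2 * ((((pd j ρ x : ℝ) : ℂ) - ev (-ρ x) (x - x₀) (D.B j)) *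
            wave h D.κ x₀ (-ρ) (Dy h D.κ j (Dt h p)) x)) +
          (((pd j ρ x : ℝ) : ℂ) + ev (-ρ x) (x - x₀) (D.B j)) *
            ((((pd j ρ x : ℝ) : ℂ) - ev (-ρ x) (x - x₀) (D.B j)) *
              wave h D.κ x₀ (-ρ) (Dt h (Dt h p)) x) -
          (((X x j : ℝ) : ℂ) - ev (-ρ x) (x - x₀) (D.Y j)) *
            wave h D.κ x₀ (-ρ) (Dy h D.κ j p) x +
          (((X x j : ℝ) : ℂ) * ((((pd j ρ x : ℝ) : ℂ) - ev (-ρ x) (x - x₀) (D.B j)) *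
              wave h D.κ x₀ (-ρ) (Dt h p) x) +
            ev (-ρ x) (x - x₀) (D.B j) * ((((X x j : ℝ) : ℂ) - ev (-ρ x) (x - x₀) (D.Y j)) *
              wave h D.κ x₀ (-ρ) (Dt h p) x)))‖ ≤ 7 * A * (K * e) := by
    intro j
    have q1 := aux (eB j) (w4 j)
    have q2 := aux (eB j) w2
    have q3 := aux (eY j) (w3 j)
    have q4 := aux (eB j) w1
    have q5 := aux (eY j) w1
    have hRj : ‖((pd j ρ x : ℝ) : ℂ)‖ ≤ A := by rw [Complex.norm_real]; exact hR j
    have hXj : ‖((X x j : ℝ) : ℂ)‖ ≤ A := by rw [Complex.norm_real]; exact hX j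
    have hKe : 0 ≤ K * e := by positivity
    refine (norm_add_le _ _).trans ((add_le_add ((norm_sub_le _ _).trans (add_le_add
      ((norm_add_le _ _).trans (add_le_add (?_ : _ ≤ 2 * (K * e)) (?_ : _ ≤ 2 * A * (K * e))))
      q3)) ((norm_add_le _ _).trans (add_le_add (?_ : _ ≤ A * (K * e))
      (?_ : _ ≤ A * (K * e))))).trans ?_)
    · rw [norm_neg, norm_mul]
      refine mul_le_mul (by simp) q1 (norm_nonneg _) (by norm_num)
    · rw [norm_mul]
      refine mul_le_mul ?_ q2 (norm_nonneg _) (by linarith)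
      linarith [norm_add_le ((pd j ρ x : ℝ) : ℂ) (ev (-ρ x) (x - x₀) (D.B j)), hB j]
    · rw [norm_mul]
      exact mul_le_mul hXj q4 (norm_nonneg _) (by linarith)
    · rw [norm_mul]
      exact mul_le_mul (hB j) q5 (norm_nonneg _) (by linarith)
    · nlinarith
  rw [← norm_neg, hdecomp]
  have hE : ‖(h : ℂ) * ((((∑ j, pd j (pd j ρ) x : ℝ) : ℂ) - ev (-ρ x) (x - x₀) D.E) *
          wave h D.κ x₀ (-ρ) (Dt h p) x)‖ ≤ K * e := by
    rw [norm_mul, Complex.norm_real, Real.norm_of_nonneg hh.le]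
    exact (mul_le_of_le_one_left (norm_nonneg _) hh1).trans (aux eE w1)
  refine (norm_add_le _ _).trans ((add_le_add hop ((norm_sub_le _ _).trans (add_le_add
    ((norm_sum_le _ _).trans (Finset.sum_le_sum fun j _ => hterm j)) hE))).trans ?_)
  rw [Finset.sum_const, Finset.card_univ, Fintype.card_fin, nsmul_eq_mul]
  have : 0 ≤ K * e := by positivity
  nlinarith

lemma hasDerivAt_ev_time (t : ℝ) (y : Euc d) (p : SPoly d) :
    HasDerivAt (fun t => ev t y p) (ev t y (tderiv p)) t := by
  induction p using MvPolynomial.induction_on with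
  | C f => simpa [tderiv, lift_C] using f.hasDerivAt t
  | add p q hp hq =>
    simp only [map_add]
    exact hp.add hq
  | mul_X p j hp =>
    simp only [map_mul, ev_X, tderiv_mul_X]
    exact hp.mul_const _

lemma norm_ev_sub_le {h : ℝ} (hh : 0 < h) {y : Euc d} {p : SPoly d} {K s : ℝ}
    (hy : ‖y‖ ≤ s) (hp : nm s (Dt h p) ≤ K) {t : ℝ} (ht : t ∈ Set.Icc (0 : ℝ) 1) :
    ‖ev t y p - ev 0 y p‖ ≤ K * t / h := by
  have hd : ∀ u ∈ Set.Icc 0 t, HasDerivWithinAt (fun t => ev t y p) (ev u y (tderiv p))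
      (Set.Icc 0 t) u := fun u _ => (hasDerivAt_ev_time u y p).hasDerivWithinAt
  have := (convex_Icc 0 t).norm_image_sub_le_of_norm_hasDerivWithin_le (C := K / h) hd
    (fun u hu => ?_) (Set.left_mem_Icc.2 ht.1) (Set.right_mem_Icc.2 ht.1)
  · rw [sub_zero, Real.norm_of_nonneg ht.1] at this
    exact this.trans_eq (by ring)
  · rw [← tderiv_eq hh, ev_smul, norm_mul, norm_inv, Complex.norm_real,
      Real.norm_of_nonneg hh.le, inv_mul_eq_div]
    gcongr
    exact (norm_ev_le ⟨hu.1, hu.2.trans ht.2⟩ hy _).trans hp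

/-- First-order Taylor expansion in `t` with the Cauchy data `0`, `1`. It shows that the profile
really grows like `t / h` off the boundary, so that normalization cannot destroy the error bounds.
-/
lemma norm_ev_sub_div_le {h : ℝ} (hh : 0 < h) {y : Euc d} {p : SPoly d} {K s : ℝ}
    (hy : ‖y‖ ≤ s) (hp : nm s (Dt h (Dt h p)) ≤ K) (h0 : ev 0 y p = 0)
    (h1 : ev 0 y (Dt h p) = 1) {t : ℝ} (ht : t ∈ Set.Icc (0 : ℝ) 1) :
    ‖ev t y p - t / h‖ ≤ K * t ^ 2 / h ^ 2 := by
  have hK : 0 ≤ K := (nm_nonneg ((norm_nonneg y).trans hy) _).trans hp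
  have hd : ∀ u ∈ Set.Icc 0 t, HasDerivWithinAt (fun t : ℝ => ev t y p - (t : ℂ) / h)
      (ev u y (tderiv p) - 1 / h) (Set.Icc 0 t) u := fun u _ =>
    ((hasDerivAt_ev_time u y p).sub
      ((Complex.ofRealCLM.hasDerivAt (x := u)).div_const (h : ℂ))).hasDerivWithinAt
  have := (convex_Icc 0 t).norm_image_sub_le_of_norm_hasDerivWithin_le (C := K * t / h ^ 2) hd
    (fun u hu => ?_) (Set.left_mem_Icc.2 ht.1) (Set.right_mem_Icc.2 ht.1)
  · rw [sub_zero, Real.norm_of_nonneg ht.1, h0] at this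
    simp only [Complex.ofReal_zero, zero_div, sub_zero] at this
    exact this.trans_eq (by ring)
  · have hu1 : u ∈ Set.Icc (0 : ℝ) 1 := ⟨hu.1, hu.2.trans ht.2⟩
    have key := norm_ev_sub_le hh hy hp hu1
    rw [h1] at key
    have e : ev u y (tderiv p) - 1 / h = (h : ℂ)⁻¹ * (ev u y (Dt h p) - 1) := by
      rw [← tderiv_eq hh, ev_smul]; ring
    rw [e, norm_mul, norm_inv, Complex.norm_real, Real.norm_of_nonneg hh.le]
    calc h⁻¹ * ‖ev u y (Dt h p) - 1‖ ≤ h⁻¹ * (K * u / h) := by gcongr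
      _ ≤ h⁻¹ * (K * t / h) := by have := hu.2; gcongr
      _ = _ := by field_simp

lemma HasApprox.family {ι : Type*} [Fintype ι] {F : ι → Euc d → ℝ} {x₀ : Euc d} {e : ℝ → ℝ}
    (he : ∀ᶠ h in 𝓝[>] (0 : ℝ), 0 ≤ e h) (hF : ∀ i, HasApprox (F i) x₀ e) :
    ∃ K : ℝ, 0 < K ∧ ∃ r : ℝ, 0 < r ∧ ∀ᶠ h in 𝓝[>] (0 : ℝ), ∃ P : ι → SPoly d, ∀ i,
      (∀ s, 0 ≤ s → s ≤ r → nm s (P i - algebraMap ℂ (SPoly d) (F i x₀ : ℂ)) ≤ K * s) ∧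
      ∀ (t : ℝ) (x : Euc d), ‖x - x₀‖ ≤ r →
        ‖(F i x : ℂ) - ev t (x - x₀) (P i)‖ * Real.exp (-‖x - x₀‖ ^ 2 / (2 * h)) ≤ K * e h := by
  choose K hK r hr H using hF
  have hKi : ∀ i, K i ≤ ∑ i, K i + 1 := fun i =>
    (Finset.single_le_sum (fun i _ => (hK i).le) (Finset.mem_univ i)).trans (by linarith)
  -- A positive common radius below every `r i`, valid also for an empty index type.
  have hri : ∀ i, (1 + ∑ i, (r i)⁻¹)⁻¹ ≤ r i := fun i => by
    rw [inv_le_comm₀ (by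
      have : 0 ≤ ∑ i, (r i)⁻¹ := Finset.sum_nonneg fun i _ => (inv_pos.2 (hr i)).le
      linarith) (hr i)]
    exact (Finset.single_le_sum (f := fun i => (r i)⁻¹) (fun i _ => (inv_pos.2 (hr i)).le)
      (Finset.mem_univ i)).trans (by linarith)
  refine ⟨∑ i, K i + 1, ?_, (1 + ∑ i, (r i)⁻¹)⁻¹, ?_, ?_⟩
  · have : 0 ≤ ∑ i, K i := Finset.sum_nonneg fun i _ => (hK i).le
    linarith
  · have : 0 ≤ ∑ i, (r i)⁻¹ := Finset.sum_nonneg fun i _ => (inv_pos.2 (hr i)).le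
    positivity
  · filter_upwards [eventually_all.2 H, he] with h hh hhe
    choose P hP1 hP2 using hh
    exact ⟨P, fun i => ⟨fun s hs hsr => (hP1 i s hs (hsr.trans (hri i))).trans
      (mul_le_mul_of_nonneg_right (hKi i) hs), fun t x hx => (hP2 i t x (hx.trans (hri i))).trans
      (mul_le_mul_of_nonneg_right (hKi i) hhe)⟩⟩

end SPoly

/-! ### The local quasimode -/

namespace SPoly

open MvPolynomial SmoothFun

variable {d : ℕ}

/-- The coefficient functions of the conjugated operator. -/
noncomputable def coeffFun (ρ : Euc d → ℝ) (X : Euc d → Euc d) :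
    Option (Fin d ⊕ Fin d) → Euc d → ℝ
  | none => fun x => ∑ j, pd j (pd j ρ) x
  | some (Sum.inl j) => pd j ρ
  | some (Sum.inr j) => fun x => X x j

lemma half_pow_floor_le {c : ℝ} : (1 / 2 : ℝ) ^ ⌊c⌋₊ ≤ 2 * Real.exp (-(c * Real.log 2)) := by
  have h1 : c - 1 ≤ ⌊c⌋₊ := by linarith [Nat.lt_floor_add_one c]
  have h2 : (1 / 2 : ℝ) ^ ⌊c⌋₊ = Real.exp (-(⌊c⌋₊ * Real.log 2)) := by
    rw [one_div, inv_pow, ← Real.rpow_natCast, Real.rpow_def_of_pos two_pos, ← Real.exp_neg,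
      mul_comm]
  have h3 : (2 : ℝ) = Real.exp (Real.log 2) := (Real.exp_log two_pos).symm
  rw [h2]
  conv_rhs => rw [h3, ← Real.exp_add, ← h3]
  rw [Real.exp_le_exp]
  nlinarith [Real.log_pos one_lt_two]

set_option maxHeartbeats 600000 in
-- Many estimates with a large local context.
theorem exists_local_quasimode {ρ : Euc d → ℝ} {X : Euc d → Euc d} {x₀ : Euc d}
    {κ : Fin d → ℂ} {z g l₁ l₂ : ℂ} {e : ℝ → ℝ}
    (hρ : ∀ᶠ x in 𝓝 x₀, ContDiffAt ℝ ∞ ρ x) (hX : Continuous X)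
    (hκ : ∀ j, (κ j).re = 0) (hg : g ≠ 0) (h₁ : l₁.re < 0) (h₂ : l₂.re < 0)
    (hfr : ∀ B Y E, (OpData.mk κ (fun j => ((pd j ρ x₀ : ℝ) : ℂ)) (fun j => ((X x₀ j : ℝ) : ℂ))
      z B Y E).FrozenEq g l₁ l₂)
    (he : ∀ᶠ h in 𝓝[>] (0 : ℝ), 0 ≤ e h) (happ : ∀ i, HasApprox (coeffFun ρ X i) x₀ e) :
    ∃ a : ℝ, 0 < a ∧ ∃ K : ℝ, 1 ≤ K ∧ ∃ δ : ℝ, 0 < δ ∧ ∀ᶠ h in 𝓝[>] (0 : ℝ), ∃ p : SPoly d,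
      (∀ y, ev 0 y p = 0) ∧ ∀ x, ‖x - x₀‖ ≤ a → -ρ x ∈ Set.Icc (0 : ℝ) 1 →
        ‖opPz X z h (wave h κ x₀ (-ρ) p) x‖ ≤ K * (e h + Real.exp (-δ / h)) ∧
        ‖wave h κ x₀ (-ρ) p x‖ ≤ K * Real.exp (-‖x - x₀‖ ^ 2 / (2 * h)) ∧
        (∀ j, ‖h * pd j (wave h κ x₀ (-ρ) p) x‖ ≤ K * Real.exp (-‖x - x₀‖ ^ 2 / (2 * h))) ∧
        Real.exp (-‖x - x₀‖ ^ 2 / (2 * h)) * (-ρ x / h - K * (ρ x) ^ 2 / h ^ 2) ≤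
          ‖wave h κ x₀ (-ρ) p x‖ := by
  obtain ⟨K, hK, r₁, hr₁, hP⟩ := HasApprox.family he happ
  set F := coeffFun ρ X with hF
  set M : ℝ := 1 + ∑ j, ‖κ j‖ + ∑ i, |F i x₀| + K with hM
  have hκ0 : 0 ≤ ∑ j, ‖κ j‖ := Finset.sum_nonneg fun _ _ => norm_nonneg _
  have hF0 : 0 ≤ ∑ i, |F i x₀| := Finset.sum_nonneg fun _ _ => abs_nonneg _
  have hM1 : 1 ≤ M := by linarith
  have hMκ : ∀ j, ‖κ j‖ ≤ M := fun j => by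
    have := Finset.single_le_sum (f := fun j => ‖κ j‖) (fun _ _ => norm_nonneg _)
      (Finset.mem_univ j)
    linarith
  have hMF : ∀ i, |F i x₀| + K ≤ M := fun i => by
    have := Finset.single_le_sum (f := fun i => |F i x₀|) (fun _ _ => abs_nonneg _)
      (Finset.mem_univ i)
    linarith
  obtain ⟨ε, hε, hε1, Kn, hKn, hneu⟩ := exists_neumann_bounds (d := d) hM1 hg h₁ h₂
  -- `K * r ≤ ε` makes the polynomial coefficients `ε`-close to their frozen values, and `r ≤ ε / 2`
  -- leaves the other half of the gap condition for `4 * h * N / r`.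
  set r : ℝ := min (min r₁ 1) (min (ε / K) (ε / 2)) with hr
  have hr0 : 0 < r := by positivity
  have hrr₁ : r ≤ r₁ := (min_le_left _ _).trans (min_le_left _ _)
  have hr1 : r ≤ 1 := (min_le_left _ _).trans (min_le_right _ _)
  have hrK : K * r ≤ ε := by
    have : r ≤ ε / K := (min_le_right _ _).trans (min_le_left _ _)
    rwa [le_div_iff₀' hK] at this
  have hrε : r ≤ ε / 2 := (min_le_right _ _).trans (min_le_right _ _)
  set δ₀ : ℝ := ε * r / 8 with hδ₀
  have hδ₀0 : 0 < δ₀ := by positivity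
  have hcontF : ∀ i, ContinuousAt (F i) x₀ := by
    have hρ' := hρ.self_of_nhds
    rintro (_ | j | j)
    · show ContinuousAt (fun x => ∑ j, pd j (pd j ρ) x) x₀
      exact tendsto_finsetSum _ fun j _ =>
        (contDiffAt_pd le_rfl (contDiffAt_pd le_rfl hρ' j) j).continuousAt
    · exact (contDiffAt_pd le_rfl hρ' j).continuousAt
    · exact ((EuclideanSpace.proj j : Euc d →L[ℝ] ℝ).continuous.comp hX).continuousAt
  have hbd : ∀ᶠ x in 𝓝 x₀, ContDiffAt ℝ ∞ ρ x ∧ ∀ i, |F i x| ≤ M + 1 := by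
    refine hρ.and (eventually_all.2 fun i => ?_)
    refine ((hcontF i).abs.eventually_lt continuousAt_const ?_).mono fun _ h => h.le
    linarith [hMF i]
  obtain ⟨a₁, ha₁, hball⟩ := Metric.eventually_nhds_iff_ball.1 hbd
  set K₂ : ℝ := 4 * M ^ 2 * Kn + 1 with hK₂
  have hK₂1 : 1 ≤ K₂ := by
    have : 0 ≤ 4 * M ^ 2 * Kn := by positivity
    linarith
  set C₁ : ℝ := 7 * (d + 1) * (M + 1) * K₂ * K + 2 * Kn with hC₁
  have hC₁0 : 0 ≤ C₁ := by positivity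
  set C₂ : ℝ := K₂ * (M + 2) with hC₂
  have hC₂K : K₂ ≤ C₂ := by nlinarith
  refine ⟨min (a₁ / 2) (r / 4), by positivity, C₁ + C₂, by linarith, δ₀ * Real.log 2,
    mul_pos hδ₀0 (Real.log_pos one_lt_two), ?_⟩
  have hsmall : ∀ᶠ h in 𝓝[>] (0 : ℝ), h < min ε (δ₀ / 2) :=
    (eventually_lt_nhds (by positivity)).filter_mono nhdsWithin_le_nhds
  filter_upwards [hP, he, hsmall, self_mem_nhdsWithin] with h ⟨P, hPh⟩ heh hhs hh
  have hh0 : 0 < h := hh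
  have hhε : h ≤ ε := hhs.le.trans (min_le_left _ _)
  have hhδ : h ≤ δ₀ / 2 := hhs.le.trans (min_le_right _ _)
  set D : OpData d := ⟨κ, fun j => ((pd j ρ x₀ : ℝ) : ℂ), fun j => ((X x₀ j : ℝ) : ℂ), z,
    fun j => P (some (Sum.inl j)), fun j => P (some (Sum.inr j)), P none⟩ with hD
  -- The largest admissible number of steps: `N * h ≤ δ₀ = ε * r / 8` gives `4 * h * N / r ≤ ε / 2`.
  -- The residual `(1 / 2) ^ N` is then exponentially small in `1 / h`.
  set N : ℕ := ⌊δ₀ / h⌋₊ with hN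
  have hN2 : 2 ≤ N := by
    rw [hN]
    refine Nat.le_floor ?_
    rw [le_div_iff₀ hh0]
    push_cast
    linarith
  have hNle : (N : ℝ) ≤ δ₀ / h := Nat.floor_le (by positivity)
  have hgapN : 4 * h * N / r + r ≤ ε := by
    have : 4 * h * N / r ≤ ε / 2 := by
      rw [div_le_iff₀ hr0]
      rw [le_div_iff₀ hh0] at hNle
      calc 4 * h * N = 4 * (N * h) := by ring
        _ ≤ 4 * δ₀ := by linarith
        _ = ε / 2 * r := by rw [hδ₀]; ring
    linarith
  have hNgap : h / (r / 8) + r ≤ ε := by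
    have e1 : h / (r / 8) = 4 * h * 2 / r := by field_simp; ring
    have e2 : 4 * h * 2 / r ≤ 4 * h * N / r := by
      gcongr
      exact_mod_cast hN2
    linarith
  have hFK : ∀ i, nm r (P i) ≤ M := fun i => by
    have h1 := (hPh i).1 r hr0.le hrr₁
    have h2 := nm_add_le hr0.le (P i - algebraMap ℂ (SPoly d) (F i x₀ : ℂ))
      (algebraMap ℂ (SPoly d) (F i x₀ : ℂ))
    rw [sub_add_cancel] at h2
    have h3 := nm_algebraMap_le (d := d) r (F i x₀ : ℂ)
    rw [Complex.norm_real, Real.norm_eq_abs] at h3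
    have h4 : K * r ≤ K := mul_le_of_le_one_right hK.le hr1
    linarith [hMF i]
  have hMF' : ∀ i, |F i x₀| ≤ M := fun i => by linarith [hMF i]
  have hclose : D.Close M ε r :=
    { κ := hMκ
      β := fun j => by
        show ‖((pd j ρ x₀ : ℝ) : ℂ)‖ ≤ M
        rw [Complex.norm_real]
        exact hMF' (some (Sum.inl j))
      η := fun j => by
        show ‖((X x₀ j : ℝ) : ℂ)‖ ≤ M
        rw [Complex.norm_real]
        exact hMF' (some (Sum.inr j))
      B := fun j => ((hPh (some (Sum.inl j))).1 r hr0.le hrr₁).trans hrK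
      Y := fun j => ((hPh (some (Sum.inr j))).1 r hr0.le hrr₁).trans hrK
      E := hFK none }
  obtain ⟨htn, hop⟩ := hneu D h r N (hfr _ _ _) hr0 hclose hh0 hhε hN2 hgapN
  set p := neumann D h g l₁ l₂ N with hp
  have hrhalf : (0 : ℝ) ≤ r / 2 := by positivity
  have n0 : nm (r / 2) p ≤ Kn := by
    have := nm_nonneg hrhalf (Dt h p); have := nm_nonneg hrhalf (Dt h (Dt h p))
    rw [tn] at htn; linarith
  have n1 : nm (r / 2) (Dt h p) ≤ Kn := by
    have := nm_nonneg hrhalf p; have := nm_nonneg hrhalf (Dt h (Dt h p))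
    rw [tn] at htn; linarith
  have n2 : nm (r / 2) (Dt h (Dt h p)) ≤ Kn := by
    have := nm_nonneg hrhalf p; have := nm_nonneg hrhalf (Dt h p)
    rw [tn] at htn; linarith
  have hMM : M ≤ M ^ 2 := le_self_pow₀ hM1 two_ne_zero
  have hKM : Kn ≤ M * Kn := le_mul_of_one_le_left hKn.le hM1
  have hKMM : M * Kn ≤ M ^ 2 * Kn := mul_le_mul_of_nonneg_right hMM hKn.le
  have hKnK₂ : Kn ≤ K₂ := by rw [hK₂]; linarith
  have hMKnK₂ : 2 * M * Kn ≤ K₂ := by rw [hK₂]; linarith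
  have hmono : ∀ {q : SPoly d}, nm (r / 2) q ≤ Kn → nm (r / 4) q ≤ K₂ := fun {q} hq =>
    ((nm_mono (by positivity) (by linarith) q).trans hq).trans hKnK₂
  have hDy : ∀ {q : SPoly d} (j : Fin d), nm (r / 2) q ≤ Kn → nm (r / 4) (Dy h D.κ j q) ≤ K₂ := by
    intro q j hq
    have hgap' : h / (r / 2 - r / 4) + r / 2 ≤ ε := by
      have e1 : h / (r / 2 - r / 4) = h / (r / 8) / 2 := by field_simp; ring
      have e2 : 0 ≤ h / (r / 8) := by positivity
      rw [e1]; linarith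
    refine (nm_Dy_le hM1 hε1 hh0 (by positivity) (by linarith) hgap' hMκ j q).trans ?_
    exact (mul_le_mul_of_nonneg_left hq (by positivity)).trans hMKnK₂
  refine ⟨p, ev_neumann_zero D h g l₁ l₂ N, fun x hx ht => ?_⟩
  have hxr : ‖x - x₀‖ ≤ r / 4 := hx.trans (min_le_right _ _)
  have hxa : x ∈ Metric.ball x₀ a₁ := by
    rw [mem_ball_iff_norm]
    exact lt_of_le_of_lt (hx.trans (min_le_left _ _)) (by linarith)
  obtain ⟨hρx, hFx⟩ := hball x hxa
  have hxr₁ : ‖x - x₀‖ ≤ r₁ := hxr.trans (by linarith)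
  have hεh : ∀ i, ‖((F i x : ℝ) : ℂ) - ev (-ρ x) (x - x₀) (P i)‖ *
      Real.exp (-‖x - x₀‖ ^ 2 / (2 * h)) ≤ K * e h := fun i => (hPh i).2 _ x hxr₁
  have hbound := norm_opPz_wave_le (D := D) hh0 (hhε.trans hε1) hκ hρx (X := X) hK₂1
    (by linarith : 1 ≤ M + 1) ht hxr (hmono n1) (hmono n2) (fun j => hDy j n0) (fun j => hDy j n1)
    (fun j => hFx (some (Sum.inl j))) (fun j => hFx (some (Sum.inr j)))
    (fun j => ((norm_ev_le ht hxr _).trans (nm_mono (by positivity) (by linarith) _)).trans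
      ((hFK (some (Sum.inl j))).trans (by linarith)))
    (fun j => hεh (some (Sum.inl j))) (fun j => hεh (some (Sum.inr j))) (hεh none)
  set G := Real.exp (-‖x - x₀‖ ^ 2 / (2 * h)) with hG
  have hG0 : 0 < G := Real.exp_pos _
  have hw0 : ‖wave h κ x₀ (-ρ) p x‖ ≤ K₂ * G := norm_wave_le hκ (τ := -ρ) ht hxr (hmono n0)
  refine ⟨?_, ?_, fun j => ?_, ?_⟩
  · refine hbound.trans ((add_le_add_right (hop.trans (mul_le_mul_of_nonneg_left
      half_pow_floor_le hKn.le)) _).trans ?_)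
    have e1 : -(δ₀ / h * Real.log 2) = -(δ₀ * Real.log 2) / h := by ring
    rw [e1]
    set E := Real.exp (-(δ₀ * Real.log 2) / h)
    have hE : 0 < E := Real.exp_pos _
    have c1 : 7 * (d + 1) * (M + 1) * K₂ * (K * e h) = (C₁ - 2 * Kn) * e h := by rw [hC₁]; ring
    rw [c1]
    have c2 : 0 ≤ C₁ - 2 * Kn := by rw [hC₁]; simp only [add_sub_cancel_right]; positivity
    have c3 : 0 ≤ C₂ := by linarith
    have c4 := mul_nonneg c2 hE.le
    have c5 := mul_nonneg c3 hE.le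
    have c6 := mul_nonneg c3 heh
    have c7 := mul_nonneg hKn.le heh
    linarith only [c4, c5, c6, c7]
  · exact hw0.trans (mul_le_mul_of_nonneg_right (by linarith) hG0.le)
  · have hdiff : DifferentiableAt ℝ (-ρ) x := (hρx.differentiableAt (by simp)).neg
    rw [pd_wave hh0 κ x₀ hdiff]
    have hneg : |pd j (-ρ) x| ≤ M + 1 := by
      rw [pd, fderiv_neg]
      show |-(pd j ρ x)| ≤ M + 1
      rw [abs_neg]
      exact hFx (some (Sum.inl j))
    have b1 := norm_wave_le (h := h) hκ (τ := -ρ) ht hxr (hDy j n0)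
    have b2 := norm_wave_le (h := h) hκ (τ := -ρ) ht hxr (hmono n1)
    refine (norm_add_le _ _).trans ?_
    rw [norm_mul, Complex.norm_real, Real.norm_eq_abs]
    calc _ ≤ K₂ * G + (M + 1) * (K₂ * G) := by
          refine add_le_add b1 (mul_le_mul hneg b2 (norm_nonneg _) (by linarith))
      _ = C₂ * G := by rw [hC₂]; ring
      _ ≤ _ := mul_le_mul_of_nonneg_right (by linarith) hG0.le
  · rw [wave, norm_mul, norm_exp_phase hκ]
    refine mul_le_mul_of_nonneg_left ?_ hG0.le
    -- The lower bound: at depth `-ρ x` the amplitude differs from `-ρ x / h` by at most a quadratic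
    -- term.
    have key := norm_ev_sub_div_le hh0 hxr (hmono n2) (ev_neumann_zero D h g l₁ l₂ N _)
      (ev_Dt_neumann_zero D hh0 g l₁ l₂ N _) ht
    have hnorm : ‖(((-ρ x : ℝ) : ℂ)) / h‖ = -ρ x / h := by
      rw [← Complex.ofReal_div, Complex.norm_real, Real.norm_of_nonneg (div_nonneg ht.1 hh0.le)]
    have h5 := norm_sub_norm_le ((((-ρ x : ℝ) : ℂ)) / h) (ev (-ρ x) (x - x₀) p)
    rw [norm_sub_rev, hnorm] at h5
    have h6 : K₂ * (-ρ x) ^ 2 / h ^ 2 ≤ (C₁ + C₂) * (ρ x) ^ 2 / h ^ 2 := by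
      rw [neg_sq]
      gcongr
      linarith
    simp only [Pi.neg_apply]
    linarith

end SPoly

/-! ### Defining functions near the boundary and lower bounds of `L²` norms -/

section

variable {d : ℕ}

lemma IsDefiningFunctionOn.eq_zero_of_mem_frontier {n : WithTop ℕ∞} {Ω V : Set (Euc d)}
    {ρ : Euc d → ℝ} (hρ : IsDefiningFunctionOn n Ω V ρ) (hΩ : IsOpen Ω) (hV : IsOpen V)
    {x : Euc d} (hx : x ∈ frontier Ω) (hxV : x ∈ V) : ρ x = 0 := by
  rw [hΩ.frontier_eq] at hx
  refine le_antisymm ?_ (not_lt.1 fun h => hx.2 ((hρ.mem_iff x hxV).2 h))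
  by_contra! h
  have hc : ContinuousAt ρ x := (hρ.contDiffOn.continuousOn).continuousAt (hV.mem_nhds hxV)
  have hev : ∀ᶠ y in 𝓝 x, 0 < ρ y ∧ y ∈ V := (hc.eventually (lt_mem_nhds h)).and (hV.mem_nhds hxV)
  obtain ⟨y, hyΩ, hy⟩ := (mem_closure_iff_frequently.1 hx.1).and_eventually hev |>.exists
  exact absurd ((hρ.mem_iff y hy.2).1 hyΩ) (not_lt.2 hy.1.le)

lemma pd_const_mul (c : ℂ) (f : Euc d → ℂ) (j : Fin d) :
    pd j (fun x => c * f x) = fun x => c * pd j f x := by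
  funext x
  rw [pd, show (fun x => c * f x) = c • f from rfl, fderiv_const_smul_field]
  rfl

lemma opPz_const_mul (X : Euc d → Euc d) (z : ℂ) (h : ℝ) (c : ℂ) (f : Euc d → ℂ) (x : Euc d) :
    opPz X z h (fun x => c * f x) x = c * opPz X z h f x := by
  rw [opPz_eq, opPz_eq, mul_sub, Finset.mul_sum]
  simp only [pd_const_mul]
  congr 1
  · exact Finset.sum_congr rfl fun j _ => by ring
  · ring

lemma opPz_eq_zero {X : Euc d → Euc d} {z : ℂ} {h : ℝ} {f : Euc d → ℂ} {x : Euc d}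
    (hf : f =ᶠ[𝓝 x] 0) : opPz X z h f x = 0 := by
  have h1 : ∀ j, pd j f =ᶠ[𝓝 x] 0 := fun j => by
    filter_upwards [hf.eventuallyEq_nhds] with y hy
    rw [pd_congr hy, pd]
    simp
  have h2 : ∀ j, pd j (pd j f) x = 0 := fun j => by
    rw [pd_congr (h1 j), pd]
    simp
  rw [opPz_eq, hf.self_of_nhds]
  simp [h2, fun j => (h1 j).self_of_nhds]

/-- A function with derivative `L ≠ 0` at `x₀` is about `-t` on a ball of radius `≈ t` near `x₀`. -/
lemma exists_ball_near_zero {ρ : Euc d → ℝ} {x₀ : Euc d} (hρ : DifferentiableAt ℝ ρ x₀)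
    (h0 : ρ x₀ = 0) (hd : fderiv ℝ ρ x₀ ≠ 0) {τ : ℝ} (hτ : 0 < τ) :
    ∃ v : Euc d, ∃ η : ℝ, 0 < η ∧ η ≤ 1 ∧ ∀ᶠ h in 𝓝[>] (0 : ℝ),
      ∀ x ∈ Metric.ball (x₀ + h • v) (h * η), -ρ x / h ∈ Set.Icc (τ / 2) (3 * τ / 2) := by
  set L := fderiv ℝ ρ x₀ with hL
  obtain ⟨w, hw⟩ : ∃ w, L w ≠ 0 := by
    by_contra! H
    exact hd (ContinuousLinearMap.ext H)
  set v : Euc d := (-τ / L w) • w with hv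
  have hLv : L v = -τ := by rw [hv, map_smul, smul_eq_mul]; field_simp
  set η : ℝ := min 1 (τ / (4 * (‖L‖ + 1))) with hη
  have hη0 : 0 < η := by positivity
  have hη1 : η ≤ 1 := min_le_left _ _
  have hLη : ‖L‖ * η ≤ τ / 4 := by
    have : η ≤ τ / (4 * (‖L‖ + 1)) := min_le_right _ _
    calc ‖L‖ * η ≤ (‖L‖ + 1) * (τ / (4 * (‖L‖ + 1))) := by gcongr; linarith
      _ = τ / 4 := by field_simp
  refine ⟨v, η, hη0, hη1, ?_⟩
  set R : ℝ := ‖v‖ + 1 with hR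
  have hR0 : 0 < R := by positivity
  have hlo := hρ.hasFDerivAt.isLittleO.def (c := τ / (4 * R)) (by positivity)
  obtain ⟨ε, hε, hball⟩ := Metric.eventually_nhds_iff_ball.1 hlo
  have hsmall : ∀ᶠ h in 𝓝[>] (0 : ℝ), h < ε / R :=
    (eventually_lt_nhds (by positivity)).filter_mono nhdsWithin_le_nhds
  filter_upwards [hsmall, self_mem_nhdsWithin] with h hh hh0 x hx
  have hh0 : 0 < h := hh0
  set u : Euc d := x - (x₀ + h • v) with hu
  have hun : ‖u‖ ≤ h * η := (mem_ball_iff_norm.1 hx).le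
  have hxu : x - x₀ = h • v + u := by rw [hu]; abel
  have hxn : ‖x - x₀‖ ≤ h * R := by
    rw [hxu]
    refine (norm_add_le _ _).trans ?_
    rw [norm_smul, Real.norm_of_nonneg hh0.le, hR, mul_add]
    nlinarith
  have hxε : x ∈ Metric.ball x₀ ε := by
    rw [mem_ball_iff_norm]
    refine hxn.trans_lt ?_
    rwa [lt_div_iff₀ hR0] at hh
  have h1 := hball x hxε
  rw [h0, sub_zero, ← hL, hxu, map_add, map_smul, hLv, ← hxu, smul_eq_mul] at h1
  have h2 : τ / (4 * R) * ‖x - x₀‖ ≤ τ / 4 * h := by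
    calc τ / (4 * R) * ‖x - x₀‖ ≤ τ / (4 * R) * (h * R) := by gcongr
      _ = τ / 4 * h := by field_simp
  have h3 : |L u| ≤ τ / 4 * h := by
    refine (L.le_opNorm u).trans ?_
    calc ‖L‖ * ‖u‖ ≤ ‖L‖ * (h * η) := by gcongr
      _ = ‖L‖ * η * h := by ring
      _ ≤ τ / 4 * h := by gcongr
  have h4 := abs_le.1 (h1.trans h2)
  have h5 := abs_le.1 h3
  rw [Set.mem_Icc, le_div_iff₀ hh0, div_le_iff₀ hh0]
  constructor <;> linarith [h4.1, h4.2, h5.1, h5.2]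

/-- The natural factor is `r ^ (d / 2)`. Since `r ≤ 1`, it may be weakened to `r ^ d`, which avoids
half-integer powers; the loss is only polynomial. -/
lemma eLpNorm_ge_of_ball {Ω : Set (Euc d)} {f : Euc d → ℂ} {x : Euc d} {r c : ℝ} (hr : 0 < r)
    (hr1 : r ≤ 1) (hc : 0 ≤ c) (hsub : Metric.ball x r ⊆ Ω) (hf : ∀ y ∈ Metric.ball x r, c ≤ ‖f y‖) :
    ENNReal.ofReal (c * r ^ d * ((volume (Metric.ball (0 : Euc d) 1)) ^ (1 / 2 : ℝ)).toReal) ≤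
      eLpNorm f 2 (volume.restrict Ω) := by
  set v := volume (Metric.ball (0 : Euc d) 1) with hv
  have hvtop : v ^ (1 / 2 : ℝ) ≠ ⊤ :=
    ENNReal.rpow_ne_top_of_nonneg (by norm_num) measure_ball_lt_top.ne
  have h1 : eLpNorm (fun _ : Euc d => c) 2 (volume.restrict (Metric.ball x r)) ≤
      eLpNorm f 2 (volume.restrict Ω) := by
    refine le_trans ?_ (eLpNorm_mono_measure f (Measure.restrict_mono hsub le_rfl))
    refine eLpNorm_mono_ae ((ae_restrict_iff' measurableSet_ball).2 (ae_of_all _ fun y hy => ?_))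
    rw [Real.norm_of_nonneg hc]
    exact hf y hy
  refine le_trans ?_ h1
  rcases eq_or_ne (volume.restrict (Metric.ball x r)) 0 with h0 | h0
  · have := Metric.measure_ball_pos volume x hr
    rw [Measure.restrict_eq_zero] at h0
    exact absurd h0 this.ne'
  rw [eLpNorm_const c two_ne_zero h0, Measure.restrict_apply_univ, Measure.addHaar_ball_of_pos _ _ hr,
    finrank_euclideanSpace_fin, ENNReal.toReal_ofNat, ENNReal.mul_rpow_of_nonneg _ _ (by norm_num),
    ENNReal.ofReal_mul (by positivity), ENNReal.ofReal_mul hc, ENNReal.ofReal_toReal hvtop,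
    mul_assoc]
  rw [Real.enorm_of_nonneg hc]
  gcongr
  have hle : ENNReal.ofReal (r ^ d) ≤ 1 := by
    rw [ENNReal.ofReal_le_one]
    exact pow_le_one₀ hr.le hr1
  calc ENNReal.ofReal (r ^ d) = ENNReal.ofReal (r ^ d) ^ (1 : ℝ) := (ENNReal.rpow_one _).symm
    _ ≤ ENNReal.ofReal (r ^ d) ^ (1 / 2 : ℝ) :=
      ENNReal.rpow_le_rpow_of_exponent_ge hle (by norm_num)

end

/-! ### Cutting off the local quasimode -/

namespace SPoly

variable {d : ℕ}

lemma norm_opPz_mul_wave_le {χ f : Euc d → ℂ} {x : Euc d} (hχ : ContDiffAt ℝ ∞ χ x)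
    (hf : ContDiffAt ℝ ∞ f x) (X : Euc d → Euc d) (z : ℂ) {h : ℝ} (hh : 0 < h) (hh1 : h ≤ 1)
    {A C K : ℝ} (hχ1 : ‖χ x‖ ≤ 1) (hX : ∀ j, |X x j| ≤ A) (h1 : ∀ j, ‖pd j χ x‖ ≤ C)
    (h2 : ∀ j, ‖pd j (pd j χ) x‖ ≤ C) (hfK : ‖f x‖ ≤ K) (hfK' : ∀ j, ‖h * pd j f x‖ ≤ K) :
    ‖opPz X z h (fun x => χ x * f x) x‖ ≤ ‖opPz X z h f x‖ + d * ((3 + A) * C * K) := by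
  rw [opPz_mul hχ hf]
  have hterm : ∀ j ∈ (Finset.univ : Finset (Fin d)),
      ‖-(h : ℂ) * (2 * pd j χ x * (h * pd j f x)) - (h : ℂ) ^ 2 * pd j (pd j χ) x * f x +
        ((X x j : ℝ) : ℂ) * h * pd j χ x * f x‖ ≤ (3 + A) * C * K := by
    intro j _
    have hC : 0 ≤ C := (norm_nonneg _).trans (h1 j)
    have hK : 0 ≤ K := (norm_nonneg _).trans hfK
    have hA : 0 ≤ A := (abs_nonneg _).trans (hX j)
    have hhn : ‖(h : ℂ)‖ ≤ 1 := by rwa [Complex.norm_real, Real.norm_of_nonneg hh.le]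
    have t1 : ‖-(h : ℂ) * (2 * pd j χ x * (h * pd j f x))‖ ≤ 1 * (2 * C * K) := by
      rw [norm_mul, norm_neg, norm_mul, norm_mul, Complex.norm_ofNat]
      gcongr
      · exact h1 j
      · exact hfK' j
    have t2 : ‖(h : ℂ) ^ 2 * pd j (pd j χ) x * f x‖ ≤ 1 * C * K := by
      rw [norm_mul, norm_mul, norm_pow]
      gcongr
      · exact pow_le_one₀ (norm_nonneg _) hhn
      · exact h2 j
    have t3 : ‖((X x j : ℝ) : ℂ) * h * pd j χ x * f x‖ ≤ A * 1 * C * K := by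
      rw [norm_mul, norm_mul, norm_mul, Complex.norm_real]
      gcongr
      · exact hX j
      · exact h1 j
    refine (norm_add_le _ _).trans ((add_le_add ((norm_sub_le _ _).trans (add_le_add t1 t2))
      t3).trans (le_of_eq (by ring)))
  refine (norm_add_le _ _).trans (add_le_add ?_ ((norm_sum_le _ _).trans
    ((Finset.sum_le_sum hterm).trans_eq (by simp))))
  rw [norm_mul]
  exact mul_le_of_le_one_left (norm_nonneg _) hχ1

end SPoly

section

variable {d : ℕ}

lemma exists_bound_closedBall {f : Euc d → ℝ} (hf : Continuous f) (x₀ : Euc d) (b : ℝ) :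
    ∃ C, 0 ≤ C ∧ ∀ x ∈ Metric.closedBall x₀ b, f x ≤ C := by
  obtain ⟨C, hC⟩ := (isCompact_closedBall x₀ b).bddAbove_image hf.continuousOn
  exact ⟨max C 0, le_max_right _ _, fun x hx =>
    (hC (Set.mem_image_of_mem f hx)).trans (le_max_left _ _)⟩

lemma exists_bump_bounds (x₀ : Euc d) {b : ℝ} (hb : 0 < b) :
    ∃ χ : Euc d → ℂ, ContDiff ℝ ∞ χ ∧ (∀ x, ‖χ x‖ ≤ 1) ∧
      (∀ x ∈ Metric.ball x₀ (b / 4), χ =ᶠ[𝓝 x] fun _ => 1) ∧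
      (∀ x ∉ Metric.ball x₀ b, χ =ᶠ[𝓝 x] 0) ∧
      ∃ C, 0 ≤ C ∧ ∀ x ∈ Metric.closedBall x₀ b, ∀ j,
        ‖pd j χ x‖ ≤ C ∧ ‖pd j (pd j χ) x‖ ≤ C := by
  let f : ContDiffBump x₀ := ⟨b / 4, b / 2, by positivity, by linarith⟩
  have hχ : ContDiff ℝ ∞ fun x => ((f x : ℝ) : ℂ) := Complex.ofRealCLM.contDiff.comp f.contDiff
  refine ⟨fun x => ((f x : ℝ) : ℂ), hχ, fun x => ?_, fun x hx => ?_, fun x hx => ?_, ?_⟩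
  · rw [Complex.norm_real, Real.norm_of_nonneg f.nonneg]
    exact f.le_one
  · filter_upwards [Metric.isOpen_ball.mem_nhds hx] with y hy
    rw [f.one_of_mem_closedBall (Metric.ball_subset_closedBall hy), Complex.ofReal_one]
  · have : x ∉ tsupport f := by
      rw [f.tsupport_eq]
      exact fun h => hx (Metric.closedBall_subset_ball (show b / 2 < b by linarith) h)
    filter_upwards [notMem_tsupport_iff_eventuallyEq.1 this] with y hy
    simp [hy]
  · have h1 : ∀ j, ContDiff ℝ ∞ (pd j fun x => ((f x : ℝ) : ℂ)) := fun j =>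
      contDiff_iff_contDiffAt.2 fun x => contDiffAt_pd (n := ∞) (by simp) hχ.contDiffAt j
    have h2 : ∀ j, ContDiff ℝ ∞ (pd j (pd j fun x => ((f x : ℝ) : ℂ))) := fun j =>
      contDiff_iff_contDiffAt.2 fun x => contDiffAt_pd (n := ∞) (by simp) (h1 j).contDiffAt j
    obtain ⟨C, hC, hCb⟩ := exists_bound_closedBall (f := fun x => ∑ j,
      (‖pd j (fun x => ((f x : ℝ) : ℂ)) x‖ + ‖pd j (pd j fun x => ((f x : ℝ) : ℂ)) x‖))
      (continuous_finsetSum _ fun j _ => (h1 j).continuous.norm.add (h2 j).continuous.norm) x₀ b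
    refine ⟨C, hC, fun x hx j => ?_⟩
    have := (Finset.single_le_sum (f := fun j => ‖pd j (fun x => ((f x : ℝ) : ℂ)) x‖ +
      ‖pd j (pd j fun x => ((f x : ℝ) : ℂ)) x‖) (fun j _ => by positivity)
      (Finset.mem_univ j)).trans (hCb x hx)
    have n1 := norm_nonneg (pd j (fun x => ((f x : ℝ) : ℂ)) x)
    have n2 := norm_nonneg (pd j (pd j fun x => ((f x : ℝ) : ℂ)) x)
    constructor <;> linarith

end

namespace SPoly

variable {d : ℕ}

set_option maxHeartbeats 800000 in
/-- Cutting off the local quasimodes gives smooth functions, vanishing on the boundary, with the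
error still small and the mass not too small. -/
theorem exists_cutoff_quasimode {Ω V : Set (Euc d)} {ρ : Euc d → ℝ} {X : Euc d → Euc d}
    {x₀ : Euc d} {κ : Fin d → ℂ} {z g l₁ l₂ : ℂ} {e : ℝ → ℝ}
    (hΩ : IsOpen Ω) (hV : IsOpen V) (hx₀V : x₀ ∈ V) (hx₀ : x₀ ∈ frontier Ω)
    (hρ : IsDefiningFunctionOn ∞ Ω V ρ) (hX : Continuous X)
    (hκ : ∀ j, (κ j).re = 0) (hg : g ≠ 0) (h₁ : l₁.re < 0) (h₂ : l₂.re < 0)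
    (hfr : ∀ B Y E, (OpData.mk κ (fun j => ((pd j ρ x₀ : ℝ) : ℂ))
      (fun j => ((X x₀ j : ℝ) : ℂ)) z B Y E).FrozenEq g l₁ l₂)
    (he : ∀ᶠ h in 𝓝[>] (0 : ℝ), 0 ≤ e h) (happ : ∀ i, HasApprox (coeffFun ρ X i) x₀ e) :
    ∃ K > 0, ∃ δ > 0, ∃ c > 0, ∀ᶠ h in 𝓝[>] (0 : ℝ), ∃ u : Euc d → ℂ, ContDiff ℝ ∞ u ∧
      (∀ x ∈ frontier Ω, u x = 0) ∧
      (∀ x ∈ Ω, ‖opPz X z h u x‖ ≤ K * (e h + Real.exp (-δ / h))) ∧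
      (∀ x ∈ Ω, ‖u x‖ ≤ K * Real.exp (-‖x - x₀‖ ^ 2 / (2 * h))) ∧
      ENNReal.ofReal (c * h ^ d) ≤ eLpNorm u 2 (volume.restrict Ω) := by
  have hρV : ∀ x ∈ V, ContDiffAt ℝ ∞ ρ x := fun x hx => hρ.contDiffOn.contDiffAt (hV.mem_nhds hx)
  have hρ0 : ρ x₀ = 0 := hρ.eq_zero_of_mem_frontier hΩ hV hx₀ hx₀V
  obtain ⟨a, ha, K, hK1, δ, hδ, hev⟩ := exists_local_quasimode
    (Filter.eventually_of_mem (hV.mem_nhds hx₀V) hρV) hX hκ hg h₁ h₂ hfr he happ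
  have hK0 : 0 < K := by linarith
  have hnhds : ∀ᶠ x in 𝓝 x₀, x ∈ V ∧ |ρ x| < 1 := by
    refine Filter.Eventually.and (hV.mem_nhds hx₀V) ?_
    have hc : ContinuousAt (fun x => |ρ x|) x₀ := (hρV x₀ hx₀V).continuousAt.abs
    exact hc.eventually (gt_mem_nhds (by simp [hρ0]))
  obtain ⟨b₀, hb₀, hball⟩ := Metric.eventually_nhds_iff_ball.1 hnhds
  set b := min a b₀ with hb
  have hb0 : 0 < b := lt_min ha hb₀
  have hVb : ∀ x ∈ Metric.ball x₀ b, x ∈ V ∧ |ρ x| < 1 := fun x hx =>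
    hball x (Metric.ball_subset_ball (min_le_right _ _) hx)
  have hab : ∀ x ∈ Metric.ball x₀ b, ‖x - x₀‖ ≤ a := fun x hx =>
    (mem_ball_iff_norm.1 hx).le.trans (min_le_left _ _)
  have hΩt : ∀ x ∈ Metric.ball x₀ b, x ∈ Ω → -ρ x ∈ Set.Icc 0 1 := fun x hx hxΩ => by
    have := (hρ.mem_iff x (hVb x hx).1).1 hxΩ
    have h3 := abs_lt.1 (hVb x hx).2
    constructor <;> linarith
  obtain ⟨χ, hχ, hχ1, hχin, hχout, C, hC, hCb⟩ := exists_bump_bounds x₀ hb0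
  obtain ⟨A, hA, hAb⟩ := exists_bound_closedBall (f := fun x => ‖X x‖) hX.norm x₀ b
  have hXA : ∀ x ∈ Metric.ball x₀ b, ∀ j, |X x j| ≤ A := fun x hx j =>
    (PiLp.norm_apply_le (X x) j).trans (hAb x (Metric.ball_subset_closedBall hx))
  -- The second entry is the Gaussian decay rate at distance `b / 4`, inside which the cutoff is
  -- identically `1`.
  set δ' := min δ ((b / 4) ^ 2 / 2) with hδ'
  have hδ'0 : 0 < δ' := lt_min hδ (by positivity)
  -- For `s = -ρ x / h` between `τ / 2` and `3 * τ / 2` one has `K * s ≤ 1 / 2`, so `s - K * s ^ 2 ≥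
  -- s / 2 ≥ τ / 4`.
  set τ : ℝ := 1 / (3 * K) with hτ
  have hτ0 : 0 < τ := by positivity
  obtain ⟨v, η, hη, hη1, hlow⟩ := exists_ball_near_zero ((hρV x₀ hx₀V).differentiableAt (by simp))
    hρ0 (hρ.fderiv_ne_zero x₀ hx₀V) hτ0
  set R : ℝ := ‖v‖ + 1 with hR
  have hR0 : 0 < R := by positivity
  set c₀ : ℝ := Real.exp (-R ^ 2 / 2) * (τ / 4) with hc₀
  have hc₀0 : 0 < c₀ := by positivity
  set w : ℝ := ((volume (Metric.ball (0 : Euc d) 1)) ^ (1 / 2 : ℝ)).toReal with hw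
  have hw0 : 0 < w := ENNReal.toReal_pos
    (ENNReal.rpow_pos (Metric.measure_ball_pos _ _ one_pos) measure_ball_lt_top.ne).ne'
    (ENNReal.rpow_ne_top_of_nonneg (by norm_num) measure_ball_lt_top.ne)
  refine ⟨K + d * ((3 + A) * C * K), by positivity, δ', hδ'0, c₀ * η ^ d * w, by positivity, ?_⟩
  have hsmall : ∀ᶠ h in 𝓝[>] (0 : ℝ), h < min 1 (b / 4 / R) :=
    (eventually_lt_nhds (by positivity)).filter_mono nhdsWithin_le_nhds
  filter_upwards [hev, hlow, he, hsmall, self_mem_nhdsWithin] with h ⟨p, hp0, hp⟩ hlow he hsm hh0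
  have hh0 : 0 < h := hh0
  have hh1 : h ≤ 1 := (hsm.trans_le (min_le_left _ _)).le
  have hhR : h * R < b / 4 := (lt_div_iff₀ hR0).1 (hsm.trans_le (min_le_right _ _))
  have hwave : ∀ x ∈ Metric.ball x₀ b, ContDiffAt ℝ ∞ (wave h κ x₀ (-ρ) p) x := fun x hx =>
    contDiffAt_wave h κ x₀ (hρV x (hVb x hx).1).neg p
  have hout : ∀ x ∉ Metric.ball x₀ b, (fun x => χ x * wave h κ x₀ (-ρ) p x) =ᶠ[𝓝 x] 0 :=
    fun x hx => by
      filter_upwards [hχout x hx] with y hy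
      simp [hy]
  refine ⟨fun x => χ x * wave h κ x₀ (-ρ) p x, contDiff_iff_contDiffAt.2 fun x => ?_, fun x hx => ?_,
    fun x hx => ?_, fun x hx => ?_, ?_⟩
  · by_cases hxb : x ∈ Metric.ball x₀ b
    · exact hχ.contDiffAt.mul (hwave x hxb)
    · exact contDiffAt_const.congr_of_eventuallyEq (hout x hxb)
  · by_cases hxb : x ∈ Metric.ball x₀ b
    · have := hρ.eq_zero_of_mem_frontier hΩ hV hx (hVb x hxb).1
      simp [wave, this, hp0]
    · exact (hout x hxb).self_of_nhds
  · by_cases hxb : x ∈ Metric.ball x₀ b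
    · obtain ⟨q1, q2, q3, -⟩ := hp x (hab x hxb) (hΩt x hxb hx)
      have hδδ : Real.exp (-δ / h) ≤ Real.exp (-δ' / h) := by
        gcongr
        exact min_le_left _ _
      have hM : 0 ≤ d * ((3 + A) * C * K) := by positivity
      have hE : 0 < Real.exp (-δ' / h) := Real.exp_pos _
      -- In the inner ball the commutator with the cutoff vanishes; outside it the commutator is
      -- multiplied by an exponentially small Gaussian.
      by_cases hxi : x ∈ Metric.ball x₀ (b / 4)
      · have hc1 : ∀ j, pd j χ =ᶠ[𝓝 x] fun _ => 0 := fun j => by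
          filter_upwards [(hχin x hxi).eventuallyEq_nhds] with y hy
          rw [pd_congr hy, pd]
          simp
        have hc2 : ∀ j, pd j (pd j χ) x = 0 := fun j => by
          rw [pd_congr (hc1 j), pd]
          simp
        have hG : Real.exp (-‖x - x₀‖ ^ 2 / (2 * h)) ≤ 1 := by
          rw [Real.exp_le_one_iff]
          exact div_nonpos_of_nonpos_of_nonneg (by simp) (by positivity)
        refine (norm_opPz_mul_wave_le hχ.contDiffAt (hwave x hxb) X z hh0 hh1 (hχ1 x)
          (hXA x hxb) (C := 0) (fun j => by rw [(hc1 j).self_of_nhds, norm_zero])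
          (fun j => by rw [hc2 j, norm_zero]) q2 q3).trans ?_
        have t1 : K * Real.exp (-δ / h) ≤ K * Real.exp (-δ' / h) :=
          mul_le_mul_of_nonneg_left hδδ hK0.le
        have t2 := mul_nonneg hM (add_nonneg he hE.le)
        linarith
      · have hxi' : b / 4 ≤ ‖x - x₀‖ := by
          rw [mem_ball_iff_norm] at hxi
          exact not_lt.1 hxi
        have hG : Real.exp (-‖x - x₀‖ ^ 2 / (2 * h)) ≤ Real.exp (-δ' / h) := by
          rw [Real.exp_le_exp, div_le_div_iff₀ (by positivity) hh0]
          have h5 : δ' ≤ (b / 4) ^ 2 / 2 := min_le_right _ _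
          have h6 : (b / 4) ^ 2 ≤ ‖x - x₀‖ ^ 2 := by gcongr
          nlinarith
        have hcb := hCb x (Metric.ball_subset_closedBall hxb)
        refine (norm_opPz_mul_wave_le hχ.contDiffAt (hwave x hxb) X z hh0 hh1 (hχ1 x)
          (hXA x hxb) (fun j => (hcb j).1) (fun j => (hcb j).2) q2 q3).trans ?_
        have t1 : K * Real.exp (-δ / h) ≤ K * Real.exp (-δ' / h) :=
          mul_le_mul_of_nonneg_left hδδ hK0.le
        have t2 := mul_le_mul_of_nonneg_left hG hM
        have t3 := mul_nonneg hM he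
        linarith
    · rw [opPz_eq_zero (hout x hxb), norm_zero]
      positivity
  · by_cases hxb : x ∈ Metric.ball x₀ b
    · obtain ⟨-, q2, -, -⟩ := hp x (hab x hxb) (hΩt x hxb hx)
      rw [norm_mul]
      refine (mul_le_of_le_one_left (norm_nonneg _) (hχ1 x)).trans (q2.trans ?_)
      refine mul_le_mul_of_nonneg_right ?_ (Real.exp_pos _).le
      exact le_add_of_nonneg_right (by positivity)
    · have := (hout x hxb).self_of_nhds
      simp only [Pi.zero_apply] at this
      show ‖χ x * wave h κ x₀ (-ρ) p x‖ ≤ _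
      rw [this, norm_zero]
      positivity
  · have hnear : ∀ x ∈ Metric.ball (x₀ + h • v) (h * η), ‖x - x₀‖ ≤ h * R := by
      intro x hx
      have : x - x₀ = h • v + (x - (x₀ + h • v)) := by abel
      rw [this]
      refine (norm_add_le _ _).trans ?_
      have h7 := (mem_ball_iff_norm.1 hx).le
      rw [norm_smul, Real.norm_of_nonneg hh0.le, hR]
      nlinarith
    have hin : ∀ x ∈ Metric.ball (x₀ + h • v) (h * η), x ∈ Metric.ball x₀ (b / 4) := fun x hx =>
      mem_ball_iff_norm.2 ((hnear x hx).trans_lt hhR)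
    have hinb : ∀ x ∈ Metric.ball (x₀ + h • v) (h * η), x ∈ Metric.ball x₀ b := fun x hx =>
      Metric.ball_subset_ball (by linarith) (hin x hx)
    have hsub : Metric.ball (x₀ + h • v) (h * η) ⊆ Ω := fun x hx => by
      refine (hρ.mem_iff x (hVb x (hinb x hx)).1).2 ?_
      have := (hlow x hx).1
      rw [le_div_iff₀ hh0] at this
      nlinarith [mul_pos hτ0 hh0]
    have hge := eLpNorm_ge_of_ball (Ω := Ω) (f := fun x => χ x * wave h κ x₀ (-ρ) p x)
      (mul_pos hh0 hη) (mul_le_one₀ hh1 hη.le hη1) hc₀0.le hsub fun x hx => ?_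
    · refine le_trans (le_of_eq ?_) hge
      rw [mul_pow]
      congr 1
      ring
    · have hxΩ := hsub hx
      obtain ⟨-, -, -, q4⟩ := hp x (hab x (hinb x hx)) (hΩt x (hinb x hx) hxΩ)
      simp only [norm_mul]
      rw [(hχin x (hin x hx)).self_of_nhds, norm_one, one_mul]
      refine le_trans ?_ q4
      obtain ⟨s1, s2⟩ := hlow x hx
      set s := -ρ x / h with hs
      have e1 : K * ρ x ^ 2 / h ^ 2 = K * s ^ 2 := by rw [hs, div_pow, neg_sq]; ring
      rw [e1, hc₀]
      have hKτ : K * τ = 1 / 3 := by rw [hτ]; field_simp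
      have hKs : K * s ≤ 1 / 2 := by
        have := mul_le_mul_of_nonneg_left s2 hK0.le
        linarith
      refine mul_le_mul ?_ ?_ (by positivity) (Real.exp_pos _).le
      -- On this small ball `‖x - x₀‖ ≤ h * R`, so the exponent `‖x - x₀‖ ^ 2 / (2 * h)` stays below
      -- `R ^ 2 / 2`.
      · rw [Real.exp_le_exp, neg_div, neg_div, neg_le_neg_iff, div_le_div_iff₀ (by positivity) two_pos]
        have h8 := hnear x hx
        have h9 : ‖x - x₀‖ ^ 2 ≤ (h * R) ^ 2 := by gcongr
        have h10 : (h * R) ^ 2 ≤ h * R ^ 2 := by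
          rw [mul_pow]
          refine mul_le_mul_of_nonneg_right ?_ (sq_nonneg _)
          nlinarith
        linarith
      · have hs0 : 0 < s := by linarith
        have h11 := mul_le_mul_of_nonneg_right hKs hs0.le
        have h12 : K * s ^ 2 = K * s * s := by ring
        linarith

end SPoly

/-! ### Diagonal choice and essential support -/

section

variable {d : ℕ}

lemma eventually_exp_neg_div_le_pow {δ : ℝ} (hδ : 0 < δ) (C : ℝ) (k : ℕ) :
    ∀ᶠ h in 𝓝[>] (0 : ℝ), C * Real.exp (-δ / h) ≤ h ^ k := by
  have h1 : Tendsto (fun h : ℝ => δ * h⁻¹) (𝓝[>] 0) atTop :=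
    tendsto_inv_nhdsGT_zero.const_mul_atTop hδ
  have h2 := ((Real.tendsto_pow_mul_exp_neg_atTop_nhds_zero k).comp h1).const_mul (C * (δ ^ k)⁻¹)
  rw [mul_zero] at h2
  filter_upwards [h2.eventually (gt_mem_nhds one_pos), self_mem_nhdsWithin] with h hh hh0
  have hh0 : 0 < h := hh0
  simp only [Function.comp_apply] at hh
  have e1 : C * (δ ^ k)⁻¹ * ((δ * h⁻¹) ^ k * Real.exp (-(δ * h⁻¹))) =
      C * Real.exp (-δ / h) * (h ^ k)⁻¹ := by
    rw [mul_pow, inv_pow, show -(δ * h⁻¹) = -δ / h by rw [neg_div, div_eq_mul_inv]]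
    field_simp
  rw [e1, ← div_eq_mul_inv, div_lt_one (by positivity)] at hh
  exact hh.le

/-- At each `h`, pick a witness for the largest attainable order not exceeding `h⁻¹`. The cap makes
the maximum exist, and it tends to infinity as `h → 0⁺`, so every fixed order is eventually passed.
-/
lemma exists_diagonal {α : Type*} [Nonempty α] {Q : ℕ → ℝ → α → Prop}
    (hanti : ∀ᶠ h in 𝓝[>] (0 : ℝ), ∀ M N v, M ≤ N → Q N h v → Q M h v)
    (hQ : ∀ N, ∀ᶠ h in 𝓝[>] (0 : ℝ), ∃ v, Q N h v) :
    ∃ u : ℝ → α, ∀ N, ∀ᶠ h in 𝓝[>] (0 : ℝ), Q N h (u h) := by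
  classical
  let n : ℝ → ℕ := fun h => Nat.findGreatest (fun N => ∃ v, Q N h v) ⌊h⁻¹⌋₊
  refine ⟨fun h => Classical.epsilon (Q (n h) h), fun N => ?_⟩
  have hN : ∀ᶠ h in 𝓝[>] (0 : ℝ), (N : ℝ) ≤ h⁻¹ :=
    tendsto_inv_nhdsGT_zero.eventually (eventually_ge_atTop (N : ℝ))
  filter_upwards [hanti, hQ N, hN] with h ha hv hN
  have hle : N ≤ ⌊h⁻¹⌋₊ := Nat.le_floor hN
  exact ha N (n h) _ (Nat.le_findGreatest hle hv)
    (Classical.epsilon_spec (Nat.findGreatest_spec (P := fun N => ∃ v, Q N h v) hle hv))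

lemma eLpNorm_le_of_bound {Ω : Set (Euc d)} (hΩ : MeasurableSet Ω) {f : Euc d → ℂ} {c : ℝ}
    (hvol : volume Ω ≠ ⊤) (hf : ∀ x ∈ Ω, ‖f x‖ ≤ c) :
    eLpNorm f 2 (volume.restrict Ω) ≤
      ENNReal.ofReal (((volume Ω) ^ (1 / 2 : ℝ)).toReal * c) := by
  have h1 := eLpNorm_le_of_ae_bound (p := 2) (μ := volume.restrict Ω) (f := f) (C := c)
    ((ae_restrict_iff' hΩ).2 (ae_of_all _ hf))
  rw [ENNReal.ofReal_mul ENNReal.toReal_nonneg, ENNReal.ofReal_toReal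
    (ENNReal.rpow_ne_top_of_nonneg (by norm_num) hvol)]
  simpa using h1

/-- Where `1 - χ` can be nonzero, `‖x - x₀‖ > ε`, and the Gaussian beats both the loss `h ^ k` and
any prescribed power of `h`. -/
lemma isBigOL2HInfty_of_gaussian {Ω : Set (Euc d)} (hΩ : IsOpen Ω) (hb : Bornology.IsBounded Ω)
    {u : ℝ → Euc d → ℂ} {x₀ : Euc d} {k : ℕ}
    (hu : ∀ᶠ h in 𝓝[>] (0 : ℝ), ∀ x ∈ Ω,
      ‖u h x‖ ≤ (h ^ k)⁻¹ * Real.exp (-‖x - x₀‖ ^ 2 / (2 * h)))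
    {χ : Euc d → ℂ} (hχ : SmoothOnClosure Ω χ) {ε : ℝ} (hε : 0 < ε)
    (hχ1 : ∀ x ∈ Metric.closedBall x₀ ε ∩ closure Ω, χ x = 1) :
    IsBigOL2HInfty Ω (fun h x => (1 - χ x) * u h x) := by
  obtain ⟨g, hg, hgχ⟩ := hχ
  have hcomp : IsCompact (closure Ω) := hb.isCompact_closure
  obtain ⟨M, hM⟩ := hcomp.bddAbove_image (f := fun x => ‖1 - g x‖)
    (continuous_const.sub hg.continuous).norm.continuousOn
  have hM' : ∀ x ∈ Ω, ‖1 - χ x‖ ≤ max M 0 := fun x hx => by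
    rw [hgχ (subset_closure hx)]
    exact (hM (Set.mem_image_of_mem (fun x => ‖1 - g x‖) (subset_closure hx))).trans
      (le_max_left _ _)
  have hvol : volume Ω ≠ ⊤ := hb.measure_lt_top.ne
  intro N
  refine ⟨((volume Ω) ^ (1 / 2 : ℝ)).toReal * max M 0, ?_⟩
  filter_upwards [hu, eventually_exp_neg_div_le_pow (show 0 < ε ^ 2 / 2 by positivity) 1 (N + k),
    self_mem_nhdsWithin] with h hu hexp hh0
  have hh0 : 0 < h := hh0
  have hmain := eLpNorm_le_of_bound hΩ.measurableSet hvol (f := fun x => (1 - χ x) * u h x)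
    (c := max M 0 * h ^ N) fun x hx => ?_
  · rwa [← mul_assoc] at hmain
  · by_cases hxε : x ∈ Metric.closedBall x₀ ε
    · rw [hχ1 x ⟨hxε, subset_closure hx⟩, sub_self, zero_mul, norm_zero]
      positivity
    · rw [mem_closedBall_iff_norm, not_le] at hxε
      rw [norm_mul]
      refine mul_le_mul (hM' x hx) ((hu x hx).trans ?_) (norm_nonneg _) (le_max_right _ _)
      have h1 : Real.exp (-‖x - x₀‖ ^ 2 / (2 * h)) ≤ h ^ (N + k) := by
        refine le_trans ?_ hexp
        rw [one_mul, Real.exp_le_exp, neg_div, neg_div, neg_le_neg_iff, div_div]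
        gcongr
      calc (h ^ k)⁻¹ * Real.exp (-‖x - x₀‖ ^ 2 / (2 * h)) ≤ (h ^ k)⁻¹ * h ^ (N + k) := by gcongr
        _ = h ^ N := by rw [pow_add]; field_simp

/-- Small closed balls about `x₀`, intersected with the closure of the domain, are admissible, which
leaves at most `x₀`. Conversely, an admissible set missing `x₀` would make the mass near `x₀`
negligible; the mass away from `x₀` is negligible too, contradicting norm `1`. -/
theorem essentialSupport_eq_singleton {Ω : Set (Euc d)} (hΩ : IsOpen Ω)
    (hb : Bornology.IsBounded Ω) {u : ℝ → Euc d → ℂ} {x₀ : Euc d} {k : ℕ}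
    (hsm : ∀ᶠ h in 𝓝[>] (0 : ℝ), Continuous (u h))
    (hn : ∀ᶠ h in 𝓝[>] (0 : ℝ), eLpNorm (u h) 2 (volume.restrict Ω) = 1)
    (hu : ∀ᶠ h in 𝓝[>] (0 : ℝ), ∀ x ∈ Ω,
      ‖u h x‖ ≤ (h ^ k)⁻¹ * Real.exp (-‖x - x₀‖ ^ 2 / (2 * h))) :
    essentialSupport Ω u = {x₀} := by
  refine Set.Subset.antisymm (fun x hx => ?_) (Set.singleton_subset_iff.2 ?_)
  · by_contra hne
    have hpos : 0 < dist x x₀ := dist_pos.2 hne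
    have := hx (Metric.closedBall x₀ (dist x x₀ / 2) ∩ closure Ω)
      ⟨Metric.isClosed_closedBall.inter isClosed_closure, Set.inter_subset_right,
        fun χ hχ hχ1 => isBigOL2HInfty_of_gaussian hΩ hb hu hχ (half_pos hpos) hχ1⟩
    have h1 := Metric.mem_closedBall.1 this.1
    linarith
  · rintro U ⟨hUc, -, hU⟩
    by_contra hx₀U
    obtain ⟨r, hr, hball⟩ := Metric.isOpen_iff.1 hUc.isOpen_compl x₀ hx₀U
    obtain ⟨χ, hχ, -, hχin, hχout, -⟩ := exists_bump_bounds x₀ hr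
    -- The test function `1 - χ` equals `1` on `U`, so admissibility bounds `χ * u`; the Gaussian
    -- estimate then bounds `(1 - χ) * u`. First order in `h` suffices.
    obtain ⟨C₁, hC₁⟩ := hU (fun x => 1 - χ x) ⟨_, contDiff_const.sub hχ, fun _ _ => rfl⟩
      (fun x hx => by
        have : x ∉ Metric.ball x₀ r := fun h => hball h hx
        have := (hχout x this).self_of_nhds
        simp only [Pi.zero_apply] at this
        simp [this]) 1
    obtain ⟨C₂, hC₂⟩ := isBigOL2HInfty_of_gaussian hΩ hb hu ⟨χ, hχ, fun _ _ => rfl⟩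
      (show 0 < r / 8 by positivity) (fun x hx => (hχin x
        (Metric.closedBall_subset_ball (by linarith) hx.1)).self_of_nhds) 1
    have hlim : Tendsto (fun h : ℝ => ENNReal.ofReal (C₁ * h ^ 1) + ENNReal.ofReal (C₂ * h ^ 1))
        (𝓝[>] 0) (𝓝 0) := by
      have : Continuous fun h : ℝ => ENNReal.ofReal (C₁ * h ^ 1) + ENNReal.ofReal (C₂ * h ^ 1) := by
        refine (ENNReal.continuous_ofReal.comp (by fun_prop)).add
          (ENNReal.continuous_ofReal.comp (by fun_prop))
      have h0 := this.tendsto 0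
      simp only [pow_one, mul_zero, ENNReal.ofReal_zero, add_zero] at h0 ⊢
      exact h0.mono_left nhdsWithin_le_nhds
    obtain ⟨h, ⟨⟨⟨h1, h2⟩, h3⟩, h4⟩, h5⟩ := ((((hC₁.and hC₂).and hn).and hsm).and
      (hlim.eventually (gt_mem_nhds one_pos))).exists
    have hsplit : u h = (fun x => (1 - (1 - χ x)) * u h x) + fun x => (1 - χ x) * u h x := by
      funext x
      simp only [Pi.add_apply]
      ring
    have hle := eLpNorm_add_le (p := 2) (μ := volume.restrict Ω)
      (f := fun x => (1 - (1 - χ x)) * u h x) (g := fun x => (1 - χ x) * u h x)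
      ((continuous_const.sub (continuous_const.sub hχ.continuous)).mul h4).aestronglyMeasurable
      ((continuous_const.sub hχ.continuous).mul h4).aestronglyMeasurable (by norm_num)
    rw [← hsplit, h3] at hle
    exact absurd (hle.trans (add_le_add h1 h2)) (not_le.2 h5)

end

/-! ### The outward normal and the roots of the frozen symbol -/

section

variable {d : ℕ}

lemma pd_eq_gradient {ρ : Euc d → ℝ} {x : Euc d} (hρ : DifferentiableAt ℝ ρ x) (j : Fin d) :
    pd j ρ x = gradient ρ x j := by
  have h := hρ.hasGradientAt.hasFDerivAt.fderiv
  rw [pd, h, InnerProductSpace.toDual_apply_apply, EuclideanSpace.inner_single_right]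
  simp

lemma gradient_ne_zero {ρ : Euc d → ℝ} {x : Euc d} (h : fderiv ℝ ρ x ≠ 0) : gradient ρ x ≠ 0 := by
  rw [gradient]
  simpa using h

/-- Moving from `x` in a direction that strictly decreases `ρ₁` enters `Ω`, where `ρ₂` is negative;
hence the one-sided derivative of `ρ₂` is not positive. -/
lemma IsDefiningFunctionOn.inner_gradient_nonpos {n : WithTop ℕ∞} {Ω V₁ V₂ : Set (Euc d)}
    {ρ₁ ρ₂ : Euc d → ℝ} {x : Euc d} (hΩ : IsOpen Ω) (hx : x ∈ frontier Ω)
    (hV₁ : IsOpen V₁) (hV₂ : IsOpen V₂) (hx₁ : x ∈ V₁) (hx₂ : x ∈ V₂)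
    (h₁ : IsDefiningFunctionOn n Ω V₁ ρ₁) (h₂ : IsDefiningFunctionOn n Ω V₂ ρ₂) (hn : n ≠ 0)
    {v : Euc d} (hv : ⟪gradient ρ₁ x, v⟫ < 0) : ⟪gradient ρ₂ x, v⟫ ≤ 0 := by
  have hline : HasDerivAt (fun t : ℝ => x + t • v) v 0 := by
    simpa using ((hasDerivAt_id (0 : ℝ)).smul_const v).const_add x
  have key : ∀ {ρ : Euc d → ℝ} {V : Set (Euc d)}, IsOpen V → x ∈ V → IsDefiningFunctionOn n Ω V ρ →
      Tendsto (fun t : ℝ => t⁻¹ * ρ (x + t • v)) (𝓝[>] 0) (𝓝 ⟪gradient ρ x, v⟫) := by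
    intro ρ V hV hxV h
    have hd : DifferentiableAt ℝ ρ (x + (0 : ℝ) • v) := by
      rw [zero_smul, add_zero]
      exact (h.contDiffOn.contDiffAt (hV.mem_nhds hxV)).differentiableAt hn
    have hc := (hd.hasFDerivAt.comp_hasDerivAt (0 : ℝ) hline).tendsto_slope_zero_right
    have h0 := h.eq_zero_of_mem_frontier hΩ hV hx hxV
    rw [zero_smul, add_zero] at hd hc
    rw [hd.hasGradientAt.hasFDerivAt.fderiv, InnerProductSpace.toDual_apply_apply] at hc
    simpa [h0] using hc
  have hV : ∀ᶠ t in 𝓝[>] (0 : ℝ), x + t • v ∈ V₁ ∧ x + t • v ∈ V₂ := by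
    have hc := hline.continuousAt
    refine Eventually.filter_mono nhdsWithin_le_nhds ((hc.eventually ?_).and (hc.eventually ?_))
    · simpa using hV₁.mem_nhds hx₁
    · simpa using hV₂.mem_nhds hx₂
  refine le_of_tendsto (key hV₂ hx₂ h₂) ?_
  filter_upwards [(key hV₁ hx₁ h₁).eventually (gt_mem_nhds hv), hV, self_mem_nhdsWithin]
    with t ht htV ht0
  have ht0 : 0 < t := ht0
  have hρ₁ : ρ₁ (x + t • v) < 0 := by
    by_contra! hc
    exact absurd ht (not_lt.2 (by positivity))
  have hρ₂ := (h₂.mem_iff _ htV.2).1 ((h₁.mem_iff _ htV.1).2 hρ₁)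
  exact mul_nonpos_of_nonneg_of_nonpos (by positivity) hρ₂.le

lemma eq_of_inner_nonpos {E : Type*} [NormedAddCommGroup E] [InnerProductSpace ℝ E] {n₁ n₂ : E}
    (h₁ : ‖n₁‖ = 1) (h₂ : ‖n₂‖ = 1) (h : ∀ v : E, ⟪n₁, v⟫ < 0 → ⟪n₂, v⟫ ≤ 0) : n₁ = n₂ := by
  rw [← inner_eq_one_iff_of_norm_eq_one (𝕜 := ℝ) h₁ h₂]
  set c : ℝ := ⟪n₁, n₂⟫ with hc
  have e1 : ⟪n₁, n₁⟫ = 1 := by rw [real_inner_self_eq_norm_sq, h₁, one_pow]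
  have e2 : ⟪n₂, n₂⟫ = 1 := by rw [real_inner_self_eq_norm_sq, h₂, one_pow]
  have e3 : ⟪n₂, n₁⟫ = c := real_inner_comm _ _
  have hc0 : 0 ≤ c := by
    have := h (-n₁) (by rw [inner_neg_right, e1]; norm_num)
    rw [inner_neg_right, e3] at this
    linarith
  have hc1 : c ≤ 1 := by
    have := real_inner_le_norm n₁ n₂
    rwa [h₁, h₂, one_mul] at this
  by_contra hne
  have hlt : 0 < 1 - c := by
    rcases hc1.lt_or_eq with h | h
    · linarith
    · exact absurd h hne
  -- The component of `n₂` orthogonal to `n₁`, tilted slightly towards `-n₁`: its product with `n₁`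
  -- is `-(1 - c) / 2`, while its product with `n₂` is `(1 - c) * (1 + c / 2) > 0`.
  have := h (n₂ - c • n₁ - ((1 - c) / 2) • n₁) (by
    rw [inner_sub_right, inner_sub_right, inner_smul_right, inner_smul_right, e1, ← hc]
    linarith)
  rw [inner_sub_right, inner_sub_right, inner_smul_right, inner_smul_right, e2, e3] at this
  nlinarith

/-- The normal is independent of the defining function, since two such functions have the same
inward directions. This permits using an analytic defining function although `ν` comes from a smooth
one. -/
lemma IsOutwardUnitNormal.gradient_eq {Ω V : Set (Euc d)} {ρ : Euc d → ℝ} {x ν : Euc d}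
    (hν : IsOutwardUnitNormal Ω x ν) (hΩ : IsOpen Ω) (hV : IsOpen V) (hxV : x ∈ V)
    (hρ : IsDefiningFunctionOn ∞ Ω V ρ) :
    ‖ν‖ = 1 ∧ gradient ρ x = ‖gradient ρ x‖ • ν ∧ 0 < ‖gradient ρ x‖ := by
  obtain ⟨hx, V', ρ', hV', hxV', hρ', rfl⟩ := hν
  have g1 := gradient_ne_zero (hρ.fderiv_ne_zero x hxV)
  have g2 := gradient_ne_zero (hρ'.fderiv_ne_zero x hxV')
  have n1 : ‖‖gradient ρ x‖⁻¹ • gradient ρ x‖ = 1 := norm_smul_inv_norm g1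
  have n2 : ‖‖gradient ρ' x‖⁻¹ • gradient ρ' x‖ = 1 := norm_smul_inv_norm g2
  refine ⟨n2, ?_, norm_pos_iff.2 g1⟩
  rw [← eq_of_inner_nonpos n1 n2 fun v hv => ?_, smul_inv_smul₀ (norm_ne_zero_iff.2 g1)]
  rw [real_inner_smul_left] at hv ⊢
  have hv' : ⟪gradient ρ x, v⟫ < 0 := by
    by_contra! hc
    exact absurd hv (not_lt.2 (by positivity))
  exact mul_nonpos_of_nonneg_of_nonpos (by positivity)
    (hρ.inner_gradient_nonpos hΩ hx hV hV' hxV hxV' hρ' (by simp) hv')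

/-- Both roots of `m² + q m + c` lie in the left half plane if `(Im c)² < q² Re c`. -/
lemma exists_roots_re_neg {q : ℝ} (hq : 0 < q) {c : ℂ} (hc : c.im ^ 2 < q ^ 2 * c.re) :
    ∃ m₁ m₂ : ℂ, m₁ + m₂ = -q ∧ m₁ * m₂ = c ∧ m₁.re < 0 ∧ m₂.re < 0 := by
  obtain ⟨s, hs⟩ := IsAlgClosed.exists_pow_nat_eq ((q : ℂ) ^ 2 - 4 * c) two_pos
  have hre := congrArg Complex.re hs
  have him := congrArg Complex.im hs
  simp [pow_two] at hre him
  -- With `s ^ 2 = q ^ 2 - 4 * c`, the hypothesis on `c` reads `(s.re ^ 2 - q ^ 2) * (s.im ^ 2 + q ^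
  -- 2) < 0`.
  have hlt : s.re ^ 2 < q ^ 2 := by
    by_contra! hle
    have e1 : c.im = -(s.re * s.im) / 2 := by linarith
    have e2 : c.re = (q ^ 2 - s.re ^ 2 + s.im ^ 2) / 4 := by linarith
    rw [e1, e2] at hc
    nlinarith [mul_nonneg (sub_nonneg.2 hle) (add_nonneg (sq_nonneg q) (sq_nonneg s.im))]
  have habs := abs_lt_of_sq_lt_sq' hlt hq.le
  refine ⟨(-q + s) / 2, (-q - s) / 2, by ring, ?_, ?_, ?_⟩
  · linear_combination (-1 / 4 : ℂ) * hs
  · simp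
    linarith [habs.2]
  · simp
    linarith [habs.1]

/-- The tangential frequency is a multiple of the tangential part of `X₀`, scaled so that `q² Re c -
(Im c)²` becomes `q² (Re z - (Im z)² / |X₀|²)`. Tangency removes the cross term with `κ` from the
sum of the roots, and dividing by `γ` accounts for `∇ρ = γ ν`. If `X₀` is parallel to `ν`, as always
for `d = 1`, the frequency is zero. -/
lemma exists_frozenEq {X₀ ν : Euc d} {γ : ℝ} (hγ : 0 < γ) (hν : ‖ν‖ = 1) (hq : 0 < ⟪X₀, ν⟫) {z : ℂ}
    (hz : (‖X₀‖ ^ 2)⁻¹ * z.im ^ 2 < z.re) :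
    ∃ (κ : Fin d → ℂ) (g l₁ l₂ : ℂ), (∀ j, (κ j).re = 0) ∧ g ≠ 0 ∧ l₁.re < 0 ∧ l₂.re < 0 ∧
      ∀ B Y E, (SPoly.OpData.mk κ (fun j => ((γ * ν j : ℝ) : ℂ)) (fun j => ((X₀ j : ℝ) : ℂ))
        z B Y E).FrozenEq g l₁ l₂ := by
  set q : ℝ := ⟪X₀, ν⟫ with hqd
  have hX : X₀ ≠ 0 := by
    rintro rfl
    simp [hqd] at hq
  set S : ℝ := ‖X₀‖ ^ 2 with hS
  have hS0 : 0 < S := by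
    have := norm_pos_iff.2 hX
    positivity
  set ξ : Euc d := (z.im / S) • (X₀ - q • ν) with hξ
  have eνν : ⟪ν, ν⟫ = 1 := by rw [real_inner_self_eq_norm_sq, hν, one_pow]
  have eXX : ⟪X₀, X₀⟫ = S := real_inner_self_eq_norm_sq _
  have eνX : ⟪ν, X₀⟫ = q := real_inner_comm _ _
  have eνξ : ⟪ν, ξ⟫ = 0 := by
    rw [hξ, inner_smul_right, inner_sub_right, inner_smul_right, eνX, eνν]; ring
  have eXξ : ⟪X₀, ξ⟫ = z.im / S * (S - q ^ 2) := by
    rw [hξ, inner_smul_right, inner_sub_right, inner_smul_right, eXX, ← hqd]; ring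
  have eξξ : ⟪ξ, ξ⟫ = (z.im / S) ^ 2 * (S - q ^ 2) := by
    nth_rewrite 1 [hξ]
    rw [real_inner_smul_left, inner_sub_left, real_inner_smul_left, eXξ, eνξ]; ring
  set c : ℂ := z - ((⟪ξ, ξ⟫ : ℝ) : ℂ) - Complex.I * ((⟪X₀, ξ⟫ : ℝ) : ℂ) with hc
  have hcre : c.re = z.re - (z.im / S) ^ 2 * (S - q ^ 2) := by
    rw [hc, eξξ]
    simp only [Complex.sub_re, Complex.ofReal_re, Complex.mul_re, Complex.I_re, Complex.I_im,
      Complex.ofReal_im]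
    ring
  have hcim : c.im = z.im * q ^ 2 / S := by
    rw [hc, eXξ]
    simp only [Complex.sub_im, Complex.ofReal_im, Complex.mul_im, Complex.I_re, Complex.I_im,
      Complex.ofReal_re]
    field_simp
    ring
  obtain ⟨m₁, m₂, hadd, hmul, hm₁, hm₂⟩ := exists_roots_re_neg hq (c := c) (by
    rw [hcre, hcim]
    have e : q ^ 2 * (z.re - (z.im / S) ^ 2 * (S - q ^ 2)) - (z.im * q ^ 2 / S) ^ 2 =
        q ^ 2 * (z.re - S⁻¹ * z.im ^ 2) := by
      field_simp
      ring
    have : 0 < q ^ 2 * (z.re - S⁻¹ * z.im ^ 2) := mul_pos (by positivity) (sub_pos.2 hz)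
    linarith)
  have hγ' : (γ : ℂ) ≠ 0 := by exact_mod_cast hγ.ne'
  have hsum : ∀ a b : Euc d, ∑ j, ((a j : ℝ) : ℂ) * ((b j : ℝ) : ℂ) = ((⟪a, b⟫ : ℝ) : ℂ) := by
    intro a b
    rw [PiLp.inner_apply]
    push_cast
    exact Finset.sum_congr rfl fun j _ => by simp [mul_comm]
  refine ⟨fun j => Complex.I * ((ξ j : ℝ) : ℂ), (γ : ℂ) ^ 2, m₁ / γ, m₂ / γ, fun j => by simp,
    pow_ne_zero 2 hγ', ?_, ?_, fun B Y E => ⟨?_, ?_, ?_⟩⟩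
  · rw [Complex.div_ofReal_re]
    exact div_neg_of_neg_of_pos hm₁ hγ
  · rw [Complex.div_ofReal_re]
    exact div_neg_of_neg_of_pos hm₂ hγ
  · have := hsum ν ν
    rw [eνν] at this
    calc _ = (γ : ℂ) ^ 2 * ∑ j, ((ν j : ℝ) : ℂ) * ((ν j : ℝ) : ℂ) := by
          rw [Finset.mul_sum]
          exact Finset.sum_congr rfl fun j _ => by push_cast; ring
      _ = _ := by rw [this]; simp
  · calc _ = 2 * γ * Complex.I * ∑ j, ((ν j : ℝ) : ℂ) * ((ξ j : ℝ) : ℂ) -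
          γ * ∑ j, ((X₀ j : ℝ) : ℂ) * ((ν j : ℝ) : ℂ) := by
          rw [Finset.mul_sum, Finset.mul_sum, ← Finset.sum_sub_distrib]
          exact Finset.sum_congr rfl fun j _ => by push_cast; ring
      _ = _ := by
        rw [hsum, hsum, eνξ, ← hqd, ← add_div, hadd]
        field_simp
        simp
  · calc _ = -∑ j, ((ξ j : ℝ) : ℂ) * ((ξ j : ℝ) : ℂ) -
          Complex.I * (∑ j, ((X₀ j : ℝ) : ℂ) * ((ξ j : ℝ) : ℂ)) + z := by
          rw [Finset.mul_sum, ← Finset.sum_neg_distrib, ← Finset.sum_sub_distrib]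
          congr 1
          refine Finset.sum_congr rfl fun j _ => ?_
          linear_combination ((ξ j : ℝ) : ℂ) ^ 2 * Complex.I_sq
      _ = c := by rw [hsum, hsum, hc]; ring
      _ = _ := by rw [← hmul]; field_simp

end

/-- `v` is smooth, normalized, vanishes on `∂Ω` and is concentrated in a Gaussian way at `x₀`. -/
structure IsConcentrated {d : ℕ} (Ω : Set (Euc d)) (x₀ : Euc d) (h : ℝ) (v : Euc d → ℂ) : Prop where
  contDiff : ContDiff ℝ ∞ v
  dirichlet : ∀ x ∈ frontier Ω, v x = 0
  normalized : eLpNorm v 2 (volume.restrict Ω) = 1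
  decay : ∀ x ∈ Ω, ‖v x‖ ≤ (h ^ (d + 1))⁻¹ * Real.exp (-‖x - x₀‖ ^ 2 / (2 * h))

/-! ### Normalization and assembly -/

section

variable {d : ℕ}

/-- Dividing by the norm costs at most a constant times `h ^ (-d)`; one more factor `h⁻¹` absorbs
all constants, giving `(h ^ (d + 1))⁻¹`. -/
lemma exists_isConcentrated {Ω : Set (Euc d)} (hΩ : IsOpen Ω) (hb : Bornology.IsBounded Ω)
    {X : Euc d → Euc d} {x₀ : Euc d} {z : ℂ} {e : ℝ → ℝ} {K δ c : ℝ} (hK : 0 < K) (hc : 0 < c)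
    (he : ∀ᶠ h in 𝓝[>] (0 : ℝ), 0 ≤ e h)
    (hu : ∀ᶠ h in 𝓝[>] (0 : ℝ), ∃ u : Euc d → ℂ, ContDiff ℝ ∞ u ∧
      (∀ x ∈ frontier Ω, u x = 0) ∧
      (∀ x ∈ Ω, ‖opPz X z h u x‖ ≤ K * (e h + Real.exp (-δ / h))) ∧
      (∀ x ∈ Ω, ‖u x‖ ≤ K * Real.exp (-‖x - x₀‖ ^ 2 / (2 * h))) ∧
      ENNReal.ofReal (c * h ^ d) ≤ eLpNorm u 2 (volume.restrict Ω)) :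
    ∀ᶠ h in 𝓝[>] (0 : ℝ), ∃ v : Euc d → ℂ, IsConcentrated Ω x₀ h v ∧
      eLpNorm (opPz X z h v) 2 (volume.restrict Ω) ≤
        ENNReal.ofReal ((h ^ (d + 1))⁻¹ * (e h + Real.exp (-δ / h))) := by
  have hvol : volume Ω ≠ ⊤ := hb.measure_lt_top.ne
  set W : ℝ := ((volume Ω) ^ (1 / 2 : ℝ)).toReal with hW
  have hW0 : 0 ≤ W := ENNReal.toReal_nonneg
  have hsmall : ∀ᶠ h in 𝓝[>] (0 : ℝ), h < c / (K * (W + 1)) :=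
    (eventually_lt_nhds (by positivity)).filter_mono nhdsWithin_le_nhds
  filter_upwards [hu, hsmall, he, self_mem_nhdsWithin] with h ⟨u, hu1, hu2, hu3, hu4, hu5⟩ hsm he hh0
  have hh0 : 0 < h := hh0
  have hfin : eLpNorm u 2 (volume.restrict Ω) ≠ ⊤ := by
    refine ((eLpNorm_le_of_bound (c := K) hΩ.measurableSet hvol fun x hx => (hu4 x hx).trans
      ?_).trans_lt ENNReal.ofReal_lt_top).ne
    refine mul_le_of_le_one_right hK.le (Real.exp_le_one_iff.2 ?_)
    exact div_nonpos_of_nonpos_of_nonneg (by simp) (by positivity)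
  set m : ℝ := (eLpNorm u 2 (volume.restrict Ω)).toReal with hm
  have hm1 : c * h ^ d ≤ m := (ENNReal.ofReal_le_iff_le_toReal hfin).1 hu5
  have hm0 : 0 < m := lt_of_lt_of_le (by positivity) hm1
  have hmK : m⁻¹ * (K * (W + 1)) ≤ (h ^ (d + 1))⁻¹ := by
    rw [inv_mul_le_iff₀ hm0]
    have h1 : h * (K * (W + 1)) ≤ c := ((lt_div_iff₀ (by positivity)).1 hsm).le
    calc K * (W + 1) = h * (K * (W + 1)) * h ^ d * (h ^ (d + 1))⁻¹ := by
          rw [pow_succ]; field_simp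
      _ ≤ c * h ^ d * (h ^ (d + 1))⁻¹ := by gcongr
      _ ≤ m * (h ^ (d + 1))⁻¹ := by gcongr
  have hmn : ‖((m⁻¹ : ℝ) : ℂ)‖ = m⁻¹ := by
    rw [Complex.norm_real, Real.norm_of_nonneg (by positivity)]
  have hKW : K ≤ K * (W + 1) := le_mul_of_one_le_right hK.le (by linarith)
  refine ⟨fun x => ((m⁻¹ : ℝ) : ℂ) * u x, ⟨contDiff_const.mul hu1, fun x hx => by
    simp [hu2 x hx], ?_, fun x hx => ?_⟩, ?_⟩
  · have := eLpNorm_const_smul ((m⁻¹ : ℝ) : ℂ) u 2 (volume.restrict Ω)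
    rw [show (fun x => ((m⁻¹ : ℝ) : ℂ) * u x) = ((m⁻¹ : ℝ) : ℂ) • u from rfl, this,
      ← ofReal_norm, hmn, ← ENNReal.ofReal_toReal hfin, ← hm,
      ← ENNReal.ofReal_mul (by positivity), inv_mul_cancel₀ hm0.ne', ENNReal.ofReal_one]
  · rw [norm_mul, hmn]
    calc m⁻¹ * ‖u x‖ ≤ m⁻¹ * (K * Real.exp (-‖x - x₀‖ ^ 2 / (2 * h))) := by
          gcongr
          exact hu4 x hx
      _ ≤ m⁻¹ * (K * (W + 1) * Real.exp (-‖x - x₀‖ ^ 2 / (2 * h))) := by gcongr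
      _ = m⁻¹ * (K * (W + 1)) * Real.exp (-‖x - x₀‖ ^ 2 / (2 * h)) := by ring
      _ ≤ _ := by gcongr
  · have hE := Real.exp_pos (-δ / h)
    refine (eLpNorm_le_of_bound (c := m⁻¹ * (K * (e h + Real.exp (-δ / h)))) hΩ.measurableSet hvol
      fun x hx => ?_).trans (ENNReal.ofReal_le_ofReal ?_)
    · rw [opPz_const_mul, norm_mul, hmn]
      gcongr
      exact hu3 x hx
    · rw [← hW]
      calc W * (m⁻¹ * (K * (e h + Real.exp (-δ / h)))) ≤
          (W + 1) * (m⁻¹ * (K * (e h + Real.exp (-δ / h)))) := by gcongr; linarith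
        _ = m⁻¹ * (K * (W + 1)) * (e h + Real.exp (-δ / h)) := by ring
        _ ≤ _ := by gcongr

/-- The exponential bound, guarded by the proposition `A`, is part of the property being
diagonalized. One family thus satisfies all polynomial bounds together with the exponential one when
`A` holds. -/
lemma exists_quasimode_of_concentrated {Ω : Set (Euc d)} (hΩ : IsOpen Ω)
    (hb : Bornology.IsBounded Ω) {X : Euc d → Euc d} {x₀ : Euc d} {z : ℂ} {A : Prop} {δ : ℝ}
    (hQ : ∀ N : ℕ, ∀ᶠ h in 𝓝[>] (0 : ℝ), ∃ v, IsConcentrated Ω x₀ h v ∧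
      eLpNorm (opPz X z h v) 2 (volume.restrict Ω) ≤ ENNReal.ofReal (h ^ N) ∧
      (A → eLpNorm (opPz X z h v) 2 (volume.restrict Ω) ≤ ENNReal.ofReal (Real.exp (-δ / h)))) :
    ∃ u : ℝ → Euc d → ℂ, IsSmoothQuasimode Ω X z u ∧ essentialSupport Ω u = {x₀} ∧
      (A → IsBigOL2 Ω (fun h => opPz X z h (u h)) (fun h => Real.exp (-δ / h))) := by
  obtain ⟨u, hu⟩ := exists_diagonal (α := Euc d → ℂ) (by
    have h1 : ∀ᶠ h in 𝓝[>] (0 : ℝ), h < 1 :=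
      (eventually_lt_nhds one_pos).filter_mono nhdsWithin_le_nhds
    filter_upwards [h1, self_mem_nhdsWithin] with h hh1 hh0 M N v hMN hv
    have hh0 : 0 < h := hh0
    exact ⟨hv.1, hv.2.1.trans (ENNReal.ofReal_le_ofReal
      (pow_le_pow_of_le_one hh0.le hh1.le hMN)), hv.2.2⟩) hQ
  refine ⟨u, ⟨?_, ?_, ?_, fun N => ⟨1, ?_⟩⟩, ?_, fun hA => ⟨1, ?_⟩⟩
  · filter_upwards [hu 0] with h hv using ⟨_, hv.1.contDiff, fun _ _ => rfl⟩
  · filter_upwards [hu 0] with h hv using hv.1.dirichlet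
  · filter_upwards [hu 0] with h hv using hv.1.normalized
  · filter_upwards [hu N] with h hv
    rw [one_mul]
    exact hv.2.1
  · refine essentialSupport_eq_singleton hΩ hb (k := d + 1) ?_ ?_ ?_ <;>
      filter_upwards [hu 0] with h hv
    · exact hv.1.contDiff.continuous
    · exact hv.1.normalized
    · exact hv.1.decay
  · filter_upwards [hu 0] with h hv
    rw [one_mul]
    exact hv.2.2 hA

lemma exists_concentrated_quasimode {Ω V : Set (Euc d)} {ρ : Euc d → ℝ} {X : Euc d → Euc d}
    {x₀ ν : Euc d} {z : ℂ} {e : ℝ → ℝ} (hΩ : IsOpen Ω) (hb : Bornology.IsBounded Ω)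
    (hX : Continuous X) (hν : IsOutwardUnitNormal Ω x₀ ν) (hx₀ : 0 < ⟪X x₀, ν⟫)
    (hz : (‖X x₀‖ ^ 2)⁻¹ * z.im ^ 2 < z.re) (hV : IsOpen V) (hx₀V : x₀ ∈ V)
    (hρ : IsDefiningFunctionOn ∞ Ω V ρ) (he : ∀ᶠ h in 𝓝[>] (0 : ℝ), 0 ≤ e h)
    (happ : ∀ i, SPoly.HasApprox (SPoly.coeffFun ρ X i) x₀ e) :
    ∃ δ > 0, ∀ᶠ h in 𝓝[>] (0 : ℝ), ∃ v : Euc d → ℂ, IsConcentrated Ω x₀ h v ∧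
      eLpNorm (opPz X z h v) 2 (volume.restrict Ω) ≤
        ENNReal.ofReal ((h ^ (d + 1))⁻¹ * (e h + Real.exp (-δ / h))) := by
  obtain ⟨hν1, hgrad, hγ⟩ := hν.gradient_eq hΩ hV hx₀V hρ
  obtain ⟨κ, g, l₁, l₂, hκ, hg, h₁, h₂, hfr⟩ := exists_frozenEq hγ hν1 hx₀ hz
  have hd : DifferentiableAt ℝ ρ x₀ :=
    (hρ.contDiffOn.contDiffAt (hV.mem_nhds hx₀V)).differentiableAt (by simp)
  have hβ : (fun j => ((pd j ρ x₀ : ℝ) : ℂ)) = fun j => ((‖gradient ρ x₀‖ * ν j : ℝ) : ℂ) := by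
    funext j
    rw [pd_eq_gradient hd, hgrad]
    simp [norm_smul, hν1]
  obtain ⟨K, hK, δ, hδ, c, hc, hu⟩ := SPoly.exists_cutoff_quasimode hΩ hV hx₀V hν.1 hρ hX hκ hg h₁ h₂
    (fun B Y E => by rw [hβ]; exact hfr B Y E) he happ
  exact ⟨δ, hδ, exists_isConcentrated hΩ hb hK hc he hu⟩

lemma contDiffAt_coeffFun {n : WithTop ℕ∞} (hn : n + 1 ≤ n) {ρ : Euc d → ℝ} {X : Euc d → Euc d}
    {x : Euc d} (hρ : ContDiffAt ℝ n ρ x) (hX : ContDiffAt ℝ n X x) (i : Option (Fin d ⊕ Fin d)) :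
    ContDiffAt ℝ n (SPoly.coeffFun ρ X i) x := by
  match i with
  | none => exact ContDiffAt.sum fun j _ => contDiffAt_pd hn (contDiffAt_pd hn hρ j) j
  | some (Sum.inl j) => exact contDiffAt_pd hn hρ j
  | some (Sum.inr j) => exact contDiffAt_euclidean.1 hX j

/-- If the data are analytic near `x₀`, a single construction gives an exponential error, which
implies every polynomial bound. Otherwise the construction is repeated for each order `N` and the
exponential claim is vacuous. -/
theorem exists_quasimode {Ω : Set (Euc d)} (hΩ : IsOpen Ω) (hb : Bornology.IsBounded Ω)
    {X : Euc d → Euc d} {x₀ ν : Euc d} {z : ℂ} (hX : ContDiff ℝ ∞ X)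
    (hν : IsOutwardUnitNormal Ω x₀ ν) (hx₀ : 0 < ⟪X x₀, ν⟫)
    (hz : (‖X x₀‖ ^ 2)⁻¹ * z.im ^ 2 < z.re) :
    ∃ u : ℝ → Euc d → ℂ, IsSmoothQuasimode Ω X z u ∧ essentialSupport Ω u = {x₀} ∧
      (HasBoundaryOfClassNear ω Ω x₀ → AnalyticAt ℝ X x₀ →
        ∃ δ : ℝ, 0 < δ ∧
          IsBigOL2 Ω (fun h => opPz X z h (u h)) (fun h => Real.exp (-δ / h))) := by
  by_cases hA : HasBoundaryOfClassNear ω Ω x₀ ∧ AnalyticAt ℝ X x₀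
  · obtain ⟨⟨V, ρ, hV, hx₀V, hρ⟩, hXa⟩ := hA
    have happ : ∀ i, ∃ δ : ℝ, 0 < δ ∧
        SPoly.HasApprox (SPoly.coeffFun ρ X i) x₀ fun h => Real.exp (-δ / h) := fun i =>
      SPoly.hasApprox_of_analyticAt (contDiffAt_coeffFun (by simp)
        (hρ.contDiffOn.contDiffAt (hV.mem_nhds hx₀V)) hXa.contDiffAt i).analyticAt
    choose δ hδ happ using happ
    set δ₀ : ℝ := Finset.univ.inf' Finset.univ_nonempty δ with hδ₀
    have hδ₀0 : 0 < δ₀ := (Finset.lt_inf'_iff _).2 fun i _ => hδ i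
    obtain ⟨δ₁, hδ₁, hv⟩ := exists_concentrated_quasimode (e := fun h => Real.exp (-δ₀ / h)) hΩ hb
      hX.continuous hν hx₀ hz hV hx₀V
      ⟨hρ.contDiffOn.of_le le_top, hρ.fderiv_ne_zero, hρ.mem_iff⟩
      (Eventually.of_forall fun h => (Real.exp_pos _).le) fun i => (happ i).mono (by
        filter_upwards [self_mem_nhdsWithin] with h hh0
        have hh0 : 0 < h := hh0
        gcongr
        exact Finset.inf'_le _ (Finset.mem_univ i))
    set δ₂ := min δ₀ δ₁ with hδ₂
    have hδ₂0 : 0 < δ₂ := lt_min hδ₀0 hδ₁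
    -- Half of the exponent `δ₂` is given up to absorb the normalization loss `h ^ (-(d + 1))` and
    -- the factor `2` from adding two errors.
    obtain ⟨u, h1, h2, h3⟩ := exists_quasimode_of_concentrated (z := z) (X := X) (x₀ := x₀)
      (A := True) (δ := δ₂ / 2) hΩ hb (fun N => by
        filter_upwards [hv, self_mem_nhdsWithin,
          eventually_exp_neg_div_le_pow (half_pos hδ₂0) 2 (d + 1),
          eventually_exp_neg_div_le_pow (half_pos hδ₂0) 1 N] with h ⟨v, hv, hv'⟩ hh0 hexp hexpN
        have hh0 : 0 < h := hh0
        have hle : (h ^ (d + 1))⁻¹ * (Real.exp (-δ₀ / h) + Real.exp (-δ₁ / h)) ≤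
            Real.exp (-(δ₂ / 2) / h) := by
          have e0 : Real.exp (-δ₀ / h) ≤ Real.exp (-δ₂ / h) := by
            gcongr
            exact min_le_left _ _
          have e1 : Real.exp (-δ₁ / h) ≤ Real.exp (-δ₂ / h) := by
            gcongr
            exact min_le_right _ _
          have e2 : Real.exp (-δ₂ / h) = Real.exp (-(δ₂ / 2) / h) * Real.exp (-(δ₂ / 2) / h) := by
            rw [← Real.exp_add]
            congr 1
            ring
          rw [inv_mul_le_iff₀ (by positivity)]
          have := mul_le_mul_of_nonneg_right hexp (Real.exp_pos (-(δ₂ / 2) / h)).le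
          linarith
        have hmain := hv'.trans (ENNReal.ofReal_le_ofReal hle)
        rw [one_mul] at hexpN
        exact ⟨v, hv, hmain.trans (ENNReal.ofReal_le_ofReal hexpN), fun _ => hmain⟩)
    exact ⟨u, h1, h2, fun _ _ => ⟨δ₂ / 2, half_pos hδ₂0, h3 trivial⟩⟩
  · obtain ⟨-, V, ρ, hV, hx₀V, hρ, -⟩ := id hν
    obtain ⟨u, h1, h2, -⟩ := exists_quasimode_of_concentrated (z := z) (X := X) (x₀ := x₀)
      (A := False) (δ := 0) hΩ hb (fun N => by
        -- Of the exponent `N + d + 2`, normalization consumes `d + 1`; the one spare power of `h <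
        -- 1 / 2` absorbs the factor `2` from the two errors.
        obtain ⟨δ, hδ, hv⟩ := exists_concentrated_quasimode (e := fun h => h ^ (N + d + 1 + 1)) hΩ hb
          hX.continuous hν hx₀ hz hV hx₀V hρ
          (by filter_upwards [self_mem_nhdsWithin] with h hh0 using pow_nonneg (le_of_lt hh0) _)
          fun i => SPoly.hasApprox_of_contDiffAt (contDiffAt_coeffFun (by simp)
            (hρ.contDiffOn.contDiffAt (hV.mem_nhds hx₀V)) hX.contDiffAt i) (N + d + 1)
        have hsmall : ∀ᶠ h in 𝓝[>] (0 : ℝ), h < 1 / 2 :=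
          (eventually_lt_nhds (by norm_num)).filter_mono nhdsWithin_le_nhds
        filter_upwards [hv, self_mem_nhdsWithin, hsmall,
          eventually_exp_neg_div_le_pow hδ 1 (N + d + 1 + 1)] with h ⟨v, hv, hv'⟩ hh0 hh2 hexp
        have hh0 : 0 < h := hh0
        refine ⟨v, hv, hv'.trans (ENNReal.ofReal_le_ofReal ?_), False.elim⟩
        rw [inv_mul_le_iff₀ (by positivity)]
        have e1 : h ^ (N + d + 1 + 1) = h * (h ^ (d + 1) * h ^ N) := by ring
        have e2 : 0 < h ^ (d + 1) * h ^ N := by positivity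
        rw [one_mul] at hexp
        rw [e1] at hexp ⊢
        nlinarith)
    exact ⟨u, h1, h2, fun ha hb => absurd ⟨ha, hb⟩ hA⟩

end

theorem mainTheorem5 (d : ℕ) (Ω : Set (Euc d)) (hΩ : IsSmoothBoundedDomain Ω)
    (X : Euc d → Euc d) (hX : ContDiff ℝ ∞ X)
    (x₀ ν : Euc d) (hν : IsOutwardUnitNormal Ω x₀ ν) (hx₀ : 0 < ⟪X x₀, ν⟫) :
    (2 ≤ d → ∀ z : ℂ, (‖X x₀‖ ^ 2)⁻¹ * z.im ^ 2 < z.re →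
      z ≠ ((⟪X x₀, ν⟫ ^ 2 / 4 : ℝ) : ℂ) →
      ∃ u : ℝ → Euc d → ℂ, IsSmoothQuasimode Ω X z u ∧ essentialSupport Ω u = {x₀} ∧
        (HasBoundaryOfClassNear ω Ω x₀ → AnalyticAt ℝ X x₀ →
          ∃ δ : ℝ, 0 < δ ∧
            IsBigOL2 Ω (fun h => opPz X z h (u h)) (fun h => Real.exp (-δ / h)))) ∧
    (d = 1 → ∀ z : ℂ, (‖X x₀‖ ^ 2)⁻¹ * z.im ^ 2 < z.re →
      ¬ (z.im = 0 ∧ ⟪X x₀, ν⟫ ^ 2 / 4 ≤ z.re) →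
      ∃ u : ℝ → Euc d → ℂ, IsSmoothQuasimode Ω X z u ∧ essentialSupport Ω u = {x₀} ∧
        (HasBoundaryOfClassNear ω Ω x₀ → AnalyticAt ℝ X x₀ →
          ∃ δ : ℝ, 0 < δ ∧
            IsBigOL2 Ω (fun h => opPz X z h (u h)) (fun h => Real.exp (-δ / h)))) :=
  ⟨fun _ _ hz _ => exists_quasimode hΩ.isOpen hΩ.isBounded hX hν hx₀ hz,
    fun _ _ hz _ => exists_quasimode hΩ.isOpen hΩ.isBounded hX hν hx₀ hz⟩
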